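/- **Notation.** For a $2\times2$ matrix kernel $K(r,r')$ on $\mathbb{R}$ and a weight $\chi:\mathbb{R}\to\mathbb{R}$, the Fredholm Pfaffian is $$\mathrm{Pf}[J-\chi K]=\sum_{n\ge 0}\frac{(-1)^n}{n!}\int_{\mathbb{R}^n}\prod_{p=1}^n\chi(r_p)\,\mathrm{Pf}\big[K(r_i,r_j)\big]_{i,j=1}^n\,dr_1\cdots dr_n,$$ where $[K(r_i,r_j)]_{i,j}$ is made of $n^2$ blocks of size $2\times 2$. For a scalar kernel, $\mathrm{Det}(I-\chi K)=\sum_{n\ge 0}\frac{(-1)^n}{n!}\int_{\mathbb{R}^n}\prod_p\chi(x_p)\det[K(x_i,x_j)]\,dx$. $P_s$ is multiplication by the indicator function of $[s,\infty)$. All matrix kernels below have $K_{21}(r,r')=-K_{12}(r',r)$. Put $$E_{r,r'}(v,w)=\frac{v-w}{v+w}\,e^{-rv-r'w+\frac{v^3+w^3}{3}} .$$ *Hard-wall kernel.* For $t>0$ let $C_v=\alpha_t+i\mathbb{R}$, $C_w=\alpha'_t+i\mathbb{R}$ with arbitrary $\alpha_t,\alpha'_t\in(0,\tfrac12t^{1/3})$,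 and let $K^{(t)}_{11},K^{(t)}_{22},K^{(t)}_{12}$ be $$\int_{C_v}\!\int_{C_w}\frac{dv\,dw}{(2i\pi)^2\,\pi t^{1/3}}\,\Gamma(2vt^{-1/3})\,\Gamma(2wt^{-1/3})\,g(v,w)\,E_{r,r'}(v,w)$$ with $g(v,w)$ equal to $\cos(\pi vt^{-1/3})\cos(\pi wt^{-1/3})$, $\sin(\pi vt^{-1/3})\sin(\pi wt^{-1/3})$, $\cos(\pi vt^{-1/3})\sin(\pi wt^{-1/3})$, respectively. Let $\sigma_{t,z}(r)=\dfrac{z}{z+e^{-t^{1/3}r}}$. *Limit kernels.* Let $C_v=a+i\mathbb{R}$, $C_w=b+i\mathbb{R}$ with arbitrary $a,b>0$. The kernel $K^{\infty}=K^{\infty,t}$ has the entries $$K^\infty_{11}=\frac{t^{1/3}}{4\pi}\iint\frac{dv\,dw}{(2i\pi)^2}\frac{E_{r,r'}(v,w)}{vw},\quad K^\infty_{22}=\frac{\pi}{4t^{1/3}}\iint\frac{dv\,dw}{(2i\pi)^2}E_{r,r'}(v,w),\quad K^\infty_{12}=\frac14\iint\frac{dv\,dw}{(2i\pi)^2}\frac{E_{r,r'}(v,w)}{v},$$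 and $K^{\mathrm{GSE}}$ has the same entries with the prefactors $\frac{t^{1/3}}{4\pi}$ and $\frac{\pi}{4t^{1/3}}$ both replaced by $\frac14$. For $\beta>0$ let $S_\beta$ be the map $K_{11}\mapsto\beta^{-2}K_{11}$, $K_{22}\mapsto\beta^2K_{22}$ that fixes $K_{12},K_{21}$, and let $\beta_t=t^{1/6}/\sqrt\pi$. *Scalar kernel.* With $\mathrm{Ai}(x)=\frac1{2i\pi}\int_{1+i\mathbb{R}}e^{v^3/3-xv}dv$ the Airy function and $K_{\mathrm{Ai}}(x,y)=\int_0^\infty\mathrm{Ai}(x+u)\mathrm{Ai}(y+u)\,du$, $$K^{\mathrm{GLD}}(x,y)=K_{\mathrm{Ai}}(x,y)-\tfrac12\,\mathrm{Ai}(x)\int_0^\infty\mathrm{Ai}(y+z)\,dz .$$ **Theorem.** Let $s\in\mathbb{R}$, and let $z_t=e^{-st^{1/3}}$. 1. For every $t>0$, $S_{\beta_t}K^{\infty,t}=K^{\mathrm{GSE}}$; and for all $r,r'\in\mathbb{R}$, $\;S_{\beta_t}K^{(t)}(r,r')\to K^{\mathrm{GSE}}(r,r')$ entrywise as $t\to+\infty$.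 2. The integrals and series defining $\mathrm{Pf}[J-\sigma_{t,z_t}K^{(t)}]$ (for every $t>0$) and $\mathrm{Pf}[J-P_sK^{\mathrm{GSE}}]$ converge absolutely, and $$\lim_{t\to+\infty}\mathrm{Pf}\big[J-\sigma_{t,z_t}K^{(t)}\big]=\mathrm{Pf}\big[J-P_sK^{\mathrm{GSE}}\big].$$ 3. The integrals and series defining $\mathrm{Det}(I-P_sK^{\mathrm{GLD}})$ and $\mathrm{Pf}[J-P_sK^{\infty,t}]$ (for every $t>0$) converge absolutely, $\mathrm{Det}(I-P_sK^{\mathrm{GLD}})\ge 0$, and for every $t>0$ $$\mathrm{Pf}[J-P_sK^{\infty,t}]=\mathrm{Pf}[J-P_sK^{\mathrm{GSE}}]=\sqrt{\mathrm{Det}(I-P_sK^{\mathrm{GLD}})} .$$ -/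

import Mathlib

open Complex MeasureTheory Filter Topology

noncomputable section

/-- The Pfaffian of a matrix made of `n × n` blocks of size `2 × 2`. The index `(p, i)` stands for
the row or column number `2 p + i` (counted from `0`), so this is the usual
`1 / (2 ^ n n!) ∑ σ, sgn σ ∏ p, A (σ (2 p)) (σ (2 p + 1))`. -/
def blockPfaffian {n : ℕ} (A : Matrix (Fin n × Fin 2) (Fin n × Fin 2) ℂ) : ℂ :=
  (1 / ((2 : ℂ) ^ n * (n.factorial : ℂ))) *
    ∑ σ : Equiv.Perm (Fin n × Fin 2),
      ((Equiv.Perm.sign σ : ℤ) : ℂ) * ∏ p : Fin n, A (σ (p, 0)) (σ (p, 1))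

/-- The matrix with the `2 × 2` blocks `K (r p) (r q)`. -/
def blockMatrix (K : ℝ → ℝ → Matrix (Fin 2) (Fin 2) ℂ) {n : ℕ} (r : Fin n → ℝ) :
    Matrix (Fin n × Fin 2) (Fin n × Fin 2) ℂ :=
  Matrix.of fun x y => K (r x.1) (r y.1) x.2 y.2

/-- The integrand of the `n`-th term of the Fredholm Pfaffian `Pf[J - χ K]`. -/
def pfaffianIntegrand (χ : ℝ → ℝ) (K : ℝ → ℝ → Matrix (Fin 2) (Fin 2) ℂ) (n : ℕ)
    (r : Fin n → ℝ) : ℂ :=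
  ((∏ p, χ (r p) : ℝ) : ℂ) * blockPfaffian (blockMatrix K r)

/-- The Fredholm Pfaffian
`Pf[J - χ K] = ∑ n, (-1) ^ n / n! ∫ (∏ p, χ (r p)) Pf[K (r i) (r j)] dr`. -/
def fredholmPfaffian (χ : ℝ → ℝ) (K : ℝ → ℝ → Matrix (Fin 2) (Fin 2) ℂ) : ℂ :=
  ∑' n : ℕ, ((-1 : ℂ) ^ n / (n.factorial : ℂ)) * ∫ r : Fin n → ℝ, pfaffianIntegrand χ K n r

/-- Absolute convergence of all the integrals and of the series that define `Pf[J - χ K]`. -/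
def FredholmPfaffianConverges (χ : ℝ → ℝ) (K : ℝ → ℝ → Matrix (Fin 2) (Fin 2) ℂ) : Prop :=
  (∀ n : ℕ, Integrable (pfaffianIntegrand χ K n)) ∧
    Summable fun n : ℕ => (1 / (n.factorial : ℝ)) * ∫ r : Fin n → ℝ, ‖pfaffianIntegrand χ K n r‖

/-- The integrand of the `n`-th term of the Fredholm determinant `Det(I - χ K)`. -/
def detIntegrand (χ : ℝ → ℝ) (K : ℝ → ℝ → ℝ) (n : ℕ) (x : Fin n → ℝ) : ℝ :=
  (∏ p, χ (x p)) * (Matrix.of fun i j : Fin n => K (x i) (x j)).det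

/-- The Fredholm determinant
`Det(I - χ K) = ∑ n, (-1) ^ n / n! ∫ (∏ p, χ (x p)) det[K (x i) (x j)] dx`. -/
def fredholmDet (χ : ℝ → ℝ) (K : ℝ → ℝ → ℝ) : ℝ :=
  ∑' n : ℕ, ((-1 : ℝ) ^ n / (n.factorial : ℝ)) * ∫ x : Fin n → ℝ, detIntegrand χ K n x

/-- Absolute convergence of all the integrals and of the series that define `Det(I - χ K)`. -/
def FredholmDetConverges (χ : ℝ → ℝ) (K : ℝ → ℝ → ℝ) : Prop :=
  (∀ n : ℕ, Integrable (detIntegrand χ K n)) ∧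
    Summable fun n : ℕ => (1 / (n.factorial : ℝ)) * ∫ x : Fin n → ℝ, ‖detIntegrand χ K n x‖

/-- The function by which the projector `P_s` onto `[s, ∞)` multiplies. -/
def cutoff (s : ℝ) : ℝ → ℝ := Set.indicator (Set.Ici s) 1

/-- The Fermi factor `z / (z + exp (- t ^ (1/3) r))`. -/
def fermiFactor (t z r : ℝ) : ℝ := z / (z + Real.exp (-(t ^ (1 / 3 : ℝ)) * r))

/-- `∫_{a + iℝ} ∫_{b + iℝ} F (v, w) dv dw / (2 i π) ^ 2`, with `v = a + i y`, `dv = i dy`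
and `w = b + i y'`, `dw = i dy'`. -/
def doubleContour (a b : ℝ) (F : ℂ → ℂ → ℂ) : ℂ :=
  (1 / (2 * I * (Real.pi : ℂ)) ^ 2) *
    ∫ p : ℝ × ℝ, F ((a : ℂ) + (p.1 : ℂ) * I) ((b : ℂ) + (p.2 : ℂ) * I) * I * I

/-- The factor common to all the entries of the kernels. -/
def contourWeight (r r' : ℝ) (v w : ℂ) : ℂ :=
  ((v - w) / (v + w)) * exp (-(r : ℂ) * v - (r' : ℂ) * w + (v ^ 3 + w ^ 3) / 3)

/-- The matrix kernel with diagonal entries `K₁₁`, `K₂₂`, with upper right entry `K₁₂`, and with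
`K₂₁ (r, r') = - K₁₂ (r', r)`. -/
def skewKernel (K11 K22 K12 : ℝ → ℝ → ℂ) : ℝ → ℝ → Matrix (Fin 2) (Fin 2) ℂ :=
  fun r r' => !![K11 r r', K12 r r'; -K12 r' r, K22 r r']

/-- The finite-time matrix kernel of the hard wall, with the contours `a + iℝ` and `b + iℝ`. -/
def hardWallKernel (t a b : ℝ) : ℝ → ℝ → Matrix (Fin 2) (Fin 2) ℂ :=
  let τ : ℂ := ((t ^ (-(1 / 3) : ℝ) : ℝ) : ℂ)
  let π : ℂ := (Real.pi : ℂ)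
  skewKernel
    (fun r r' => doubleContour a b fun v w => (τ / π) * Gamma (2 * v * τ) * Gamma (2 * w * τ) *
      cos (π * v * τ) * cos (π * w * τ) * contourWeight r r' v w)
    (fun r r' => doubleContour a b fun v w => (τ / π) * Gamma (2 * v * τ) * Gamma (2 * w * τ) *
      sin (π * v * τ) * sin (π * w * τ) * contourWeight r r' v w)
    (fun r r' => doubleContour a b fun v w => (τ / π) * Gamma (2 * v * τ) * Gamma (2 * w * τ) *
      cos (π * v * τ) * sin (π * w * τ) * contourWeight r r' v w)

/-- The leading large-time form `K^∞` of the hard-wall kernel, with its time prefactors. -/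
def largeTimeKernel (t a b : ℝ) : ℝ → ℝ → Matrix (Fin 2) (Fin 2) ℂ :=
  let c : ℂ := ((t ^ (1 / 3 : ℝ) : ℝ) : ℂ)
  let π : ℂ := (Real.pi : ℂ)
  skewKernel
    (fun r r' => (c / (4 * π)) * doubleContour a b fun v w => 1 / (v * w) * contourWeight r r' v w)
    (fun r r' => (π / (4 * c)) * doubleContour a b fun v w => contourWeight r r' v w)
    (fun r r' => (1 / 4) * doubleContour a b fun v w => 1 / v * contourWeight r r' v w)

/-- The GSE matrix kernel. -/
def gseKernel (a b : ℝ) : ℝ → ℝ → Matrix (Fin 2) (Fin 2) ℂ :=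
  skewKernel
    (fun r r' => (1 / 4) * doubleContour a b fun v w => 1 / (v * w) * contourWeight r r' v w)
    (fun r r' => (1 / 4) * doubleContour a b fun v w => contourWeight r r' v w)
    (fun r r' => (1 / 4) * doubleContour a b fun v w => 1 / v * contourWeight r r' v w)

/-- The symmetry `K₁₁ ↦ K₁₁ / β²`, `K₂₂ ↦ β² K₂₂`, which leaves `K₁₂` and `K₂₁` unchanged. -/
def betaRescale (β : ℝ) (K : ℝ → ℝ → Matrix (Fin 2) (Fin 2) ℂ) :
    ℝ → ℝ → Matrix (Fin 2) (Fin 2) ℂ :=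
  fun r r' => !![K r r' 0 0 / (β : ℂ) ^ 2, K r r' 0 1; K r r' 1 0, (β : ℂ) ^ 2 * K r r' 1 1]

/-- The Airy function `Ai(x) = (1 / (2 i π)) ∫_{1 + iℝ} exp (v ^ 3 / 3 - x v) dv`. This integral
converges absolutely, and its value is real: changing the sign of `y` conjugates the integrand of
the resulting `(1 / 2 π) ∫ exp ((1 + i y) ^ 3 / 3 - x (1 + i y)) dy`. -/
def airyAi (x : ℝ) : ℝ :=
  ((1 / (2 * I * (Real.pi : ℂ))) *
    ∫ y : ℝ, exp ((1 + (y : ℂ) * I) ^ 3 / 3 - (x : ℂ) * (1 + (y : ℂ) * I)) * I).re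

/-- The Airy kernel. -/
def airyKernel (x y : ℝ) : ℝ := ∫ u in Set.Ioi (0 : ℝ), airyAi (x + u) * airyAi (y + u)

/-- The scalar kernel of Gueudré and Le Doussal. -/
def gldKernel (x y : ℝ) : ℝ :=
  airyKernel x y - (1 / 2) * airyAi x * ∫ u in Set.Ioi (0 : ℝ), airyAi (y + u)

end

/-! The first two parts are contour analysis. With τ = t^(-1/3), the rescaling has β² = 1/(πτ), and
it turns the hard-wall entries into double contour integrals with the symbols τ Γ(2vτ) cos(πvτ) and
Γ(2vτ) sin(πvτ)/π. As τ → 0 these tend to 1/(2v) and 1/2, the symbols of the GSE kernel. The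
rescaling is a congruence by a matrix of determinant 1, which no Pfaffian sees. By Cauchy's theorem
the entries do not depend on the contours, and exp(v³/3) has Gaussian modulus on every vertical line
of positive abscissa. Hadamard's inequality bounds the n-th term of a Fredholm series by (2n)^(n/2)
(∫ G)^n / n!, so dominated convergence applies to the entries, to the integrals and to the series
(`fredholmPfaffian_tendsto`). To the left of s, the Fermi factor absorbs the growth exp(-2ar) of the
kernel as long as 2a < t^(1/3).

The third part rests on identities between finite matrices that are exact before any limit. Let B(x)
= ∫_0^∞ Ai(x + u) du, let H be the Hankel matrix of the sequence B(s + nh), S the truncated shift, E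
the projection onto the first basis vector, and W = S - Sᵀ. The GSE kernel discretized with mesh h
has the finite Fredholm Pfaffian Pf(J - h Xᵀ W X / 4), where the rows of Xᵀ hold the values of B and
of its difference quotients. Summation by parts gives h X J Xᵀ = -HWH, so the square of this
Pfaffian is det(1 - WHWH/4), which is det(1 - WH/2)² because W is antisymmetric and H symmetric.
Scaling the kernel down to zero settles the sign: the Pfaffian is det(1 - WH/2)
(`pfaffian_blockJ_sub`).

Since SᵀS = 1 - E, one has W - E = (1 + Sᵀ)(S - 1), hence WH/2 = -T + EH/2 with T = (1 + Sᵀ)(1 -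
S)H/2. Here T discretizes the operator on [s, ∞) with kernel Ai(x + y - s), whose square is the Airy
kernel, and the corner E produces the rank-one term of the scalar kernel. Two exact formulas follow.
The first, det(1 - WH/2)² = det(1 - T(T - EH/2)), tends to the scalar Fredholm determinant
(`det_one_sub_quarter_skewShift`). The second, det(1 - WH/2) = (det(1 + T) + det(1 - T))/2, tends to
half the sum of the Fredholm determinants with the kernels ±Ai(x + y - s)
(`det_one_sub_half_skewShift`). This second limit picks the sign of the square root: the operator
with kernel Ai(x + y - s) is a contraction, so both determinants are nonnegative. The contraction
property comes from moving the Airy contour to an abscissa that tends to 0 (`abs_airyForm_le`). -/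

/-- The Pfaffian of a matrix made of `2 × 2` blocks indexed by a finite type of sites. -/
noncomputable def pfaffian {ι : Type*} [Fintype ι] [DecidableEq ι]
    (A : Matrix (ι × Fin 2) (ι × Fin 2) ℂ) : ℂ :=
  (1 / ((2 : ℂ) ^ Fintype.card ι * ((Fintype.card ι).factorial : ℂ))) *
    ∑ σ : Equiv.Perm (ι × Fin 2),
      ((Equiv.Perm.sign σ : ℤ) : ℂ) * ∏ p : ι, A (σ (p, 0)) (σ (p, 1))

/-! ### Pfaffians as sums over all permutations: congruence and antisymmetrization. -/

section Pfaffian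

variable {ι κ : Type*} [Fintype ι] [DecidableEq ι] [Fintype κ] [DecidableEq κ]

theorem blockPfaffian_eq_pfaffian {n : ℕ} (A : Matrix (Fin n × Fin 2) (Fin n × Fin 2) ℂ) :
    blockPfaffian A = pfaffian A := by
  simp [blockPfaffian, pfaffian]

theorem pfaffian_smul (c : ℂ) (A : Matrix (ι × Fin 2) (ι × Fin 2) ℂ) :
    pfaffian (c • A) = c ^ Fintype.card ι * pfaffian A := by
  unfold pfaffian
  simp only [Matrix.smul_apply, smul_eq_mul, Finset.prod_mul_distrib, Finset.prod_const,
    Finset.card_univ]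
  rw [mul_left_comm, Finset.mul_sum (a := c ^ _)]
  congr 2
  ext σ
  ring

theorem continuous_pfaffian {X : Type*} [TopologicalSpace X]
    {A : X → Matrix (ι × Fin 2) (ι × Fin 2) ℂ} (hA : Continuous A) :
    Continuous fun x => pfaffian (A x) := by
  unfold pfaffian
  fun_prop

theorem pfaffian_submatrix_equiv (e : κ ≃ ι) (A : Matrix (ι × Fin 2) (ι × Fin 2) ℂ) :
    pfaffian (A.submatrix (Prod.map e id) (Prod.map e id)) = pfaffian A := by
  unfold pfaffian
  rw [Fintype.card_congr e]
  congr 1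
  let e' : κ × Fin 2 ≃ ι × Fin 2 := Equiv.prodCongr e (Equiv.refl _)
  refine Fintype.sum_equiv e'.permCongr _ _ fun σ => ?_
  rw [Equiv.Perm.sign_permCongr]
  congr 1
  refine Fintype.prod_equiv e _ _ fun p => ?_
  simp [e', Equiv.permCongr_apply, Matrix.submatrix_apply]

/-- The rows that a choice of an ordered pair for each site singles out. -/
def pairRows (g : ι → (ι × Fin 2) × (ι × Fin 2)) (x : ι × Fin 2) : ι × Fin 2 :=
  if x.2 = 0 then (g x.1).1 else (g x.1).2

/-- Each entry of BᵀAB is a sum over pairs of rows of B. For a fixed choice g of pairs, the signed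
sum over σ is the determinant of the matrix of chosen rows, which is a 0-1 matrix times B, even if g
repeats a row. So det B factors out, and what remains does not involve B. -/
theorem sum_sign_mul_congr (A B : Matrix (ι × Fin 2) (ι × Fin 2) ℂ) :
    ∑ σ : Equiv.Perm (ι × Fin 2), ((Equiv.Perm.sign σ : ℤ) : ℂ) *
      ∏ p : ι, (B.transpose * A * B) (σ (p, 0)) (σ (p, 1)) =
    B.det * ∑ g : ι → (ι × Fin 2) × (ι × Fin 2), (∏ p, A (g p).1 (g p).2) *
      ((1 : Matrix (ι × Fin 2) (ι × Fin 2) ℂ).submatrix (pairRows g) id).det := by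
  have h1 : ∀ x y, (B.transpose * A * B) x y =
      ∑ z : (ι × Fin 2) × (ι × Fin 2), A z.1 z.2 * (B z.1 x * B z.2 y) := by
    intro x y
    rw [Fintype.sum_prod_type, Finset.sum_comm, Matrix.mul_apply]
    refine Finset.sum_congr rfl fun l _ => ?_
    rw [Matrix.mul_apply, Finset.sum_mul]
    refine Finset.sum_congr rfl fun k _ => ?_
    simp only [Matrix.transpose_apply]
    ring
  have h2 : ∀ g : ι → (ι × Fin 2) × (ι × Fin 2), (B.submatrix (pairRows g) id).det =
      ∑ σ : Equiv.Perm (ι × Fin 2), ((Equiv.Perm.sign σ : ℤ) : ℂ) *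
        ∏ p : ι, (B (g p).1 (σ (p, 0)) * B (g p).2 (σ (p, 1))) := by
    intro g
    rw [← Matrix.det_transpose, Matrix.det_apply']
    refine Finset.sum_congr rfl fun σ _ => ?_
    rw [Fintype.prod_prod_type]
    simp [pairRows]
  have h3 : ∀ g : ι → (ι × Fin 2) × (ι × Fin 2), (B.submatrix (pairRows g) id).det =
      ((1 : Matrix (ι × Fin 2) (ι × Fin 2) ℂ).submatrix (pairRows g) id).det * B.det := by
    intro g
    rw [← Matrix.det_mul]
    congr 1
    ext x y
    simp [Matrix.mul_apply, Matrix.one_apply]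
  simp_rw [h1, Fintype.prod_sum, Finset.mul_sum]
  rw [Finset.sum_comm]
  refine Finset.sum_congr rfl fun g _ => ?_
  rw [← mul_assoc, mul_comm B.det, mul_assoc, mul_comm B.det, ← h3, h2, Finset.mul_sum]
  refine Finset.sum_congr rfl fun σ _ => ?_
  rw [Finset.prod_mul_distrib]
  ring

theorem pfaffian_congruence (A B : Matrix (ι × Fin 2) (ι × Fin 2) ℂ) :
    pfaffian (B.transpose * A * B) = B.det * pfaffian A := by
  -- The cofactor of det B is the same for every B, so B = 1 identifies it.
  have h := sum_sign_mul_congr A 1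
  simp only [Matrix.transpose_one, Matrix.one_mul, Matrix.mul_one, Matrix.det_one, one_mul] at h
  unfold pfaffian
  rw [sum_sign_mul_congr, h]
  ring

/-- A Pfaffian only depends on the antisymmetric part. -/
theorem pfaffian_antisymm (A : Matrix (ι × Fin 2) (ι × Fin 2) ℂ) :
    pfaffian ((1 / 2 : ℂ) • (A - A.transpose)) = pfaffian A := by
  classical
  -- Antisymmetrization is performed one site at a time: s is the set of sites already treated.
  have key : ∀ s : Finset ι, ∑ σ : Equiv.Perm (ι × Fin 2), ((Equiv.Perm.sign σ : ℤ) : ℂ) *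
      (∏ p ∈ s, ((1 / 2 : ℂ) • (A - A.transpose)) (σ (p, 0)) (σ (p, 1))) *
        ∏ p ∈ sᶜ, A (σ (p, 0)) (σ (p, 1)) =
      ∑ σ : Equiv.Perm (ι × Fin 2), ((Equiv.Perm.sign σ : ℤ) : ℂ) *
        ∏ p, A (σ (p, 0)) (σ (p, 1)) := by
    intro s
    induction s using Finset.induction_on with
    | empty => simp
    | insert q s hq ih =>
      rw [← ih]
      set D := (1 / 2 : ℂ) • (A - A.transpose) with hD
      let R : Equiv.Perm (ι × Fin 2) → ℂ := fun σ =>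
        (∏ p ∈ s, D (σ (p, 0)) (σ (p, 1))) * ∏ p ∈ (insert q s)ᶜ, A (σ (p, 0)) (σ (p, 1))
      have e1 : ∀ σ : Equiv.Perm (ι × Fin 2), ((Equiv.Perm.sign σ : ℤ) : ℂ) *
          (∏ p ∈ insert q s, D (σ (p, 0)) (σ (p, 1))) *
            ∏ p ∈ (insert q s)ᶜ, A (σ (p, 0)) (σ (p, 1)) =
          (1 / 2) * (((Equiv.Perm.sign σ : ℤ) : ℂ) * A (σ (q, 0)) (σ (q, 1)) * R σ) -
          (1 / 2) * (((Equiv.Perm.sign σ : ℤ) : ℂ) * A (σ (q, 1)) (σ (q, 0)) * R σ) := by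
        intro σ
        rw [Finset.prod_insert hq]
        have : D (σ (q, 0)) (σ (q, 1)) =
            (1 / 2) * (A (σ (q, 0)) (σ (q, 1)) - A (σ (q, 1)) (σ (q, 0))) := by
          simp [hD]
        rw [this]
        simp only [R]
        ring
      have e2 : ∀ σ : Equiv.Perm (ι × Fin 2), ((Equiv.Perm.sign σ : ℤ) : ℂ) *
          (∏ p ∈ s, D (σ (p, 0)) (σ (p, 1))) * ∏ p ∈ sᶜ, A (σ (p, 0)) (σ (p, 1)) =
          ((Equiv.Perm.sign σ : ℤ) : ℂ) * A (σ (q, 0)) (σ (q, 1)) * R σ := by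
        intro σ
        have : sᶜ = insert q (insert q s)ᶜ := by
          ext p
          simp only [Finset.mem_compl, Finset.mem_insert]
          by_cases h : p = q <;> simp [h, hq]
        rw [this, Finset.prod_insert (by simp)]
        simp only [R]
        ring
      let τ : Equiv.Perm (ι × Fin 2) := Equiv.swap (q, 0) (q, 1)
      -- Composing with the transposition of the two indices of q changes the sign and leaves the
      -- factors of the other sites alone.
      have e3 : ∑ σ : Equiv.Perm (ι × Fin 2),
          ((Equiv.Perm.sign σ : ℤ) : ℂ) * A (σ (q, 1)) (σ (q, 0)) * R σ =
          - ∑ σ : Equiv.Perm (ι × Fin 2),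
          ((Equiv.Perm.sign σ : ℤ) : ℂ) * A (σ (q, 0)) (σ (q, 1)) * R σ := by
        rw [← Equiv.sum_comp (Equiv.mulRight τ), ← Finset.sum_neg_distrib]
        refine Finset.sum_congr rfl fun σ _ => ?_
        have hR : R (σ * τ) = R σ := by
          have hne : ∀ p i, p ≠ q → τ (p, i) = (p, i) := by
            intro p i hp
            apply Equiv.swap_apply_of_ne_of_ne <;> simp [hp]
          simp only [R]
          congr 1
          · refine Finset.prod_congr rfl fun p hp => ?_
            have : p ≠ q := fun h => hq (h ▸ hp)
            simp [Equiv.Perm.mul_apply, hne p _ this]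
          · refine Finset.prod_congr rfl fun p hp => ?_
            have : p ≠ q := by
              rintro rfl
              simp at hp
            simp [Equiv.Perm.mul_apply, hne p _ this]
        simp only [Equiv.coe_mulRight, hR, Equiv.Perm.sign_mul]
        simp [τ, Equiv.Perm.sign_swap]
      simp_rw [e1, e2]
      rw [Finset.sum_sub_distrib, ← Finset.mul_sum, ← Finset.mul_sum, e3]
      ring
  have := key Finset.univ
  simp only [Finset.compl_univ, Finset.prod_empty, mul_one] at this
  unfold pfaffian
  rw [this]

end Pfaffian

/-! ### Dependence of the Pfaffian on one diagonal block. -/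

section PfaffianSite

variable {ι : Type*} [DecidableEq ι]

/-- The standard symplectic `2 × 2` block at the site `q`. -/
def siteJ (q : ι) : Matrix (ι × Fin 2) (ι × Fin 2) ℂ :=
  Matrix.of fun x y => (if x = (q, 0) ∧ y = (q, 1) then 1 else 0) -
    (if x = (q, 1) ∧ y = (q, 0) then 1 else 0)

/-- The restriction of a block matrix to the sites other than `q`. -/
def removeSite (A : Matrix (ι × Fin 2) (ι × Fin 2) ℂ) (q : ι) :
    Matrix ({i // i ≠ q} × Fin 2) ({i // i ≠ q} × Fin 2) ℂ :=
  A.submatrix (Prod.map Subtype.val id) (Prod.map Subtype.val id)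

theorem siteJ_eq_zero_of_fst_ne {q : ι} {x : ι × Fin 2} (h : x.1 ≠ q) (y : ι × Fin 2) :
    siteJ q x y = 0 := by
  have h1 : ∀ i, x ≠ (q, i) := fun i hi => h (by rw [hi])
  simp [siteJ, h1]

theorem siteJ_eq_zero_of_snd_ne {q : ι} {y : ι × Fin 2} (h : y.1 ≠ q) (x : ι × Fin 2) :
    siteJ q x y = 0 := by
  have h1 : ∀ i, y ≠ (q, i) := fun i hi => h (by rw [hi])
  simp [siteJ, h1]

theorem siteJ_self (q : ι) : siteJ q (q, 0) (q, 1) = 1 ∧ siteJ q (q, 1) (q, 0) = -1 ∧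
    siteJ q (q, 0) (q, 0) = 0 ∧ siteJ q (q, 1) (q, 1) = 0 := by
  simp [siteJ]

variable [Fintype ι]

/-- A factor of `siteJ q` survives only if σ sends the two indices of a site p onto those of q. As σ
is injective, at most one p does this, so the product has no term of order two or more in d. -/
theorem prod_add_siteJ (A : Matrix (ι × Fin 2) (ι × Fin 2) ℂ) (d : ℂ) (q : ι)
    (σ : Equiv.Perm (ι × Fin 2)) :
    ∏ p : ι, (A + d • siteJ q) (σ (p, 0)) (σ (p, 1)) =
      ∏ p : ι, A (σ (p, 0)) (σ (p, 1)) + d * ∑ p : ι, siteJ q (σ (p, 0)) (σ (p, 1)) *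
        ∏ p' ∈ Finset.univ.erase p, A (σ (p', 0)) (σ (p', 1)) := by
  by_cases h : ∃ p₀, siteJ q (σ (p₀, 0)) (σ (p₀, 1)) ≠ 0
  · obtain ⟨p₀, hp₀⟩ := h
    have hz : ∀ p, p ≠ p₀ → siteJ q (σ (p, 0)) (σ (p, 1)) = 0 := by
      intro p hp
      have h0 : ((σ (p₀, 0) = (q, 0) ∧ σ (p₀, 1) = (q, 1)) ∨
          (σ (p₀, 0) = (q, 1) ∧ σ (p₀, 1) = (q, 0))) := by
        by_contra hc
        push Not at hc
        apply hp₀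
        simp only [siteJ, Matrix.of_apply]
        rw [if_neg (by tauto), if_neg (by tauto), sub_zero]
      apply siteJ_eq_zero_of_fst_ne
      intro hq
      have hq' : σ (p, 0) = (q, 0) ∨ σ (p, 0) = (q, 1) := by
        rcases h : σ (p, 0) with ⟨a, i⟩
        rw [h] at hq
        simp only at hq
        subst hq
        fin_cases i <;> simp
      have inj : ∀ i, σ (p, 0) ≠ σ (p₀, i) := fun i hi => hp (by
        simpa using congrArg Prod.fst (σ.injective hi))
      rcases h0 with ⟨h1, h2⟩ | ⟨h1, h2⟩ <;> rcases hq' with h3 | h3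
      · exact inj 0 (h3.trans h1.symm)
      · exact inj 1 (h3.trans h2.symm)
      · exact inj 1 (h3.trans h2.symm)
      · exact inj 0 (h3.trans h1.symm)
    rw [Finset.sum_eq_single p₀ (fun p _ hp => by rw [hz p hp, zero_mul]) (by simp),
      ← Finset.mul_prod_erase _ _ (Finset.mem_univ p₀),
      ← Finset.mul_prod_erase Finset.univ (fun p => A (σ (p, 0)) (σ (p, 1)))
        (Finset.mem_univ p₀)]
    have : ∏ p ∈ Finset.univ.erase p₀, (A + d • siteJ q) (σ (p, 0)) (σ (p, 1)) =
        ∏ p ∈ Finset.univ.erase p₀, A (σ (p, 0)) (σ (p, 1)) := by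
      refine Finset.prod_congr rfl fun p hp => ?_
      simp [hz p (Finset.ne_of_mem_erase hp)]
    rw [this]
    simp only [Matrix.add_apply, Matrix.smul_apply, smul_eq_mul]
    ring
  · push Not at h
    simp [h]

/-- The product over the sites other than `q` is a sum over the permutations of these sites. -/
theorem sum_perm_fix_site (A : Matrix (ι × Fin 2) (ι × Fin 2) ℂ) (q : ι) :
    (∑ σ : Equiv.Perm (ι × Fin 2), if σ (q, 0) = (q, 0) ∧ σ (q, 1) = (q, 1) then
      ((Equiv.Perm.sign σ : ℤ) : ℂ) * ∏ p ∈ Finset.univ.erase q, A (σ (p, 0)) (σ (p, 1)) else 0) =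
    ∑ σ : Equiv.Perm ({i // i ≠ q} × Fin 2), ((Equiv.Perm.sign σ : ℤ) : ℂ) *
      ∏ p, removeSite A q (σ (p, 0)) (σ (p, 1)) := by
  classical
  let P : ι × Fin 2 → Prop := fun x => x.1 ≠ q
  let e : {x // P x} ≃ {i // i ≠ q} × Fin 2 := Equiv.prodSubtypeFstEquivSubtypeProd (p := (· ≠ q))
  have hval : ∀ y, ((e.symm y : {x // P x}) : ι × Fin 2) = (y.1.1, y.2) := fun y => rfl
  rw [← Equiv.sum_comp e.permCongr,
    ← Equiv.sum_comp (Equiv.Perm.subtypeEquivSubtypePerm P).symm, ← Finset.sum_filter]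
  have hfil : ∀ σ : Equiv.Perm (ι × Fin 2), σ ∈ Finset.univ.filter
      (fun σ : Equiv.Perm (ι × Fin 2) => σ (q, 0) = (q, 0) ∧ σ (q, 1) = (q, 1)) ↔
      ∀ a, ¬ P a → σ a = a := by
    intro σ
    simp only [Finset.mem_filter, Finset.mem_univ, true_and, P, not_not]
    constructor
    · rintro ⟨h0, h1⟩ ⟨a, i⟩ rfl
      fin_cases i
      · exact h0
      · exact h1
    · exact fun h => ⟨h _ rfl, h _ rfl⟩
  rw [Finset.sum_subtype _ hfil]
  refine Finset.sum_congr rfl fun σ _ => ?_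
  obtain ⟨τ, rfl⟩ := (Equiv.Perm.subtypeEquivSubtypePerm P).surjective σ
  rw [Equiv.symm_apply_apply, Equiv.Perm.sign_permCongr]
  have hc : ((Equiv.Perm.subtypeEquivSubtypePerm P τ : {f : Equiv.Perm (ι × Fin 2) //
      ∀ a, ¬ P a → f a = a}) : Equiv.Perm (ι × Fin 2)) = Equiv.Perm.ofSubtype τ := rfl
  rw [hc, Equiv.Perm.sign_ofSubtype]
  congr 1
  rw [Finset.prod_subtype (Finset.univ.erase q) (p := (· ≠ q)) (by simp)]
  refine Finset.prod_congr rfl fun p _ => ?_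
  have h : ∀ i, Equiv.Perm.ofSubtype τ ((p : ι), i) =
      Prod.map Subtype.val id (e.permCongr τ (p, i)) := by
    intro i
    rw [Equiv.Perm.ofSubtype_apply_of_mem τ (show P ((p : ι), i) from p.2)]
    rfl
  rw [h, h]
  rfl

/-- Exchanging the sites p and q reduces to p = q. Then σ either fixes the two indices of q or
exchanges them. The second case carries a minus sign from `siteJ` and another from the parity of σ,
so it repeats the first: hence the factor 2. -/
theorem sum_sign_siteJ (A : Matrix (ι × Fin 2) (ι × Fin 2) ℂ) (q p : ι) :
    ∑ σ : Equiv.Perm (ι × Fin 2), ((Equiv.Perm.sign σ : ℤ) : ℂ) *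
      (siteJ q (σ (p, 0)) (σ (p, 1)) * ∏ p' ∈ Finset.univ.erase p, A (σ (p', 0)) (σ (p', 1))) =
    2 * ∑ σ : Equiv.Perm ({i // i ≠ q} × Fin 2), ((Equiv.Perm.sign σ : ℤ) : ℂ) *
      ∏ p, removeSite A q (σ (p, 0)) (σ (p, 1)) := by
  let τ : Equiv.Perm (ι × Fin 2) := Equiv.prodCongrLeft fun _ => Equiv.swap p q
  have hτ : ∀ a i, τ (a, i) = (Equiv.swap p q a, i) := fun a i => rfl
  -- Exchanging two sites moves two pairs of indices, an even permutation.
  have hs : Equiv.Perm.sign τ = 1 := by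
    simp only [τ, Equiv.Perm.sign_prodCongrLeft, Finset.prod_const, Finset.card_univ,
      Fintype.card_fin, Int.units_sq]
  rw [← Equiv.sum_comp (Equiv.mulRight τ)]
  have h1 : ∀ σ : Equiv.Perm (ι × Fin 2),
      ∏ p' ∈ Finset.univ.erase p, A ((σ * τ) (p', 0)) ((σ * τ) (p', 1)) =
      ∏ p' ∈ Finset.univ.erase q, A (σ (p', 0)) (σ (p', 1)) := by
    intro σ
    refine Finset.prod_equiv (Equiv.swap p q) ?_ ?_
    · intro i
      simp only [Finset.mem_erase, Finset.mem_univ, and_true]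
      rw [not_iff_not, Equiv.swap_apply_eq_iff, Equiv.swap_apply_right]
    · intro i _
      simp [Equiv.Perm.mul_apply, hτ]
  let ρ : Equiv.Perm (ι × Fin 2) := Equiv.swap (q, 0) (q, 1)
  have hρ : ∀ p' i, p' ≠ q → ρ (p', i) = (p', i) := by
    intro p' i hp
    apply Equiv.swap_apply_of_ne_of_ne <;> simp [hp]
  let R : Equiv.Perm (ι × Fin 2) → ℂ := fun σ => ((Equiv.Perm.sign σ : ℤ) : ℂ) *
    ∏ p ∈ Finset.univ.erase q, A (σ (p, 0)) (σ (p, 1))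
  have hR : ∀ σ, R (σ * ρ) = - R σ := by
    intro σ
    have : ∏ p ∈ Finset.univ.erase q, A ((σ * ρ) (p, 0)) ((σ * ρ) (p, 1)) =
        ∏ p ∈ Finset.univ.erase q, A (σ (p, 0)) (σ (p, 1)) :=
      Finset.prod_congr rfl fun p hp => by
        simp [Equiv.Perm.mul_apply, hρ p _ (Finset.ne_of_mem_erase hp)]
    simp only [R, this, Equiv.Perm.sign_mul]
    simp [ρ]
  have h2 : ∑ σ : Equiv.Perm (ι × Fin 2),
      (if σ (q, 0) = (q, 1) ∧ σ (q, 1) = (q, 0) then R σ else 0) =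
      - ∑ σ : Equiv.Perm (ι × Fin 2),
      (if σ (q, 0) = (q, 0) ∧ σ (q, 1) = (q, 1) then R σ else 0) := by
    rw [← Equiv.sum_comp (Equiv.mulRight ρ), ← Finset.sum_neg_distrib]
    refine Finset.sum_congr rfl fun σ _ => ?_
    have e0 : (σ * ρ) (q, 0) = σ (q, 1) := by simp [ρ, Equiv.Perm.mul_apply]
    have e1 : (σ * ρ) (q, 1) = σ (q, 0) := by simp [ρ, Equiv.Perm.mul_apply]
    simp only [Equiv.coe_mulRight, e0, e1, hR]
    by_cases h : σ (q, 0) = (q, 0) ∧ σ (q, 1) = (q, 1)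
    · rw [if_pos h, if_pos h.symm]
    · rw [if_neg h, if_neg (fun h' => h h'.symm), neg_zero]
  have h3 : ∀ σ : Equiv.Perm (ι × Fin 2), ((Equiv.Perm.sign (σ * τ) : ℤ) : ℂ) *
      (siteJ q ((σ * τ) (p, 0)) ((σ * τ) (p, 1)) *
        ∏ p' ∈ Finset.univ.erase p, A ((σ * τ) (p', 0)) ((σ * τ) (p', 1))) =
      (if σ (q, 0) = (q, 0) ∧ σ (q, 1) = (q, 1) then R σ else 0) -
      (if σ (q, 0) = (q, 1) ∧ σ (q, 1) = (q, 0) then R σ else 0) := by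
    intro σ
    rw [h1, Equiv.Perm.sign_mul, hs, mul_one]
    simp only [Equiv.Perm.mul_apply, hτ, Equiv.swap_apply_left, siteJ, Matrix.of_apply, R]
    split_ifs <;> ring
  simp only [Equiv.coe_mulRight]
  simp_rw [h3]
  rw [Finset.sum_sub_distrib, h2, sum_perm_fix_site]
  ring

/-- Expansion of the Pfaffian with respect to the diagonal block of one site. -/
theorem pfaffian_add_siteJ (A : Matrix (ι × Fin 2) (ι × Fin 2) ℂ) (d : ℂ) (q : ι) :
    pfaffian (A + d • siteJ q) = pfaffian A + d * pfaffian (removeSite A q) := by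
  have hcard : Fintype.card ι = Fintype.card {i // i ≠ q} + 1 := by
    have : 0 < Fintype.card ι := Fintype.card_pos_iff.mpr ⟨q⟩
    rw [Fintype.card_subtype_compl, Fintype.card_subtype_eq]
    omega
  -- All positions p contribute equally, and the resulting factor 2 · card ι is the quotient of the
  -- normalizations 2^n n! of the two Pfaffians.
  have h : ∑ σ : Equiv.Perm (ι × Fin 2), ((Equiv.Perm.sign σ : ℤ) : ℂ) *
      ∑ p : ι, siteJ q (σ (p, 0)) (σ (p, 1)) *
        ∏ p' ∈ Finset.univ.erase p, A (σ (p', 0)) (σ (p', 1)) =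
      Fintype.card ι * (2 * ∑ σ : Equiv.Perm ({i // i ≠ q} × Fin 2),
        ((Equiv.Perm.sign σ : ℤ) : ℂ) * ∏ p, removeSite A q (σ (p, 0)) (σ (p, 1))) := by
    rw [Finset.sum_congr rfl fun σ _ => Finset.mul_sum _ _ _, Finset.sum_comm,
      Finset.sum_congr rfl fun p _ => sum_sign_siteJ A q p]
    simp
  unfold pfaffian
  simp_rw [prod_add_siteJ, mul_add]
  rw [Finset.sum_add_distrib, mul_add]
  congr 1
  simp_rw [mul_left_comm _ d]
  rw [← Finset.mul_sum, h, hcard]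
  set n := Fintype.card {i // i ≠ q}
  have h1 : ((n.factorial : ℕ) : ℂ) ≠ 0 := by exact_mod_cast n.factorial_ne_zero
  have h2 : ((n : ℂ) + 1) ≠ 0 := by exact_mod_cast n.succ_ne_zero
  rw [Nat.factorial_succ, pow_succ]
  push_cast
  field_simp

/-- The Pfaffian of a matrix with a vanishing row. -/
theorem pfaffian_eq_zero_of_site (A : Matrix (ι × Fin 2) (ι × Fin 2) ℂ) (x : ι × Fin 2)
    (hrow : ∀ y, A x y = 0) (hcol : ∀ y, A y x = 0) : pfaffian A = 0 := by
  unfold pfaffian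
  rw [Finset.sum_eq_zero, mul_zero]
  intro σ _
  rw [Finset.prod_eq_zero (Finset.mem_univ (σ.symm x).1), mul_zero]
  have h : σ ((σ.symm x).1, (σ.symm x).2) = x := by simp
  rcases hi : (σ.symm x).2 with i
  fin_cases i
  · rw [hi] at h
    simp only [Fin.zero_eta] at h
    rw [h, hrow]
  · rw [hi] at h
    simp only [Fin.mk_one] at h
    rw [h, hcol]

end PfaffianSite

/-! ### The square of the Pfaffian, and the expansion of Pf(J + A). -/

section PfaffianSq

variable {ι : Type*} [DecidableEq ι] [Fintype ι]

/-- The unipotent matrix that eliminates the rows and columns of the site `q`. -/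
noncomputable def siteElim (A : Matrix (ι × Fin 2) (ι × Fin 2) ℂ) (q : ι) :
    Matrix (ι × Fin 2) (ι × Fin 2) ℂ :=
  1 + Matrix.of fun x y => if y.1 = q then 0 else
    (if x = (q, 0) then A (q, 1) y / A (q, 0) (q, 1) else 0) -
    (if x = (q, 1) then A (q, 0) y / A (q, 0) (q, 1) else 0)

theorem det_siteElim (A : Matrix (ι × Fin 2) (ι × Fin 2) ℂ) (q : ι) :
    (siteElim A q).det = 1 := by
  rw [Matrix.twoBlockTriangular_det (siteElim A q) (fun x => x.1 = q)]
  · have h1 : (siteElim A q).toSquareBlockProp (fun x => x.1 = q) = 1 := by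
      ext ⟨x, hx⟩ ⟨y, hy⟩
      simp [siteElim, Matrix.toSquareBlockProp, hy, Matrix.one_apply]
    have h2 : (siteElim A q).toSquareBlockProp (fun x => ¬ x.1 = q) = 1 := by
      ext ⟨x, hx⟩ ⟨y, hy⟩
      have h : ∀ i, x ≠ (q, i) := fun i hi => hx (by rw [hi])
      simp [siteElim, Matrix.toSquareBlockProp, Matrix.one_apply, h]
    rw [h1, h2, Matrix.det_one, Matrix.det_one, one_mul]
  · intro x hx y hy
    have h : x ≠ y := fun h => hx (h ▸ hy)
    simp [siteElim, hy, h]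

theorem mul_siteElim_apply (A : Matrix (ι × Fin 2) (ι × Fin 2) ℂ) (q : ι) (x y : ι × Fin 2) :
    (A * siteElim A q) x y = A x y + if y.1 = q then 0 else
      A x (q, 0) * (A (q, 1) y / A (q, 0) (q, 1)) -
      A x (q, 1) * (A (q, 0) y / A (q, 0) (q, 1)) := by
  rw [siteElim, Matrix.mul_add, Matrix.mul_one, Matrix.add_apply, Matrix.mul_apply]
  congr 1
  split_ifs with h
  · simp [h]
  · simp [h, mul_sub]

theorem siteElim_transpose_mul_apply (A M : Matrix (ι × Fin 2) (ι × Fin 2) ℂ) (q : ι)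
    (i : Fin 2) (y : ι × Fin 2) : ((siteElim A q).transpose * M) (q, i) y = M (q, i) y := by
  rw [Matrix.mul_apply]
  simp [siteElim, Matrix.one_apply]

theorem antisymm_congruence {A : Matrix (ι × Fin 2) (ι × Fin 2) ℂ} (hA : A.transpose = -A)
    (B : Matrix (ι × Fin 2) (ι × Fin 2) ℂ) :
    (B.transpose * A * B).transpose = -(B.transpose * A * B) := by
  simp [Matrix.transpose_mul, hA, Matrix.mul_assoc]

theorem antisymm_apply {A : Matrix (ι × Fin 2) (ι × Fin 2) ℂ} (hA : A.transpose = -A)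
    (x y : ι × Fin 2) : A x y = -A y x := by
  have := congrFun (congrFun hA y) x
  simpa using this

theorem antisymm_diag {A : Matrix (ι × Fin 2) (ι × Fin 2) ℂ} (hA : A.transpose = -A)
    (x : ι × Fin 2) : A x x = 0 := by
  have := antisymm_apply hA x x
  linear_combination (1 / 2 : ℂ) * this

/-- This is Gaussian elimination whose pivot is the 2 × 2 block of q, antisymmetric with
off-diagonal entry A (q, 0) (q, 1). The transposed factor does not alter the rows of q, so only the
column operations matter there. -/
theorem siteElim_row {A : Matrix (ι × Fin 2) (ι × Fin 2) ℂ} (hA : A.transpose = -A) (q : ι)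
    (hq : A (q, 0) (q, 1) ≠ 0) (i : Fin 2) {y : ι × Fin 2} (hy : y.1 ≠ q) :
    ((siteElim A q).transpose * A * siteElim A q) (q, i) y = 0 := by
  rw [Matrix.mul_assoc, siteElim_transpose_mul_apply, mul_siteElim_apply, if_neg hy]
  fin_cases i
  · simp only [Fin.zero_eta, antisymm_diag hA]
    field_simp
    ring
  · simp only [Fin.mk_one, antisymm_diag hA, antisymm_apply hA (q, 1) (q, 0)]
    field_simp
    ring

/-- The Pfaffian of a matrix that decouples the site `q`. -/
theorem pfaffian_of_decoupled {A : Matrix (ι × Fin 2) (ι × Fin 2) ℂ} (hA : A.transpose = -A)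
    (q : ι) (hq : ∀ i (y : ι × Fin 2), y.1 ≠ q → A (q, i) y = 0) :
    pfaffian A = A (q, 0) (q, 1) * pfaffian (removeSite A q) := by
  set a := A (q, 0) (q, 1)
  -- Once a times `siteJ q` is subtracted, the row (q, 0) is zero, so only the term linear in a of
  -- the expansion remains.
  have hrow : ∀ y, (A + (-a) • siteJ q) (q, 0) y = 0 := by
    intro y
    by_cases hy : y.1 = q
    · obtain ⟨p, i⟩ := y
      simp only at hy
      subst hy
      fin_cases i
      · simp [antisymm_diag hA, siteJ_self]
      · simp [siteJ_self, a]
    · simp [hq 0 y hy, siteJ_eq_zero_of_snd_ne hy]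
  have hanti : (siteJ q : Matrix (ι × Fin 2) (ι × Fin 2) ℂ).transpose = - siteJ q := by
    ext x y
    simp [siteJ, and_comm]
  have hcol : ∀ y, (A + (-a) • siteJ q) y (q, 0) = 0 := by
    intro y
    have : (A + (-a) • siteJ q).transpose = -(A + (-a) • siteJ q) := by
      rw [Matrix.transpose_add, Matrix.transpose_smul, hA, hanti]
      module
    rw [antisymm_apply this, hrow, neg_zero]
  have h := pfaffian_add_siteJ (A + (-a) • siteJ q) a q
  rw [pfaffian_eq_zero_of_site _ _ hrow hcol, zero_add] at h
  have h1 : A + (-a) • siteJ q + a • siteJ q = A := by module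
  rw [h1] at h
  rw [h]
  congr 2
  ext x y
  have : (Prod.map Subtype.val id x : ι × Fin 2).1 ≠ q := x.1.2
  simp [removeSite, siteJ_eq_zero_of_fst_ne this]

theorem det_of_decoupled {A : Matrix (ι × Fin 2) (ι × Fin 2) ℂ} (hA : A.transpose = -A)
    (q : ι) (hq : ∀ i (y : ι × Fin 2), y.1 ≠ q → A (q, i) y = 0) :
    A.det = A (q, 0) (q, 1) ^ 2 * (removeSite A q).det := by
  rw [Matrix.twoBlockTriangular_det' A (fun x => x.1 = q)]
  · congr 1
    · let e : Fin 2 ≃ {x : ι × Fin 2 // x.1 = q} :=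
        { toFun := fun i => ⟨(q, i), rfl⟩
          invFun := fun x => x.1.2
          left_inv := fun i => rfl
          right_inv := by
            rintro ⟨⟨p, i⟩, rfl⟩
            rfl }
      rw [← Matrix.det_submatrix_equiv_self e, Matrix.det_fin_two]
      simp only [Matrix.submatrix_apply, Matrix.toSquareBlockProp, Matrix.toBlock_apply,
        e, Equiv.coe_fn_mk, antisymm_diag hA, antisymm_apply hA (q, 1) (q, 0)]
      ring
    · rw [← Matrix.det_submatrix_equiv_self
        (Equiv.prodSubtypeFstEquivSubtypeProd (p := (· ≠ q)) (β := Fin 2)).symm]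
      rfl
  · rintro ⟨p, i⟩ rfl y hy
    exact hq i y hy

/-- Induction on the number of sites. When the pivot of a site is nonzero, a congruence of
determinant 1 decouples that site, and both sides split off the square of the pivot. -/
theorem pfaffian_sq_aux (n : ℕ) : ∀ (ι : Type) [DecidableEq ι] [Fintype ι],
    Fintype.card ι = n → ∀ A : Matrix (ι × Fin 2) (ι × Fin 2) ℂ, A.transpose = -A →
      pfaffian A ^ 2 = A.det := by
  induction n with
  | zero =>
    intro ι _ _ hc A _
    have : IsEmpty ι := Fintype.card_eq_zero_iff.mp hc
    simp [pfaffian, Matrix.det_isEmpty]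
  | succ n ih =>
    intro ι _ _ hc A hA
    obtain ⟨q⟩ : Nonempty ι := Fintype.card_pos_iff.mp (by omega)
    have hanti : (siteJ q : Matrix (ι × Fin 2) (ι × Fin 2) ℂ).transpose = - siteJ q := by
      ext x y
      simp [siteJ, and_comm]
    have hcard : Fintype.card {i // i ≠ q} = n := by
      rw [Fintype.card_subtype_compl, Fintype.card_subtype_eq]
      omega
    have key : ∀ M : Matrix (ι × Fin 2) (ι × Fin 2) ℂ, M.transpose = -M →
        M (q, 0) (q, 1) ≠ 0 → pfaffian M ^ 2 = M.det := by
      intro M hM hM0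
      have hM' := antisymm_congruence hM (siteElim M q)
      have hdec : ∀ i (y : ι × Fin 2), y.1 ≠ q →
          ((siteElim M q).transpose * M * siteElim M q) (q, i) y = 0 :=
        fun i y hy => siteElim_row hM q hM0 i hy
      have h1 := pfaffian_congruence M (siteElim M q)
      have h2 : ((siteElim M q).transpose * M * siteElim M q).det = M.det := by
        simp [Matrix.det_mul, det_siteElim]
      rw [det_siteElim, one_mul] at h1
      rw [← h1, ← h2, pfaffian_of_decoupled hM' q hdec, det_of_decoupled hM' q hdec, mul_pow,
        ih _ hcard]
      ext x y
      exact congrFun (congrFun hM' (Prod.map Subtype.val id x)) (Prod.map Subtype.val id y)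
    have hcont : Continuous fun ε : ℂ => A + ε • siteJ q := by fun_prop
    -- A zero pivot is reached by continuity: both sides are continuous in ε, and they agree for all
    -- ε but the one that cancels the pivot.
    have heq : (fun ε : ℂ => pfaffian (A + ε • siteJ q) ^ 2) =
        fun ε : ℂ => (A + ε • siteJ q).det := by
      refine Continuous.ext_on (dense_compl_singleton (-A (q, 0) (q, 1)))
        ((continuous_pfaffian hcont).pow 2) hcont.matrix_det ?_
      intro ε hε
      apply key
      · rw [Matrix.transpose_add, Matrix.transpose_smul, hA, hanti]
        module
      · simp only [Matrix.add_apply, Matrix.smul_apply, siteJ_self, smul_eq_mul, mul_one]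
        intro h
        exact hε (by simp [eq_neg_of_add_eq_zero_right h])
    simpa using congrFun heq 0

/-- The square of the Pfaffian of an antisymmetric matrix is its determinant. -/
theorem pfaffian_sq {ι : Type} [DecidableEq ι] [Fintype ι]
    (A : Matrix (ι × Fin 2) (ι × Fin 2) ℂ) (hA : A.transpose = -A) :
    pfaffian A ^ 2 = A.det :=
  pfaffian_sq_aux _ ι rfl A hA

/-- The restriction of a block matrix to a finite set of sites. -/
def restrictSites (A : Matrix (ι × Fin 2) (ι × Fin 2) ℂ) (S : Finset ι) :
    Matrix (S × Fin 2) (S × Fin 2) ℂ :=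
  A.submatrix (Prod.map Subtype.val id) (Prod.map Subtype.val id)

omit [Fintype ι] in
theorem pfaffian_restrictSites_add_siteJ (A : Matrix (ι × Fin 2) (ι × Fin 2) ℂ)
    (S : Finset ι) {q : ι} (hq : q ∈ S) :
    pfaffian (restrictSites (A + siteJ q) S) =
      pfaffian (restrictSites A S) + pfaffian (restrictSites A (S.erase q)) := by
  have h1 : restrictSites (A + siteJ q) S =
      restrictSites A S + (1 : ℂ) • siteJ (⟨q, hq⟩ : S) := by
    ext ⟨⟨x, hx⟩, i⟩ ⟨⟨y, hy⟩, j⟩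
    simp [restrictSites, siteJ]
  rw [h1, pfaffian_add_siteJ, one_mul]
  congr 1
  let e : (S.erase q : Finset ι) ≃ {i : S // i ≠ ⟨q, hq⟩} :=
    { toFun := fun i => ⟨⟨i, Finset.mem_of_mem_erase i.2⟩, fun h =>
        Finset.ne_of_mem_erase i.2 (congrArg Subtype.val h)⟩
      invFun := fun i => ⟨i.1.1, Finset.mem_erase.mpr
        ⟨fun h => i.2 (Subtype.ext h), i.1.2⟩⟩
      left_inv := fun i => rfl
      right_inv := fun i => rfl }
  rw [← pfaffian_submatrix_equiv e]
  rfl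

-- Each block added at a site of T either is not used, and the site stays, or is used, and the site
-- disappears from the Pfaffian. The set U collects the sites that disappear.
omit [Fintype ι] in
theorem pfaffian_restrictSites_add_sum (A : Matrix (ι × Fin 2) (ι × Fin 2) ℂ) (T : Finset ι) :
    ∀ S : Finset ι, T ⊆ S → pfaffian (restrictSites (A + ∑ q ∈ T, siteJ q) S) =
      ∑ U ∈ T.powerset, pfaffian (restrictSites A (S \ U)) := by
  induction T using Finset.induction_on with
  | empty =>
    intro S _
    simpa using congrArg (fun U => pfaffian (restrictSites A U)) (Finset.sdiff_empty (s := S)).symm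
  | insert q T hq ih =>
    intro S hS
    rw [Finset.insert_subset_iff] at hS
    rw [Finset.sum_insert hq, add_comm (siteJ q), ← add_assoc,
      pfaffian_restrictSites_add_siteJ _ _ hS.1, ih S hS.2,
      ih (S.erase q) (Finset.subset_erase.mpr ⟨hS.2, hq⟩), Finset.sum_powerset_insert hq]
    congr 1
    refine Finset.sum_congr rfl fun U _ => ?_
    have : S.erase q \ U = S \ insert q U := by
      ext x
      simp only [Finset.mem_sdiff, Finset.mem_erase, Finset.mem_insert]
      tauto
    rw [this]

/-- The standard symplectic block matrix. -/
def blockJ (ι : Type*) [DecidableEq ι] : Matrix (ι × Fin 2) (ι × Fin 2) ℂ :=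
  Matrix.of fun x y => if x.1 = y.1 then (if x.2 = 0 ∧ y.2 = 1 then 1 else 0) -
    (if x.2 = 1 ∧ y.2 = 0 then 1 else 0) else 0

/-- The Pfaffian of `J + A` is the sum of the Pfaffians of the diagonal restrictions of `A`. -/
theorem pfaffian_blockJ_add (A : Matrix (ι × Fin 2) (ι × Fin 2) ℂ) :
    pfaffian (blockJ ι + A) = ∑ S : Finset ι, pfaffian (restrictSites A S) := by
  have h := pfaffian_restrictSites_add_sum A Finset.univ Finset.univ (Finset.Subset.refl _)
  have hJ : ∑ q : ι, siteJ q = blockJ ι := by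
    ext ⟨x, i⟩ ⟨y, j⟩
    rw [Matrix.sum_apply]
    by_cases hxy : x = y
    · subst hxy
      rw [Finset.sum_eq_single x]
      · simp [siteJ, blockJ]
      · intro q _ hq
        simp [siteJ, hq.symm]
      · simp
    · rw [Finset.sum_eq_zero]
      · simp [blockJ, hxy]
      · intro q _
        have h1 : ∀ i' j', ¬ ((x, i) = (q, i') ∧ (y, j) = (q, j')) := by
          rintro i' j' ⟨h1, h2⟩
          simp only [Prod.mk.injEq] at h1 h2
          exact hxy (h1.1.trans h2.1.symm)
        simp only [siteJ, Matrix.of_apply]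
        rw [if_neg (h1 _ _), if_neg (h1 _ _), sub_zero]
  let e : ι ≃ (Finset.univ : Finset ι) :=
    { toFun := fun i => ⟨i, Finset.mem_univ i⟩
      invFun := fun i => i.1
      left_inv := fun i => rfl
      right_inv := fun i => rfl }
  rw [hJ, ← pfaffian_submatrix_equiv e, Finset.powerset_univ] at h
  have h1 : (restrictSites (A + blockJ ι) Finset.univ).submatrix (Prod.map e id) (Prod.map e id) =
      blockJ ι + A := by
    rw [add_comm]
    rfl
  rw [h1] at h
  rw [h]
  -- Passing to complements turns the sum over removed sites into a sum over kept sites.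
  refine Fintype.sum_equiv (Function.Involutive.toPerm compl compl_involutive) _ _ fun U => ?_
  rw [← Finset.compl_eq_univ_sdiff]
  rfl

end PfaffianSq

/-! ### From sums over sequences to sums over subsets. -/

section SubsetSums

variable {ι : Type*} [DecidableEq ι] [Fintype ι]

theorem card_injective_image_eq (n : ℕ) (S : Finset ι) (hS : S.card = n) :
    (Finset.univ.filter fun k : Fin n → ι => Function.Injective k ∧
      Finset.univ.image k = S).card = n.factorial := by
  have e : {k : Fin n → ι // Function.Injective k ∧ Finset.univ.image k = S} ≃ (Fin n ≃ S) :=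
    { toFun := fun k => Equiv.ofBijective
        (fun i => (⟨k.1 i, (Finset.ext_iff.mp k.2.2 _).mp
          (Finset.mem_image_of_mem _ (Finset.mem_univ i))⟩ : S))
        ⟨fun i j h => k.2.1 (congrArg Subtype.val h), fun ⟨x, hx⟩ => by
          obtain ⟨i, _, hi⟩ := Finset.mem_image.mp ((Finset.ext_iff.mp k.2.2 x).mpr hx)
          exact ⟨i, Subtype.ext hi⟩⟩
      invFun := fun f => ⟨fun i => f i, fun i j h => f.injective (Subtype.ext h), by
        ext x
        simp only [Finset.mem_image, Finset.mem_univ, true_and]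
        constructor
        · rintro ⟨i, rfl⟩
          exact (f i).2
        · intro hx
          exact ⟨f.symm ⟨x, hx⟩, by simp⟩⟩
      left_inv := fun k => rfl
      right_inv := fun f => by
        ext i
        rfl }
  rw [← Fintype.card_subtype, Fintype.card_congr e,
    Fintype.card_equiv (Fintype.equivFinOfCardEq (by simp [hS])).symm, Fintype.card_fin]

/-- The sum over sequences of a symmetric function that vanishes at sequences with repetitions. -/
theorem sum_seq_eq_sum_powersetCard {R : Type*} [Field R] (n : ℕ) (G : (Fin n → ι) → R)
    (g : Finset ι → R) (h0 : ∀ k, ¬ Function.Injective k → G k = 0)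
    (h1 : ∀ k, Function.Injective k → G k = g (Finset.univ.image k)) :
    ∑ k, G k = n.factorial * ∑ S ∈ Finset.univ.powersetCard n, g S := by
  classical
  have : ∑ k, G k = ∑ k ∈ Finset.univ.filter (fun k : Fin n → ι => Function.Injective k), G k := by
    rw [Finset.sum_filter]
    refine Finset.sum_congr rfl fun k _ => ?_
    split_ifs with h
    · rfl
    · exact h0 k h
  rw [this, ← Finset.sum_fiberwise_of_maps_to (t := Finset.univ.powersetCard n)
    (g := fun k : Fin n → ι => Finset.univ.image k), Finset.mul_sum]
  · refine Finset.sum_congr rfl fun S hS => ?_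
    rw [Finset.mem_powersetCard] at hS
    rw [Finset.sum_congr rfl (g := fun _ => g S), Finset.sum_const, Finset.filter_filter,
      card_injective_image_eq n S hS.2, nsmul_eq_mul]
    intro k hk
    simp only [Finset.mem_filter] at hk
    rw [h1 k hk.1.2, hk.2]
  · intro k hk
    simp only [Finset.mem_filter] at hk
    rw [Finset.mem_powersetCard]
    exact ⟨Finset.subset_univ _, by rw [Finset.card_image_of_injective _ hk.2]; simp⟩

/-- The factor 1/n! of a Fredholm series cancels the number of orderings of an n-element set. The
series stops because no injective sequence is longer than the cardinality of ι. -/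
theorem tsum_seq_eq_sum_finset {R : Type*} [RCLike R] (G : (n : ℕ) → (Fin n → ι) → R)
    (g : Finset ι → R) (h0 : ∀ n k, ¬ Function.Injective k → G n k = 0)
    (h1 : ∀ n k, Function.Injective k → G n k = g (Finset.univ.image k)) :
    ∑' n : ℕ, ((-1 : R) ^ n / (n.factorial : R)) * ∑ k, G n k =
      ∑ S : Finset ι, (-1) ^ S.card * g S := by
  have hterm : ∀ n, ((-1 : R) ^ n / (n.factorial : R)) * ∑ k, G n k =
      ∑ S ∈ Finset.univ.powersetCard n, (-1) ^ S.card * g S := by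
    intro n
    rw [sum_seq_eq_sum_powersetCard n (G n) g (h0 n) (h1 n)]
    have : (n.factorial : R) ≠ 0 := by exact_mod_cast n.factorial_ne_zero
    rw [← mul_assoc, div_mul_cancel₀ _ this, Finset.mul_sum]
    refine Finset.sum_congr rfl fun S hS => ?_
    rw [(Finset.mem_powersetCard.mp hS).2]
  simp_rw [hterm]
  rw [tsum_eq_sum (s := Finset.range (Fintype.card ι + 1)),
    ← Finset.sum_fiberwise_of_maps_to (s := Finset.univ) (g := Finset.card)
      (t := Finset.range (Fintype.card ι + 1))]
  · refine Finset.sum_congr rfl fun n _ => ?_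
    rw [Finset.powersetCard_eq_filter, Finset.powerset_univ]
  · intro S _
    rw [Finset.mem_range]
    exact Nat.lt_succ_of_le (Finset.card_le_univ S)
  · intro n hn
    rw [Finset.powersetCard_eq_empty.mpr, Finset.sum_empty]
    rw [Finset.card_univ]
    simpa using hn

end SubsetSums

/-- Multilinearity in the rows: each row comes either from M or from the identity, which leaves the
principal minors. This is the scalar counterpart of `pfaffian_blockJ_add`. -/
theorem det_one_add_eq_sum {R : Type*} [CommRing R] {ι : Type*} [DecidableEq ι] [Fintype ι]
    (M : Matrix ι ι R) : (1 + M).det =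
      ∑ S : Finset ι, (M.submatrix (Subtype.val : S → ι) Subtype.val).det := by
  simp_rw [← Matrix.det_piecewise_one_eq_submatrix_det]
  rw [add_comm]
  exact (Matrix.detRowAlternating (n := ι) (R := R)).map_add_univ _ _

/-! ### Hadamard bounds and the convergence of the series that they dominate. -/

section Hadamard

open scoped ComplexOrder

variable {X : Type*} [Fintype X] [DecidableEq X]

/-- Hadamard's inequality for a matrix with entries of modulus at most one. -/
theorem norm_det_sq_le_of_norm_le_one {𝕜 : Type*} [RCLike 𝕜] (M : Matrix X X 𝕜)
    (hM : ∀ i j, ‖M i j‖ ≤ 1) :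
    ‖M.det‖ ^ 2 ≤ (Fintype.card X : ℝ) ^ Fintype.card X := by
  rcases isEmpty_or_nonempty X with hX | hX
  · simp [Matrix.det_isEmpty]
  -- The eigenvalues of M Mᴴ have product |det M|² and sum at most the square of the size of M; the
  -- inequality of arithmetic and geometric means compares the two.
  have hP := Matrix.posSemidef_self_mul_conjTranspose M
  have hH := hP.isHermitian
  have hdet : ((‖M.det‖ ^ 2 : ℝ) : 𝕜) = ((∏ i, hH.eigenvalues i : ℝ) : 𝕜) := by
    have := hH.det_eq_prod_eigenvalues
    rw [Matrix.det_mul, Matrix.det_conjTranspose] at this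
    rw [RCLike.ofReal_prod, ← this]
    push_cast
    rw [← RCLike.mul_conj]
    rfl
  have htr : (∑ i, hH.eigenvalues i : ℝ) ≤ (Fintype.card X : ℝ) * Fintype.card X := by
    have := hH.trace_eq_sum_eigenvalues
    have h2 : ((∑ i, hH.eigenvalues i : ℝ) : 𝕜) = ((∑ i, ∑ j, ‖M i j‖ ^ 2 : ℝ) : 𝕜) := by
      rw [RCLike.ofReal_sum, ← this, Matrix.trace]
      push_cast
      refine Finset.sum_congr rfl fun i _ => ?_
      rw [Matrix.diag_apply, Matrix.mul_apply]
      refine Finset.sum_congr rfl fun j _ => ?_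
      rw [Matrix.conjTranspose_apply, ← RCLike.mul_conj]
      rfl
    rw [RCLike.ofReal_inj.mp h2]
    calc ∑ i, ∑ j, ‖M i j‖ ^ 2 ≤ ∑ i : X, ∑ j : X, (1 : ℝ) := by
          refine Finset.sum_le_sum fun i _ => Finset.sum_le_sum fun j _ => ?_
          exact pow_le_one₀ (norm_nonneg _) (hM i j)
      _ = _ := by simp
  rw [RCLike.ofReal_inj.mp hdet]
  have hN : (0 : ℝ) < Fintype.card X := by exact_mod_cast Fintype.card_pos
  have hamgm := Real.geom_mean_le_arith_mean Finset.univ (fun _ : X => (1 : ℝ)) hH.eigenvalues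
    (fun _ _ => zero_le_one) (by simp [hN]) (fun i _ => hP.eigenvalues_nonneg i)
  simp only [Real.rpow_one, Finset.sum_const, Finset.card_univ, nsmul_eq_mul, mul_one,
    one_mul] at hamgm
  have hp : 0 ≤ ∏ i, hH.eigenvalues i := Finset.prod_nonneg fun i _ => hP.eigenvalues_nonneg i
  have h3 : (∏ i, hH.eigenvalues i) ^ ((Fintype.card X : ℝ)⁻¹) ≤ Fintype.card X :=
    hamgm.trans (by rw [div_le_iff₀ hN]; exact htr)
  have h4 := pow_le_pow_left₀ (Real.rpow_nonneg hp _) h3 (Fintype.card X)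
  rwa [← Real.rpow_natCast, ← Real.rpow_mul hp, inv_mul_cancel₀ hN.ne', Real.rpow_one] at h4

theorem norm_det_sq_le {𝕜 : Type*} [RCLike 𝕜] (M : Matrix X X 𝕜) (c : X → ℝ)
    (hc : ∀ i, 0 < c i) (hM : ∀ i j, ‖M i j‖ ≤ c i * c j) :
    ‖M.det‖ ^ 2 ≤ (Fintype.card X : ℝ) ^ Fintype.card X * (∏ i, c i ^ 2) ^ 2 := by
  have h : M = Matrix.diagonal (fun i => (c i : 𝕜)) *
      (Matrix.of fun i j => M i j / ((c i : 𝕜) * c j)) * Matrix.diagonal (fun i => (c i : 𝕜)) := by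
    ext i j
    have h1 : (c i : 𝕜) ≠ 0 := by exact_mod_cast (hc i).ne'
    have h2 : (c j : 𝕜) ≠ 0 := by exact_mod_cast (hc j).ne'
    rw [Matrix.mul_diagonal, Matrix.diagonal_mul, Matrix.of_apply]
    field_simp
  have hb := norm_det_sq_le_of_norm_le_one (Matrix.of fun i j => M i j / ((c i : 𝕜) * c j)) (by
    intro i j
    have h1 := hc i
    have h2 := hc j
    rw [Matrix.of_apply, norm_div, norm_mul, RCLike.norm_ofReal, RCLike.norm_ofReal,
      abs_of_pos h1, abs_of_pos h2, div_le_one (mul_pos h1 h2)]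
    exact hM i j)
  rw [h, Matrix.det_mul, Matrix.det_mul, Matrix.det_diagonal]
  have hn : ‖∏ i, (c i : 𝕜)‖ = ∏ i, c i := by
    rw [norm_prod]
    exact Finset.prod_congr rfl fun i _ => by rw [RCLike.norm_ofReal, abs_of_pos (hc i)]
  rw [norm_mul, norm_mul, hn, Finset.prod_pow]
  have h0 : 0 ≤ (∏ i, c i) ^ 4 := pow_nonneg (Finset.prod_nonneg fun i _ => (hc i).le) 4
  nlinarith [mul_le_mul_of_nonneg_right hb h0]

/-- The growth of the Hadamard bounds. -/
noncomputable def hadamardGrowth (n : ℕ) : ℝ := √((2 * n : ℝ) ^ n)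

theorem hadamardGrowth_nonneg (n : ℕ) : 0 ≤ hadamardGrowth n := Real.sqrt_nonneg _

theorem hadamardGrowth_sq (n : ℕ) : hadamardGrowth n ^ 2 = (2 * n : ℝ) ^ n :=
  Real.sq_sqrt (by positivity)

/-- Hadamard gives n^(n/2). The larger (2n)^(n/2) lets determinants and Pfaffians share one growth
function. -/
theorem norm_det_le {𝕜 : Type*} [RCLike 𝕜] {n : ℕ} (M : Matrix (Fin n) (Fin n) 𝕜) (c : Fin n → ℝ)
    (hc : ∀ i, 0 < c i) (hM : ∀ i j, ‖M i j‖ ≤ c i * c j) :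
    ‖M.det‖ ≤ hadamardGrowth n * ∏ i, c i ^ 2 := by
  have h := norm_det_sq_le M c hc hM
  rw [Fintype.card_fin] at h
  have hp : 0 ≤ ∏ i, c i ^ 2 := Finset.prod_nonneg fun i _ => sq_nonneg _
  refine (sq_le_sq₀ (norm_nonneg _) (mul_nonneg (hadamardGrowth_nonneg n) hp)).mp ?_
  rw [mul_pow, hadamardGrowth_sq]
  refine h.trans (mul_le_mul_of_nonneg_right ?_ (sq_nonneg _))
  gcongr
  linarith [(Nat.cast_nonneg n : (0 : ℝ) ≤ n)]

/-- The antisymmetric part of A has the same Pfaffian and, the bound being symmetric, obeys the same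
entrywise estimate. Its determinant has size 2n and is the square of the Pfaffian, which turns
Hadamard's (2n)^n into (2n)^(n/2). -/
theorem norm_blockPfaffian_le {n : ℕ} (A : Matrix (Fin n × Fin 2) (Fin n × Fin 2) ℂ)
    (c : Fin n → ℝ) (hc : ∀ i, 0 < c i) (hA : ∀ x y, ‖A x y‖ ≤ c x.1 * c y.1) :
    ‖blockPfaffian A‖ ≤ hadamardGrowth n * ∏ i, c i ^ 2 := by
  rw [blockPfaffian_eq_pfaffian, ← pfaffian_antisymm]
  set D := (1 / 2 : ℂ) • (A - A.transpose)
  have hD : D.transpose = -D := by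
    simp only [D, Matrix.transpose_smul, Matrix.transpose_sub, Matrix.transpose_transpose]
    module
  have hDn : ∀ x y, ‖D x y‖ ≤ c x.1 * c y.1 := by
    intro x y
    have : D x y = (1 / 2) * (A x y - A y x) := by simp [D]
    rw [this, norm_mul]
    have h1 := norm_sub_le (A x y) (A y x)
    have h2 := hA x y
    have h3 := hA y x
    rw [show ‖(1 / 2 : ℂ)‖ = 1 / 2 by norm_num]
    linarith [mul_comm (c x.1) (c y.1)]
  have h := norm_det_sq_le D (fun x => c x.1) (fun x => hc _) hDn
  rw [← pfaffian_sq D hD, norm_pow, Fintype.card_prod, Fintype.card_fin, Fintype.card_fin,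
    Fintype.prod_prod_type] at h
  simp only [Finset.prod_const, Finset.card_univ, Fintype.card_fin] at h
  have hp : 0 ≤ ∏ i, c i ^ 2 := Finset.prod_nonneg fun i _ => sq_nonneg _
  refine (sq_le_sq₀ (norm_nonneg _) (mul_nonneg (hadamardGrowth_nonneg n) hp)).mp ?_
  rw [mul_pow, hadamardGrowth_sq]
  refine (sq_le_sq₀ (by positivity) (by positivity)).mp ?_
  refine h.trans (le_of_eq ?_)
  rw [Finset.prod_pow]
  push_cast
  ring

/-- From n^n ≤ e^n n!, the square of the n-th term is at most a geometric factor divided by n!. The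
inequality y ≤ y²/A + A with A = 2^(-n) then splits the term into one of an exponential series and
one of a geometric series. -/
theorem summable_hadamardGrowth (M : ℝ) :
    Summable fun n : ℕ => (1 / (n.factorial : ℝ)) * (hadamardGrowth n * M ^ n) := by
  have hbd : ∀ n : ℕ, ‖(1 / (n.factorial : ℝ)) * (hadamardGrowth n * M ^ n)‖ ≤
      (4 * Real.exp 1 * M ^ 2) ^ n / n.factorial + (1 / 2 : ℝ) ^ n := by
    intro n
    have hf : (0 : ℝ) < n.factorial := by exact_mod_cast n.factorial_pos
    have h1 : (n : ℝ) ^ n ≤ Real.exp 1 ^ n * n.factorial := by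
      have := Real.pow_div_factorial_le_exp (n : ℝ) (Nat.cast_nonneg n) n
      rw [div_le_iff₀ hf] at this
      rwa [← Real.exp_nat_mul, mul_one]
    have h2 : hadamardGrowth n ^ 2 ≤ (2 * Real.exp 1) ^ n * n.factorial := by
      rw [hadamardGrowth_sq, mul_pow, mul_pow, mul_assoc]
      gcongr
    set H := hadamardGrowth n
    have hH : 0 ≤ H := Real.sqrt_nonneg _
    set A : ℝ := (1 / 2) ^ n
    have hA : 0 < A := by positivity
    have h3 : (4 * Real.exp 1 * M ^ 2) ^ n = (2 * Real.exp 1) ^ n * (|M| ^ n) ^ 2 / A := by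
      rw [← sq_abs M]
      simp only [A, one_div, inv_pow, div_inv_eq_mul]
      rw [← pow_mul, mul_comm n 2, pow_mul, ← mul_pow, ← mul_pow]
      congr 1
      ring
    rw [norm_mul, norm_mul, norm_pow, Real.norm_of_nonneg hH, Real.norm_of_nonneg (by positivity),
      Real.norm_eq_abs, h3]
    set m := |M| ^ n
    have hm : 0 ≤ m := by positivity
    set f : ℝ := (n.factorial : ℝ)
    have h4 : (H * m) ^ 2 / (A * f ^ 2) ≤ (2 * Real.exp 1) ^ n * m ^ 2 / A / f := by
      rw [div_div, div_le_div_iff₀ (by positivity) (by positivity)]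
      have := mul_le_mul_of_nonneg_right h2 (show 0 ≤ m ^ 2 * (A * f) by positivity)
      nlinarith
    have h5 : 1 / f * (H * m) ≤ (H * m) ^ 2 / (A * f ^ 2) + A := by
      have h6 : (H * m) ^ 2 / (A * f ^ 2) = ((H * m) / f) ^ 2 / A := by
        field_simp
      rw [h6, one_div_mul_eq_div]
      set y := H * m / f
      have : y ^ 2 / A + A - y = ((y - A) ^ 2 + y * A) / A := by
        field_simp
        ring
      have h7 : 0 ≤ y := by positivity
      have : 0 ≤ y ^ 2 / A + A - y := by
        rw [this]
        positivity
      linarith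
    linarith
  refine Summable.of_norm_bounded ?_ hbd
  exact (Real.summable_pow_div_factorial _).add (summable_geometric_of_lt_one (by norm_num)
    (by norm_num))

end Hadamard

/-! ### Dominated convergence for Fredholm Pfaffians and determinants. -/

section FredholmSeries

variable {𝕜 : Type*} [RCLike 𝕜]

theorem fredholm_series_integrable (F : (n : ℕ) → (Fin n → ℝ) → 𝕜) (G : ℝ → ℝ)
    (hG : Integrable G) (hF : ∀ n, AEStronglyMeasurable (F n))
    (hb : ∀ n r, ‖F n r‖ ≤ hadamardGrowth n * ∏ p, G (r p)) (n : ℕ) : Integrable (F n) :=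
  ((Integrable.fintype_prod (f := fun _ : Fin n => G) fun _ => hG).const_mul
    (hadamardGrowth n)).mono' (hF n) (Eventually.of_forall (hb n))

theorem fredholm_series_integral_le (F : (n : ℕ) → (Fin n → ℝ) → 𝕜) (G : ℝ → ℝ)
    (hG : Integrable G) (hF : ∀ n, AEStronglyMeasurable (F n))
    (hb : ∀ n r, ‖F n r‖ ≤ hadamardGrowth n * ∏ p, G (r p)) (n : ℕ) :
    ∫ r, ‖F n r‖ ≤ hadamardGrowth n * (∫ x, G x) ^ n := by
  have h := integral_mono (fredholm_series_integrable F G hG hF hb n).norm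
    ((Integrable.fintype_prod (f := fun _ : Fin n => G) fun _ => hG).const_mul
      (hadamardGrowth n)) (hb n)
  rwa [integral_const_mul, integral_fintype_prod_volume_eq_pow, Fintype.card_fin] at h

theorem fredholm_series_summable (F : (n : ℕ) → (Fin n → ℝ) → 𝕜) (G : ℝ → ℝ)
    (hG : Integrable G) (hF : ∀ n, AEStronglyMeasurable (F n))
    (hb : ∀ n r, ‖F n r‖ ≤ hadamardGrowth n * ∏ p, G (r p)) :
    Summable fun n : ℕ => (1 / (n.factorial : ℝ)) * ∫ r : Fin n → ℝ, ‖F n r‖ := by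
  refine Summable.of_nonneg_of_le (fun n => ?_) (fun n => ?_)
    (summable_hadamardGrowth (∫ x, G x))
  · positivity
  · exact mul_le_mul_of_nonneg_left (fredholm_series_integral_le F G hG hF hb n) (by positivity)

/-- Dominated convergence is used twice: inside each integral, with the integrable product of the G
(r p), and then in the series, with (∫ G)^n times the Hadamard growth over n!. -/
theorem fredholm_series_tendsto {ι : Type*} {l : Filter ι} [l.IsCountablyGenerated]
    (F : ι → (n : ℕ) → (Fin n → ℝ) → 𝕜) (F' : (n : ℕ) → (Fin n → ℝ) → 𝕜) (G : ℝ → ℝ)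
    (hG : Integrable G) (hF : ∀ᶠ i in l, ∀ n, AEStronglyMeasurable (F i n))
    (hb : ∀ᶠ i in l, ∀ n r, ‖F i n r‖ ≤ hadamardGrowth n * ∏ p, G (r p))
    (hlim : ∀ n, ∀ᵐ r, Tendsto (fun i => F i n r) l (𝓝 (F' n r))) :
    Tendsto (fun i => ∑' n : ℕ, ((-1 : 𝕜) ^ n / (n.factorial : 𝕜)) * ∫ r, F i n r) l
      (𝓝 (∑' n : ℕ, ((-1 : 𝕜) ^ n / (n.factorial : 𝕜)) * ∫ r, F' n r)) := by
  refine tendsto_tsum_of_dominated_convergence (summable_hadamardGrowth (∫ x, G x)) ?_ ?_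
  · intro n
    refine Tendsto.const_mul _ ?_
    refine tendsto_integral_filter_of_dominated_convergence
      (fun r => hadamardGrowth n * ∏ p, G (r p)) ?_ ?_ ?_ (hlim n)
    · filter_upwards [hF] with i hi using hi n
    · filter_upwards [hb] with i hi using Eventually.of_forall (hi n)
    · exact (Integrable.fintype_prod (f := fun _ : Fin n => G) fun _ => hG).const_mul
        (hadamardGrowth n)
  · filter_upwards [hF, hb] with i hi1 hi2 n
    rw [norm_mul, norm_div, norm_pow, norm_neg, norm_one, one_pow, RCLike.norm_natCast]
    exact mul_le_mul_of_nonneg_left ((norm_integral_le_integral_norm _).trans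
      (fredholm_series_integral_le (F i) G hG hi1 hi2 n)) (by positivity)

theorem ae_forall_fin {P : ℝ → Prop} (h : ∀ᵐ x, P x) (n : ℕ) :
    ∀ᵐ r : Fin n → ℝ, ∀ p, P (r p) := by
  rw [ae_all_iff]
  intro p
  exact (Measure.tendsto_eval_ae_ae (μ := fun _ : Fin n => (volume : Measure ℝ)) (i := p)).eventually h

end FredholmSeries

section FredholmPfaffian

/-- Domination of a weighted matrix kernel by a product of positive functions. -/
structure PfaffianDominated (χ : ℝ → ℝ) (K : ℝ → ℝ → Matrix (Fin 2) (Fin 2) ℂ) (g G : ℝ → ℝ) :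
    Prop where
  measurable_weight : Measurable χ
  measurable_kernel : ∀ i j, Measurable fun p : ℝ × ℝ => K p.1 p.2 i j
  bound : ∀ r r', χ r ≠ 0 → χ r' ≠ 0 → ∀ i j, ‖K r r' i j‖ ≤ g r * g r'
  bound_weight : ∀ r, |χ r| * g r ^ 2 ≤ G r

variable {χ : ℝ → ℝ} {K : ℝ → ℝ → Matrix (Fin 2) (Fin 2) ℂ} {g G : ℝ → ℝ}

theorem PfaffianDominated.aestronglyMeasurable (h : PfaffianDominated χ K g G) (n : ℕ) :
    AEStronglyMeasurable (pfaffianIntegrand χ K n) := by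
  refine Measurable.aestronglyMeasurable ?_
  unfold pfaffianIntegrand blockPfaffian blockMatrix
  have h1 := h.measurable_weight
  have h2 := h.measurable_kernel
  refine Measurable.mul ?_ (Measurable.const_mul ?_ _)
  · refine Complex.measurable_ofReal.comp ?_
    exact Finset.measurable_prod _ fun p _ => h1.comp (measurable_pi_apply p)
  · refine Finset.measurable_sum _ fun σ _ => Measurable.const_mul ?_ _
    refine Finset.measurable_prod _ fun p _ => ?_
    exact (h2 (σ (p, 0)).2 (σ (p, 1)).2).comp (f := fun r : Fin n → ℝ =>
      (r (σ (p, 0)).1, r (σ (p, 1)).1))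
      ((measurable_pi_apply _).prodMk (measurable_pi_apply _))

theorem PfaffianDominated.norm_le_prod (h : PfaffianDominated χ K g G) (hg : ∀ r, 0 < g r) (n : ℕ)
    (r : Fin n → ℝ) :
    ‖pfaffianIntegrand χ K n r‖ ≤ hadamardGrowth n * ∏ p, (|χ (r p)| * g (r p) ^ 2) := by
  unfold pfaffianIntegrand
  by_cases h0 : ∃ p, χ (r p) = 0
  · obtain ⟨p, hp⟩ := h0
    rw [Finset.prod_eq_zero (Finset.mem_univ p) hp]
    simpa using mul_nonneg (hadamardGrowth_nonneg n) (Finset.prod_nonneg fun p _ => by positivity)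
  · push Not at h0
    have hP := norm_blockPfaffian_le (blockMatrix K r) (fun p => g (r p)) (fun p => hg _)
      (fun x y => h.bound _ _ (h0 _) (h0 _) _ _)
    rw [norm_mul, Complex.norm_real, Real.norm_eq_abs, Finset.abs_prod, Finset.prod_mul_distrib,
      mul_left_comm]
    gcongr

theorem PfaffianDominated.norm_le (h : PfaffianDominated χ K g G) (hg : ∀ r, 0 < g r) (n : ℕ)
    (r : Fin n → ℝ) : ‖pfaffianIntegrand χ K n r‖ ≤ hadamardGrowth n * ∏ p, G (r p) :=
  (h.norm_le_prod hg n r).trans (mul_le_mul_of_nonneg_left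
    (Finset.prod_le_prod (fun p _ => by positivity) fun p _ => h.bound_weight _)
    (hadamardGrowth_nonneg n))

theorem PfaffianDominated.converges (h : PfaffianDominated χ K g G) (hg : ∀ r, 0 < g r)
    (hG : Integrable G) : FredholmPfaffianConverges χ K :=
  ⟨fredholm_series_integrable _ G hG h.aestronglyMeasurable (h.norm_le hg),
    fredholm_series_summable _ G hG h.aestronglyMeasurable (h.norm_le hg)⟩

/-- The kernels need to converge only where the limit weight is nonzero: elsewhere the weight tends
to 0 while the Pfaffian stays bounded. The conull property P leaves room for exceptional points,
such as the jump of the limit weight. -/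
theorem fredholmPfaffian_tendsto {ι : Type*} {l : Filter ι} [l.IsCountablyGenerated]
    {χ : ι → ℝ → ℝ} {K : ι → ℝ → ℝ → Matrix (Fin 2) (Fin 2) ℂ} {χ' : ℝ → ℝ}
    {K' : ℝ → ℝ → Matrix (Fin 2) (Fin 2) ℂ} {g G : ℝ → ℝ} (hg : ∀ r, 0 < g r) (hG : Integrable G)
    (h : ∀ᶠ i in l, PfaffianDominated (χ i) (K i) g G)
    {P : ℝ → Prop} (hP : ∀ᵐ x, P x) (hχ : ∀ r, P r → Tendsto (fun i => χ i r) l (𝓝 (χ' r)))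
    (hK : ∀ r r', P r → P r' → χ' r ≠ 0 → χ' r' ≠ 0 →
      Tendsto (fun i => K i r r') l (𝓝 (K' r r'))) :
    Tendsto (fun i => fredholmPfaffian (χ i) (K i)) l (𝓝 (fredholmPfaffian χ' K')) := by
  refine fredholm_series_tendsto (fun i => pfaffianIntegrand (χ i) (K i))
    (pfaffianIntegrand χ' K') G hG (h.mono fun i hi => hi.aestronglyMeasurable)
    (h.mono fun i hi => hi.norm_le hg) fun n => ?_
  filter_upwards [ae_forall_fin hP n] with r hr
  by_cases h0 : ∃ p, χ' (r p) = 0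
  · have hz : pfaffianIntegrand χ' K' n r = 0 := by
      obtain ⟨p, hp⟩ := h0
      rw [pfaffianIntegrand, Finset.prod_eq_zero (Finset.mem_univ p) hp]
      simp
    rw [hz]
    have hlim : Tendsto (fun i => hadamardGrowth n * ∏ p, (|χ i (r p)| * g (r p) ^ 2)) l
        (𝓝 (hadamardGrowth n * ∏ p, (|χ' (r p)| * g (r p) ^ 2))) :=
      (tendsto_finsetProd _ fun p _ => ((hχ _ (hr p)).abs).mul_const _).const_mul _
    obtain ⟨p, hp⟩ := h0
    rw [Finset.prod_eq_zero (Finset.mem_univ p) (by rw [hp]; simp), mul_zero] at hlim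
    exact squeeze_zero_norm' (h.mono fun i hi => hi.norm_le_prod hg n r) hlim
  · push Not at h0
    unfold pfaffianIntegrand
    refine Tendsto.mul ?_ ?_
    · exact (Complex.continuous_ofReal.tendsto _).comp
        (tendsto_finsetProd _ fun p _ => hχ _ (hr p))
    · simp_rw [blockPfaffian_eq_pfaffian]
      have hA : Tendsto (fun i => blockMatrix (K i) r) l (𝓝 (blockMatrix K' r)) := by
        refine tendsto_pi_nhds.mpr fun x => tendsto_pi_nhds.mpr fun y => ?_
        exact tendsto_pi_nhds.mp (tendsto_pi_nhds.mp
          (hK _ _ (hr x.1) (hr y.1) (h0 _) (h0 _)) x.2) y.2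
      exact ((continuous_pfaffian continuous_id).tendsto _).comp hA

end FredholmPfaffian

section FredholmDet

/-- Domination of a weighted scalar kernel by a product of positive functions. -/
structure DetDominated (χ : ℝ → ℝ) (K : ℝ → ℝ → ℝ) (g G : ℝ → ℝ) : Prop where
  measurable_weight : Measurable χ
  measurable_kernel : Measurable fun p : ℝ × ℝ => K p.1 p.2
  bound : ∀ r r', χ r ≠ 0 → χ r' ≠ 0 → |K r r'| ≤ g r * g r'
  bound_weight : ∀ r, |χ r| * g r ^ 2 ≤ G r

variable {χ : ℝ → ℝ} {K : ℝ → ℝ → ℝ} {g G : ℝ → ℝ}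

theorem DetDominated.aestronglyMeasurable (h : DetDominated χ K g G) (n : ℕ) :
    AEStronglyMeasurable (detIntegrand χ K n) := by
  refine Measurable.aestronglyMeasurable ?_
  unfold detIntegrand
  simp_rw [Matrix.det_apply']
  refine Measurable.mul ?_ ?_
  · exact Finset.measurable_prod _ fun p _ => h.measurable_weight.comp (measurable_pi_apply p)
  · refine Finset.measurable_sum _ fun σ _ => Measurable.const_mul ?_ _
    refine Finset.measurable_prod _ fun p _ => ?_
    exact h.measurable_kernel.comp (f := fun r : Fin n → ℝ => (r (σ p), r p))
      ((measurable_pi_apply _).prodMk (measurable_pi_apply _))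

theorem DetDominated.norm_le_prod (h : DetDominated χ K g G) (hg : ∀ r, 0 < g r) (n : ℕ)
    (r : Fin n → ℝ) :
    ‖detIntegrand χ K n r‖ ≤ hadamardGrowth n * ∏ p, (|χ (r p)| * g (r p) ^ 2) := by
  unfold detIntegrand
  by_cases h0 : ∃ p, χ (r p) = 0
  · obtain ⟨p, hp⟩ := h0
    rw [Finset.prod_eq_zero (Finset.mem_univ p) hp]
    simpa using mul_nonneg (hadamardGrowth_nonneg n) (Finset.prod_nonneg fun p _ => by positivity)
  · push Not at h0
    have hP := norm_det_le (Matrix.of fun i j : Fin n => K (r i) (r j)) (fun p => g (r p))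
      (fun p => hg _) (fun x y => h.bound _ _ (h0 _) (h0 _))
    rw [norm_mul, Real.norm_eq_abs (∏ p, χ (r p)), Finset.abs_prod, Finset.prod_mul_distrib,
      mul_left_comm]
    gcongr

theorem DetDominated.norm_le (h : DetDominated χ K g G) (hg : ∀ r, 0 < g r) (n : ℕ)
    (r : Fin n → ℝ) : ‖detIntegrand χ K n r‖ ≤ hadamardGrowth n * ∏ p, G (r p) :=
  (h.norm_le_prod hg n r).trans (mul_le_mul_of_nonneg_left
    (Finset.prod_le_prod (fun p _ => by positivity) fun p _ => h.bound_weight _)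
    (hadamardGrowth_nonneg n))

theorem DetDominated.converges (h : DetDominated χ K g G) (hg : ∀ r, 0 < g r)
    (hG : Integrable G) : FredholmDetConverges χ K :=
  ⟨fredholm_series_integrable _ G hG h.aestronglyMeasurable (h.norm_le hg),
    fredholm_series_summable _ G hG h.aestronglyMeasurable (h.norm_le hg)⟩

theorem fredholmDet_tendsto {ι : Type*} {l : Filter ι} [l.IsCountablyGenerated]
    {χ : ι → ℝ → ℝ} {K : ι → ℝ → ℝ → ℝ} {χ' : ℝ → ℝ}
    {K' : ℝ → ℝ → ℝ} {g G : ℝ → ℝ} (hg : ∀ r, 0 < g r) (hG : Integrable G)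
    (h : ∀ᶠ i in l, DetDominated (χ i) (K i) g G)
    {P : ℝ → Prop} (hP : ∀ᵐ x, P x) (hχ : ∀ r, P r → Tendsto (fun i => χ i r) l (𝓝 (χ' r)))
    (hK : ∀ r r', P r → P r' → χ' r ≠ 0 → χ' r' ≠ 0 →
      Tendsto (fun i => K i r r') l (𝓝 (K' r r'))) :
    Tendsto (fun i => fredholmDet (χ i) (K i)) l (𝓝 (fredholmDet χ' K')) := by
  refine fredholm_series_tendsto (fun i => detIntegrand (χ i) (K i))
    (detIntegrand χ' K') G hG (h.mono fun i hi => hi.aestronglyMeasurable)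
    (h.mono fun i hi => hi.norm_le hg) fun n => ?_
  filter_upwards [ae_forall_fin hP n] with r hr
  by_cases h0 : ∃ p, χ' (r p) = 0
  · have hz : detIntegrand χ' K' n r = 0 := by
      obtain ⟨p, hp⟩ := h0
      rw [detIntegrand, Finset.prod_eq_zero (Finset.mem_univ p) hp, zero_mul]
    rw [hz]
    have hlim : Tendsto (fun i => hadamardGrowth n * ∏ p, (|χ i (r p)| * g (r p) ^ 2)) l
        (𝓝 (hadamardGrowth n * ∏ p, (|χ' (r p)| * g (r p) ^ 2))) :=
      (tendsto_finsetProd _ fun p _ => ((hχ _ (hr p)).abs).mul_const _).const_mul _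
    obtain ⟨p, hp⟩ := h0
    rw [Finset.prod_eq_zero (Finset.mem_univ p) (by rw [hp]; simp), mul_zero] at hlim
    exact squeeze_zero_norm' (h.mono fun i hi => hi.norm_le_prod hg n r) hlim
  · push Not at h0
    unfold detIntegrand
    refine Tendsto.mul (tendsto_finsetProd _ fun p _ => hχ _ (hr p)) ?_
    have hA : Tendsto (fun i => Matrix.of fun a b : Fin n => K i (r a) (r b)) l
        (𝓝 (Matrix.of fun a b : Fin n => K' (r a) (r b))) :=
      tendsto_pi_nhds.mpr fun x => tendsto_pi_nhds.mpr fun y =>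
        hK _ _ (hr x) (hr y) (h0 _) (h0 _)
    exact ((continuous_id.matrix_det).tendsto _).comp hA

end FredholmDet

/-! ### Step kernels: Fredholm series become finite Pfaffians and determinants. -/

section StepKernels

/-- The index of the cell of mesh `h`, counted from `s`, that contains `r`. -/
noncomputable def cellIndex (s h r : ℝ) : ℕ := ⌊(r - s) / h⌋₊

/-- The indicator function of the first `M` cells of mesh `h`, counted from `s`. -/
noncomputable def stepCutoff (s h : ℝ) (M : ℕ) : ℝ → ℝ := Set.indicator (Set.Ico s (s + M * h)) 1

/-- The cell number `k` of mesh `h`, counted from `s`. -/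
def cell (s h : ℝ) (k : ℕ) : Set ℝ := Set.Ico (s + k * h) (s + (k + 1) * h)

variable {s h : ℝ}

theorem mem_cell_iff (hh : 0 < h) (k : ℕ) (r : ℝ) : r ∈ cell s h k ↔ s ≤ r ∧ cellIndex s h r = k := by
  unfold cell cellIndex
  constructor
  · rintro ⟨h1, h2⟩
    have hk : (0 : ℝ) ≤ k * h := by positivity
    refine ⟨by linarith, ?_⟩
    rw [Nat.floor_eq_iff (div_nonneg (by linarith) hh.le), le_div_iff₀ hh, div_lt_iff₀ hh]
    constructor <;> linarith
  · rintro ⟨h1, h2⟩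
    rw [Nat.floor_eq_iff (div_nonneg (by linarith) hh.le), le_div_iff₀ hh, div_lt_iff₀ hh] at h2
    constructor <;> linarith [h2.1, h2.2]

theorem measurable_cellIndex (s h : ℝ) : Measurable (cellIndex s h) :=
  Nat.measurable_floor.comp ((measurable_id.sub_const s).div_const h)

theorem measurable_stepCutoff (s h : ℝ) (M : ℕ) : Measurable (stepCutoff s h M) :=
  measurable_one.indicator measurableSet_Ico

theorem stepCutoff_ne_zero_iff (M : ℕ) (r : ℝ) :
    stepCutoff s h M r ≠ 0 ↔ s ≤ r ∧ r < s + M * h := by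
  simp [stepCutoff, Set.indicator_apply]

theorem cellIndex_lt (hh : 0 < h) {M : ℕ} {r : ℝ} (hr : stepCutoff s h M r ≠ 0) :
    cellIndex s h r < M := by
  rw [stepCutoff_ne_zero_iff] at hr
  unfold cellIndex
  rw [Nat.floor_lt (div_nonneg (by linarith [hr.1]) hh.le), div_lt_iff₀ hh]
  linarith [hr.2]

theorem stepCutoff_eq_sum (hh : 0 < h) (M : ℕ) (r : ℝ) :
    stepCutoff s h M r = ∑ k : Fin M, (cell s h k).indicator 1 r := by
  by_cases hr : stepCutoff s h M r = 0
  · rw [hr, Finset.sum_eq_zero]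
    intro k _
    rw [Set.indicator_of_notMem]
    intro hk
    rw [mem_cell_iff hh] at hk
    have h0 := (stepCutoff_ne_zero_iff M r).not.mp (not_not.mpr hr)
    apply h0
    refine ⟨hk.1, ?_⟩
    have h1 := (mem_cell_iff hh k r).mpr hk
    have h2 : ((k : ℕ) : ℝ) + 1 ≤ M := by exact_mod_cast k.2
    have := h1.2
    nlinarith
  · have h1 := cellIndex_lt hh hr
    have h2 := (stepCutoff_ne_zero_iff M r).mp hr
    rw [Finset.sum_eq_single ⟨cellIndex s h r, h1⟩]
    · rw [Set.indicator_of_mem ((mem_cell_iff hh _ r).mpr ⟨h2.1, rfl⟩)]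
      exact Set.indicator_of_mem (Set.mem_Ico.mpr h2) _
    · intro k _ hk
      rw [Set.indicator_of_notMem]
      intro hm
      rw [mem_cell_iff hh] at hm
      exact hk (Fin.ext hm.2.symm)
    · simp

theorem integral_step {𝕜 : Type*} [RCLike 𝕜] (hh : 0 < h) (M n : ℕ) (g : (Fin n → ℕ) → 𝕜) :
    ∫ r : Fin n → ℝ, ((∏ p, stepCutoff s h M (r p) : ℝ) : 𝕜) * g (fun p => cellIndex s h (r p)) =
      ∑ k : Fin n → Fin M, (h : 𝕜) ^ n * g (fun p => k p) := by
  have h1 : ∀ r : Fin n → ℝ,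
      ((∏ p, stepCutoff s h M (r p) : ℝ) : 𝕜) * g (fun p => cellIndex s h (r p)) =
      ∑ k : Fin n → Fin M, ((∏ p, (cell s h (k p)).indicator 1 (r p) : ℝ) : 𝕜) *
        g (fun p => k p) := by
    intro r
    simp_rw [stepCutoff_eq_sum hh, Fintype.prod_sum]
    rw [RCLike.ofReal_sum, Finset.sum_mul]
    refine Finset.sum_congr rfl fun k _ => ?_
    by_cases hk : ∀ p, r p ∈ cell s h (k p)
    · congr 2
      ext p
      exact ((mem_cell_iff hh _ _).mp (hk p)).2
    · push Not at hk
      obtain ⟨p, hp⟩ := hk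
      rw [Finset.prod_eq_zero (Finset.mem_univ p) (Set.indicator_of_notMem hp _)]
      simp
  have hint1 : ∀ k : ℕ, Integrable ((cell s h k).indicator (1 : ℝ → ℝ)) := fun k =>
    (integrable_indicator_iff measurableSet_Ico).mpr (integrableOn_const (by simp))
  have hval : ∀ k : ℕ, ∫ x, (cell s h k).indicator (1 : ℝ → ℝ) x = h := by
    intro k
    rw [cell, integral_indicator_one measurableSet_Ico, Real.volume_real_Ico_of_le] <;> nlinarith
  simp_rw [h1]
  rw [integral_finsetSum]
  · refine Finset.sum_congr rfl fun k _ => ?_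
    rw [integral_mul_const, integral_ofReal,
      integral_fintype_prod_volume_eq_prod (fun p => (cell s h (k p)).indicator (1 : ℝ → ℝ))]
    simp [hval]
  · intro k _
    exact ((Integrable.fintype_prod (f := fun p => (cell s h (k p)).indicator (1 : ℝ → ℝ))
      fun p => hint1 _).ofReal).mul_const _

/-- A repeated site gives the antisymmetric part two equal rows, so its determinant, the square of
the Pfaffian, vanishes. -/
theorem pfaffian_eq_zero_of_not_injective {n : ℕ} {ι : Type*} (A : ι → ι → Matrix (Fin 2) (Fin 2) ℂ)
    (k : Fin n → ι) (hk : ¬ Function.Injective k) :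
    pfaffian (Matrix.of fun x y : Fin n × Fin 2 => A (k x.1) (k y.1) x.2 y.2) = 0 := by
  rw [← pfaffian_antisymm]
  set B : Matrix (Fin n × Fin 2) (Fin n × Fin 2) ℂ :=
    Matrix.of fun x y => A (k x.1) (k y.1) x.2 y.2
  have hD : ((1 / 2 : ℂ) • (B - B.transpose)).transpose = -((1 / 2 : ℂ) • (B - B.transpose)) := by
    simp only [Matrix.transpose_smul, Matrix.transpose_sub, Matrix.transpose_transpose]
    module
  have h := pfaffian_sq _ hD
  unfold Function.Injective at hk
  push Not at hk
  obtain ⟨a, b, hab, hne⟩ := hk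
  rw [Matrix.det_zero_of_row_eq (i := (a, 0)) (j := (b, 0)) (by simpa using hne)] at h
  · exact pow_eq_zero_iff (two_ne_zero) |>.mp h
  · ext y
    simp [B, hab]

theorem det_eq_zero_of_not_injective {R : Type*} [CommRing R] {n : ℕ} {ι : Type*} (A : ι → ι → R)
    (k : Fin n → ι) (hk : ¬ Function.Injective k) :
    (Matrix.of fun x y : Fin n => A (k x) (k y)).det = 0 := by
  unfold Function.Injective at hk
  push Not at hk
  obtain ⟨a, b, hab, hne⟩ := hk
  refine Matrix.det_zero_of_row_eq hne ?_
  ext y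
  simp [hab]

/-- The enumeration of the image of an injective sequence. -/
noncomputable def imageEquiv {n : ℕ} {ι : Type*} [DecidableEq ι] (k : Fin n → ι)
    (hk : Function.Injective k) : Fin n ≃ (Finset.univ.image k : Finset ι) :=
  Equiv.ofBijective (fun i => ⟨k i, Finset.mem_image_of_mem _ (Finset.mem_univ i)⟩)
    ⟨fun i j hij => hk (congrArg Subtype.val hij), fun ⟨x, hx⟩ => by
      obtain ⟨i, _, hi⟩ := Finset.mem_image.mp hx
      exact ⟨i, Subtype.ext hi⟩⟩

/-- The Fredholm Pfaffian of a step kernel is a finite Pfaffian. -/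
theorem fredholmPfaffian_step (hh : 0 < h) (M : ℕ) (A : ℕ → ℕ → Matrix (Fin 2) (Fin 2) ℂ) :
    fredholmPfaffian (stepCutoff s h M) (fun r r' => A (cellIndex s h r) (cellIndex s h r')) =
      pfaffian (blockJ (Fin M) - (h : ℂ) •
        Matrix.of fun x y : Fin M × Fin 2 => A x.1 y.1 x.2 y.2) := by
  set B : Matrix (Fin M × Fin 2) (Fin M × Fin 2) ℂ := Matrix.of fun x y => A x.1 y.1 x.2 y.2
  have h1 : ∀ n, ∫ r : Fin n → ℝ, pfaffianIntegrand (stepCutoff s h M)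
      (fun r r' => A (cellIndex s h r) (cellIndex s h r')) n r =
      ∑ k : Fin n → Fin M, (h : ℂ) ^ n *
        pfaffian (Matrix.of fun x y : Fin n × Fin 2 => A (k x.1) (k y.1) x.2 y.2) := by
    intro n
    refine Eq.trans ?_ (integral_step (s := s) (𝕜 := ℂ) hh M n
      (fun k => pfaffian (Matrix.of fun x y : Fin n × Fin 2 => A (k x.1) (k y.1) x.2 y.2)))
    refine integral_congr_ae (Eventually.of_forall fun r => ?_)
    simp only [pfaffianIntegrand, blockPfaffian_eq_pfaffian]
    rfl
  unfold fredholmPfaffian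
  simp_rw [h1]
  -- Sequences of cells with a repetition contribute nothing, so the series is a signed sum over
  -- sets of cells, which the expansion of Pf(J + A) resums.
  rw [tsum_seq_eq_sum_finset (R := ℂ) (fun n (k : Fin n → Fin M) => (h : ℂ) ^ n *
        pfaffian (Matrix.of fun x y : Fin n × Fin 2 => A (k x.1) (k y.1) x.2 y.2))
      (fun S => pfaffian (restrictSites ((h : ℂ) • B) S)), sub_eq_add_neg, pfaffian_blockJ_add]
  · refine Finset.sum_congr rfl fun S _ => ?_
    have : restrictSites (-((h : ℂ) • B)) S = (-1 : ℂ) • restrictSites ((h : ℂ) • B) S := by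
      ext x y
      simp [restrictSites]
    rw [this, pfaffian_smul, Fintype.card_coe]
  · intro n k hk
    rw [pfaffian_eq_zero_of_not_injective (fun a b : Fin M => A a b) k hk, mul_zero]
  · intro n k hk
    rw [← pfaffian_submatrix_equiv (imageEquiv k hk)]
    have : (restrictSites ((h : ℂ) • B) (Finset.univ.image k)).submatrix
        (Prod.map (imageEquiv k hk) id) (Prod.map (imageEquiv k hk) id) =
        (h : ℂ) • Matrix.of fun x y : Fin n × Fin 2 => A (k x.1) (k y.1) x.2 y.2 := by
      ext x y
      rfl
    rw [this, pfaffian_smul, Fintype.card_fin]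

/-- The Fredholm determinant of a step kernel is a finite determinant. -/
theorem fredholmDet_step (hh : 0 < h) (M : ℕ) (A : ℕ → ℕ → ℝ) :
    fredholmDet (stepCutoff s h M) (fun r r' => A (cellIndex s h r) (cellIndex s h r')) =
      (1 - h • Matrix.of fun x y : Fin M => A x y).det := by
  set B : Matrix (Fin M) (Fin M) ℝ := Matrix.of fun x y => A x y
  have h1 : ∀ n, ∫ r : Fin n → ℝ, detIntegrand (stepCutoff s h M)
      (fun r r' => A (cellIndex s h r) (cellIndex s h r')) n r =
      ∑ k : Fin n → Fin M, h ^ n * (Matrix.of fun x y : Fin n => A (k x) (k y)).det := by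
    intro n
    exact integral_step (s := s) (𝕜 := ℝ) hh M n
      (fun k => (Matrix.of fun x y : Fin n => A (k x) (k y)).det)
  unfold fredholmDet
  simp_rw [h1]
  rw [tsum_seq_eq_sum_finset (R := ℝ) (fun n (k : Fin n → Fin M) => h ^ n *
        (Matrix.of fun x y : Fin n => A (k x) (k y)).det)
      (fun S => ((h • B).submatrix (Subtype.val : S → Fin M) Subtype.val).det), sub_eq_add_neg,
      det_one_add_eq_sum]
  · refine Finset.sum_congr rfl fun S _ => ?_
    have : (-(h • B)).submatrix (Subtype.val : {x // x ∈ S} → Fin M)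
        (Subtype.val : {x // x ∈ S} → Fin M) =
        (-1 : ℝ) • (h • B).submatrix (Subtype.val : {x // x ∈ S} → Fin M)
        (Subtype.val : {x // x ∈ S} → Fin M) := by
      ext x y
      simp
    rw [this, Matrix.det_smul, Fintype.card_coe]
  · intro n k hk
    rw [det_eq_zero_of_not_injective (fun a b : Fin M => A a b) k hk, mul_zero]
  · intro n k hk
    rw [← Matrix.det_submatrix_equiv_self (imageEquiv k hk)]
    have : ((h • B).submatrix (Subtype.val : {x // x ∈ Finset.univ.image k} → Fin M)
        (Subtype.val : {x // x ∈ Finset.univ.image k} → Fin M)).submatrix (imageEquiv k hk) (imageEquiv k hk) =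
        h • Matrix.of fun x y : Fin n => A (k x) (k y) := by
      ext x y
      rfl
    rw [this, Matrix.det_smul, Fintype.card_fin]

end StepKernels

/-! ### Exact determinant identities for Hankel matrices and the truncated shift. -/

section HankelAlgebra

variable {R : Type*} [Field R] [CharZero R] {M : ℕ}

/-- The Hankel matrix of a sequence. -/
def hankelMatrix (R : Type*) (M : ℕ) (b : ℕ → R) : Matrix (Fin (M + 1)) (Fin (M + 1)) R :=
  Matrix.of fun i j => b (i + j)

/-- The shift matrix. -/
def shiftMatrix (R : Type*) [Zero R] [One R] (M : ℕ) : Matrix (Fin (M + 1)) (Fin (M + 1)) R :=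
  Matrix.of fun i j => if (i : ℕ) + 1 = j then 1 else 0

/-- The projection onto the first basis vector. -/
def cornerMatrix (R : Type*) [Zero R] [One R] (M : ℕ) : Matrix (Fin (M + 1)) (Fin (M + 1)) R :=
  Matrix.of fun i j => if i = 0 ∧ j = 0 then 1 else 0

/-- The antisymmetric difference matrix. -/
def skewShift (R : Type*) [Ring R] (M : ℕ) : Matrix (Fin (M + 1)) (Fin (M + 1)) R :=
  shiftMatrix R M - (shiftMatrix R M).transpose

/-- The one-sided differences of a Hankel matrix, averaged over neighbouring rows. -/
def hankelDiff (R : Type*) [Field R] (M : ℕ) (b : ℕ → R) :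
    Matrix (Fin (M + 1)) (Fin (M + 1)) R :=
  (1 / 2 : R) • ((1 + (shiftMatrix R M).transpose) * (1 - shiftMatrix R M) * hankelMatrix R M b)

/-- The truncated shift is an isometry except at the first basis vector. This corner defect is the
discrete boundary term at s, from which the rank-one part of the scalar kernel arises. -/
theorem shift_transpose_mul_shift :
    (shiftMatrix R M).transpose * shiftMatrix R M = 1 - cornerMatrix R M := by
  ext i j
  rw [Matrix.mul_apply]
  simp only [shiftMatrix, cornerMatrix, Matrix.transpose_apply, Matrix.of_apply, Matrix.sub_apply,
    Matrix.one_apply, mul_ite, mul_one, mul_zero]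
  rcases Fin.eq_zero_or_eq_succ j with rfl | ⟨k, rfl⟩
  · rw [Finset.sum_eq_zero]
    · by_cases hi : i = 0 <;> simp [hi]
    · intro l _
      rw [if_neg]
      simp
  · rw [Finset.sum_eq_single k.castSucc]
    · have : ((k : ℕ) + 1 = i) ↔ i = k.succ := by
        rw [Fin.ext_iff, Fin.val_succ]
        omega
      simp [this]
    · intro l _ hl
      rw [if_neg]
      intro h
      apply hl
      rw [Fin.ext_iff]
      simpa using h
    · simp

/-- Up to the corner, the central difference W is a forward difference followed by an average of
neighbours, and the factorization is exact at finite size. -/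
theorem skewShift_sub_corner : skewShift R M - cornerMatrix R M =
    (1 + (shiftMatrix R M).transpose) * (shiftMatrix R M - 1) := by
  rw [add_mul, mul_sub, mul_sub, shift_transpose_mul_shift, skewShift]
  simp only [one_mul, mul_one]
  abel

theorem skewShift_add_corner : skewShift R M + cornerMatrix R M =
    (1 - (shiftMatrix R M).transpose) * (1 + shiftMatrix R M) := by
  rw [sub_mul, mul_add, mul_add, shift_transpose_mul_shift, skewShift]
  simp only [one_mul, mul_one]
  abel

theorem hankelMatrix_transpose (b : ℕ → R) :
    (hankelMatrix R M b).transpose = hankelMatrix R M b := by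
  ext i j
  simp [hankelMatrix, add_comm]

theorem skewShift_transpose : (skewShift R M).transpose = -skewShift R M := by
  simp [skewShift]

theorem cornerMatrix_transpose : (cornerMatrix R M).transpose = cornerMatrix R M := by
  ext i j
  simp [cornerMatrix, and_comm]

theorem half_skewShift_mul_hankel (b : ℕ → R) :
    (1 / 2 : R) • (skewShift R M * hankelMatrix R M b) = - hankelDiff R M b +
      (1 / 2 : R) • (cornerMatrix R M * hankelMatrix R M b) := by
  have h : skewShift R M = (1 + (shiftMatrix R M).transpose) * (shiftMatrix R M - 1) +
      cornerMatrix R M := by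
    rw [← skewShift_sub_corner]
    abel
  rw [h, add_mul, smul_add, hankelDiff, ← smul_neg]
  congr 2
  rw [← neg_mul, ← mul_neg, neg_sub]

/-- The subtracted matrix lives on row 0 only, so the determinant is affine in c. -/
theorem det_sub_smul_corner_mul (A B : Matrix (Fin (M + 1)) (Fin (M + 1)) R) (c : R) :
    (A - c • (cornerMatrix R M * B)).det = A.det - c * (A.updateRow 0 (B 0)).det := by
  have h : A - c • (cornerMatrix R M * B) = A.updateRow 0 (A 0 + (-c) • B 0) := by
    have hB : ∀ i j, (cornerMatrix R M * B) i j = if i = 0 then B 0 j else 0 := by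
      intro i j
      rw [Matrix.mul_apply]
      by_cases hi : i = 0 <;> simp [cornerMatrix, hi]
    ext i j
    rw [Matrix.sub_apply, Matrix.smul_apply, hB, Matrix.updateRow_apply]
    by_cases hi : i = 0
    · subst hi
      simp
      ring
    · simp [hi]
  rw [h, Matrix.det_updateRow_add, Matrix.det_updateRow_smul, Matrix.updateRow_eq_self]
  ring

/-- 1 - WHWH/4 is the product of 1 - WH/2 and 1 + WH/2, and transposition followed by Sylvester's
identity exchanges the determinants of these two factors. -/
theorem det_one_sub_skew_mul_symm {n : Type*} [Fintype n] [DecidableEq n] (W H : Matrix n n R)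
    (hW : W.transpose = -W) (hH : H.transpose = H) :
    (1 - (1 / 4 : R) • (W * (H * W * H))).det = (1 - (1 / 2 : R) • (W * H)).det ^ 2 := by
  have h1 : (1 - (1 / 4 : R) • (W * (H * W * H))) =
      (1 - (1 / 2 : R) • (W * H)) * (1 + (1 / 2 : R) • (W * H)) := by
    rw [sub_mul, mul_add, mul_add]
    simp only [one_mul, mul_one, smul_mul_smul_comm, Matrix.mul_assoc]
    rw [show (1 / 2 : R) * (1 / 2) = 1 / 4 by norm_num]
    abel
  have h2 : (1 + (1 / 2 : R) • (W * H)).det = (1 - (1 / 2 : R) • (W * H)).det := by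
    rw [← Matrix.det_transpose, Matrix.transpose_add, Matrix.transpose_smul, Matrix.transpose_mul,
      hW, hH, Matrix.transpose_one, mul_neg, smul_neg, ← sub_eq_add_neg, ← Matrix.mul_smul,
      Matrix.det_one_sub_mul_comm, Matrix.smul_mul]
  rw [h1, Matrix.det_mul, h2, sq]

/-- Consider det(1 + T - c EH), which is affine in c. It is det(1 + T) at c = 0. At c = 1 it is
det(1 - T), by the other factorization `skewShift_add_corner`, transposition and Sylvester's
identity. The required value is at c = 1/2, the midpoint. -/
theorem det_one_sub_half_skewShift (b : ℕ → R) :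
    (1 - (1 / 2 : R) • (skewShift R M * hankelMatrix R M b)).det =
      1 / 2 * ((1 + hankelDiff R M b).det + (1 - hankelDiff R M b).det) := by
  set H := hankelMatrix R M b with hH
  set T := hankelDiff R M b with hT
  have h0 := half_skewShift_mul_hankel (M := M) b
  rw [← hH, ← hT] at h0
  have h1 : (1 - (1 / 2 : R) • (skewShift R M * H)) =
      (1 + T) - (1 / 2 : R) • (cornerMatrix R M * H) := by
    rw [h0]
    abel
  have h2 : ((1 + T) - (1 : R) • (cornerMatrix R M * H)).det = (1 - T).det := by
    have h3 : (1 + T) - (1 : R) • (cornerMatrix R M * H) =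
        1 - (1 / 2 : R) • ((1 - (shiftMatrix R M).transpose) * (1 + shiftMatrix R M) * H) := by
      rw [← skewShift_add_corner, add_mul, smul_add, h0]
      module
    rw [h3, ← Matrix.det_transpose, hT, hankelDiff]
    simp only [Matrix.transpose_sub, Matrix.transpose_add, Matrix.transpose_smul,
      Matrix.transpose_mul, Matrix.transpose_one, Matrix.transpose_transpose]
    rw [← hH, hH, hankelMatrix_transpose, ← Matrix.mul_smul, Matrix.det_one_sub_mul_comm,
      Matrix.smul_mul]
  rw [det_sub_smul_corner_mul] at h2
  rw [h1, det_sub_smul_corner_mul]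
  linear_combination (1 / 2 : R) * h2

/-- With Ω = HWH antisymmetric, det(1 - (W + cE)Ω/4) is even in c by transposition and affine in c
because E has rank one, hence constant. Replacing c = 0 by c = -1 makes W - E appear, which factors
exactly and yields T. -/
theorem det_one_sub_quarter_skewShift (b : ℕ → R) :
    (1 - (1 / 4 : R) • (skewShift R M * (hankelMatrix R M b * skewShift R M *
      hankelMatrix R M b))).det =
      (1 - hankelDiff R M b * (hankelDiff R M b -
        (1 / 2 : R) • (cornerMatrix R M * hankelMatrix R M b))).det := by
  set H := hankelMatrix R M b with hH
  set T := hankelDiff R M b with hT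
  set W := skewShift R M with hW
  set E := cornerMatrix R M with hE
  set Ω := H * W * H with hΩ
  have h0 := half_skewShift_mul_hankel (M := M) b
  rw [← hH, ← hT, ← hW, ← hE] at h0
  have hHt : H.transpose = H := hankelMatrix_transpose b
  have hWt : W.transpose = -W := skewShift_transpose
  have hEt : E.transpose = E := cornerMatrix_transpose
  have hΩt : Ω.transpose = -Ω := by
    simp only [hΩ, Matrix.transpose_mul, hHt, hWt]
    simp [Matrix.mul_assoc]
  have hodd : ∀ c : R, (1 - (1 / 4 : R) • ((W + c • E) * Ω)).det =
      (1 - (1 / 4 : R) • ((W - c • E) * Ω)).det := by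
    intro c
    rw [← Matrix.det_transpose]
    simp only [Matrix.transpose_sub, Matrix.transpose_add, Matrix.transpose_smul,
      Matrix.transpose_mul, Matrix.transpose_one, hΩt, hWt, hEt]
    rw [← Matrix.mul_smul, Matrix.det_one_sub_mul_comm]
    congr 2
    rw [Matrix.smul_mul]
    congr 1
    rw [mul_neg, ← neg_mul]
    congr 1
    abel
  have haff : ∀ c : R, (1 - (1 / 4 : R) • ((W + c • E) * Ω)).det =
      (1 - (1 / 4 : R) • (W * Ω)).det -
        c / 4 * ((1 - (1 / 4 : R) • (W * Ω)).updateRow 0 (Ω 0)).det := by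
    intro c
    rw [← det_sub_smul_corner_mul]
    congr 1
    rw [add_mul, smul_add, Matrix.smul_mul, smul_smul]
    rw [show (1 / 4 : R) * c = c / 4 by ring]
    abel
  have h1 := haff 1
  have h2 := haff (-1)
  have h3 := hodd 1
  rw [neg_smul, ← sub_eq_add_neg] at h2
  have h4 : (1 - (1 / 4 : R) • (W * Ω)).det = (1 - (1 / 4 : R) • ((W - (1 : R) • E) * Ω)).det := by
    linear_combination (-1 / 2 : R) * h1 - (1 / 2 : R) * h2 + (1 / 2 : R) * h3
  rw [h4]
  congr 2
  have h5 : (1 / 2 : R) • ((W - (1 : R) • E) * H) = -T := by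
    rw [one_smul, sub_mul, smul_sub, h0]
    abel
  calc (1 / 4 : R) • ((W - (1 : R) • E) * Ω)
      = ((1 / 2 : R) • ((W - (1 : R) • E) * H)) * ((1 / 2 : R) • (W * H)) := by
        rw [smul_mul_smul_comm, hΩ, show (1 / 2 : R) * (1 / 2) = 1 / 4 by norm_num]
        simp only [Matrix.mul_assoc]
    _ = T * (T - (1 / 2 : R) • (E * H)) := by
        rw [h5, h0, neg_mul, ← mul_neg]
        congr 1
        abel

end HankelAlgebra

/-! ### The finite Pfaffian as a determinant of half the size. -/

section HankelPfaffian

variable {M : ℕ}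

/-- The pairs of vectors, indexed by sites, from which the discrete kernel is built. -/
def siteVectors (M : ℕ) (b d : ℕ → ℂ) : Matrix (Fin (M + 1)) (Fin M × Fin 2) ℂ :=
  Matrix.of fun l x => if x.2 = 0 then b (l + x.1) else d (l + x.1)

/-- The matrix kernel of the discrete skew form at the sites. -/
noncomputable def siteKernel (M : ℕ) (b d : ℕ → ℂ) : Matrix (Fin M × Fin 2) (Fin M × Fin 2) ℂ :=
  (siteVectors M b d).transpose * ((1 / 4 : ℂ) • skewShift ℂ M) * siteVectors M b d

/-- Summation by parts: when h d is replaced by the difference of b, the products of b at equal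
shifts cancel in the antisymmetric combination, and only products at shifts differing by one remain.
-/
theorem siteVectors_mul_blockJ (b d : ℕ → ℂ) (h : ℂ) (hd : ∀ k, h * d k = b k - b (k + 1)) :
    h • (siteVectors M b d * blockJ (Fin M) * (siteVectors M b d).transpose) =
      -(hankelMatrix ℂ M b * skewShift ℂ M * hankelMatrix ℂ M b) := by
  have hS : ∀ i j, (hankelMatrix ℂ M b * shiftMatrix ℂ M * hankelMatrix ℂ M b) i j =
      ∑ k : Fin M, b (i + k) * b (j + k + 1) := by
    intro i j
    rw [Matrix.mul_apply, Fin.sum_univ_succ]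
    have h0 : (hankelMatrix ℂ M b * shiftMatrix ℂ M) i 0 = 0 := by
      simp [Matrix.mul_apply, shiftMatrix]
    rw [h0, zero_mul, zero_add]
    refine Finset.sum_congr rfl fun k _ => ?_
    congr 1
    · rw [Matrix.mul_apply, Finset.sum_eq_single k.castSucc]
      · simp [hankelMatrix, shiftMatrix]
      · intro l _ hl
        have : ¬ ((l : ℕ) + 1 = k.succ) := by
          intro hh
          apply hl
          rw [Fin.ext_iff]
          simpa using hh
        simp only [shiftMatrix, Matrix.of_apply, if_neg this, mul_zero]
      · simp
    · simp only [hankelMatrix, Matrix.of_apply, Fin.val_succ]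
      congr 1
      omega
  have hSt : hankelMatrix ℂ M b * (shiftMatrix ℂ M).transpose * hankelMatrix ℂ M b =
      (hankelMatrix ℂ M b * shiftMatrix ℂ M * hankelMatrix ℂ M b).transpose := by
    simp only [Matrix.transpose_mul, hankelMatrix_transpose, Matrix.mul_assoc]
  have hXJ : ∀ (l : Fin (M + 1)) (k : Fin M),
      (siteVectors M b d * blockJ (Fin M)) l (k, 0) = -d (l + k) ∧
      (siteVectors M b d * blockJ (Fin M)) l (k, 1) = b (l + k) := by
    intro l k
    simp only [Matrix.mul_apply, Fintype.sum_prod_type, Fin.sum_univ_two]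
    simp [siteVectors, blockJ, Finset.sum_ite_eq']
  ext i j
  rw [skewShift, mul_sub, sub_mul, hSt, Matrix.smul_apply, Matrix.neg_apply, Matrix.sub_apply,
    Matrix.transpose_apply, hS, hS, Matrix.mul_apply, Fintype.sum_prod_type, smul_eq_mul,
    Finset.mul_sum, ← Finset.sum_sub_distrib, ← Finset.sum_neg_distrib]
  refine Finset.sum_congr rfl fun k _ => ?_
  rw [Fin.sum_univ_two, (hXJ i k).1, (hXJ i k).2]
  simp only [siteVectors, Matrix.transpose_apply, Matrix.of_apply]
  have h1 := hd (i + k)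
  have h2 := hd (j + k)
  simp only [if_true, one_ne_zero, if_false]
  linear_combination (b (i + k)) * h2 - b (j + k) * h1

theorem blockJ_mul_self : blockJ (Fin M) * blockJ (Fin M) = -1 := by
  ext ⟨i, a⟩ ⟨j, c⟩
  simp only [Matrix.mul_apply, Fintype.sum_prod_type, Fin.sum_univ_two]
  fin_cases a <;> fin_cases c <;>
    by_cases hij : i = j <;> simp [blockJ, hij]

theorem det_blockJ : (blockJ (Fin M)).det = 1 := by
  have h : blockJ (Fin M) = Matrix.kroneckerMap (· * ·) (1 : Matrix (Fin M) (Fin M) ℂ)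
      !![0, 1; -1, 0] := by
    ext ⟨i, a⟩ ⟨j, c⟩
    fin_cases a <;> fin_cases c <;> by_cases hij : i = j <;> simp [blockJ, hij]
  rw [h, Matrix.det_kronecker]
  simp [Matrix.det_fin_two]

theorem blockJ_transpose : (blockJ (Fin M)).transpose = -blockJ (Fin M) := by
  ext ⟨i, a⟩ ⟨j, c⟩
  fin_cases a <;> fin_cases c <;> by_cases hij : i = j <;> simp [blockJ, hij, Ne.symm, eq_comm]

theorem siteKernel_transpose (b d : ℕ → ℂ) : (siteKernel M b d).transpose = -siteKernel M b d := by
  simp only [siteKernel, Matrix.transpose_mul, Matrix.transpose_smul, skewShift_transpose,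
    Matrix.transpose_transpose]
  simp [Matrix.mul_assoc]

/-- With J factored out, Sylvester's identity moves the determinant from pairs of sites to the M + 1
summation indices. There h X J Xᵀ = -HWH, and the determinant becomes that of 1 - WHWH/4, a perfect
square. -/
theorem pfaffian_blockJ_sub_sq (b d : ℕ → ℂ) (h : ℂ) (hd : ∀ k, h * d k = b k - b (k + 1)) :
    pfaffian (blockJ (Fin M) - h • siteKernel M b d) ^ 2 =
      (1 - (1 / 2 : ℂ) • (skewShift ℂ M * hankelMatrix ℂ M b)).det ^ 2 := by
  rw [pfaffian_sq, ← det_one_sub_skew_mul_symm _ _ skewShift_transpose (hankelMatrix_transpose b)]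
  · set X := siteVectors M b d
    have h1 : blockJ (Fin M) - h • siteKernel M b d = blockJ (Fin M) *
        (1 + (blockJ (Fin M) * X.transpose) * (h • ((1 / 4 : ℂ) • skewShift ℂ M * X))) := by
      rw [mul_add, mul_one, Matrix.mul_assoc, ← Matrix.mul_assoc (blockJ (Fin M)) (blockJ (Fin M)),
        blockJ_mul_self, neg_mul, one_mul, ← sub_eq_add_neg]
      simp only [siteKernel, Matrix.smul_mul, Matrix.mul_smul, Matrix.mul_assoc, X]
    rw [h1, Matrix.det_mul, det_blockJ, one_mul, Matrix.det_one_add_mul_comm]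
    have h2 := siteVectors_mul_blockJ (M := M) b d h hd
    rw [sub_eq_add_neg]
    congr 2
    calc h • ((1 / 4 : ℂ) • skewShift ℂ M * X) * (blockJ (Fin M) * X.transpose)
        = (1 / 4 : ℂ) • (skewShift ℂ M * (h • (X * blockJ (Fin M) * X.transpose))) := by
          simp only [Matrix.smul_mul, Matrix.mul_smul, Matrix.mul_assoc]
          rw [smul_comm]
      _ = _ := by
          rw [h2, mul_neg, smul_neg]
  · rw [Matrix.transpose_sub, Matrix.transpose_smul, blockJ_transpose, siteKernel_transpose]
    module

theorem pfaffian_blockJ : pfaffian (blockJ (Fin M)) = 1 := by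
  have h := pfaffian_blockJ_add (0 : Matrix (Fin M × Fin 2) (Fin M × Fin 2) ℂ)
  rw [add_zero] at h
  rw [h, Finset.sum_eq_single ∅]
  · simp [pfaffian]
  · intro S _ hS
    obtain ⟨q, hq⟩ := Finset.nonempty_iff_ne_empty.mpr hS
    exact pfaffian_eq_zero_of_site _ (⟨q, hq⟩, 0) (fun _ => rfl) (fun _ => rfl)
  · simp

/-- The finite Pfaffian of the discrete kernel is a determinant of half the size. -/
theorem pfaffian_blockJ_sub (b d : ℕ → ℂ) (h : ℂ) (hd : ∀ k, h * d k = b k - b (k + 1)) :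
    pfaffian (blockJ (Fin M) - h • siteKernel M b d) =
      (1 - (1 / 2 : ℂ) • (skewShift ℂ M * hankelMatrix ℂ M b)).det := by
  -- The squares leave a sign open. Scaling both sequences by c makes the two sides entire functions
  -- of c with equal squares and common value 1 at c = 0; they agree near 0, where their sum is
  -- nonzero, hence everywhere.
  let p : ℂ → ℂ := fun c => pfaffian (blockJ (Fin M) - h • (c ^ 2 • siteKernel M b d))
  let q : ℂ → ℂ := fun c => (1 - (1 / 2 : ℂ) • (skewShift ℂ M * (c • hankelMatrix ℂ M b))).det
  have hsq : ∀ c, p c ^ 2 = q c ^ 2 := by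
    intro c
    have h1 := pfaffian_blockJ_sub_sq (M := M) (c • b) (c • d) h (fun k => by
      simp only [Pi.smul_apply, smul_eq_mul]
      linear_combination c * hd k)
    have h2 : siteKernel M (c • b) (c • d) = c ^ 2 • siteKernel M b d := by
      have : siteVectors M (c • b) (c • d) = c • siteVectors M b d := by
        ext l x
        by_cases hx : x.2 = 0 <;> simp [siteVectors, hx]
      simp only [siteKernel, this, Matrix.transpose_smul, Matrix.smul_mul, Matrix.mul_smul,
        smul_smul]
      congr 1
      ring
    have h3 : hankelMatrix ℂ M (c • b) = c • hankelMatrix ℂ M b := by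
      ext i j
      simp [hankelMatrix]
    rw [h2, h3] at h1
    exact h1
  have hp : Differentiable ℂ p := by
    simp only [p, pfaffian, Matrix.sub_apply, Matrix.smul_apply]
    fun_prop
  have hq : Differentiable ℂ q := by
    have hq' : ∀ c, q c = ∑ σ : Equiv.Perm (Fin (M + 1)), ((Equiv.Perm.sign σ : ℤ) : ℂ) *
        ∏ i, ((1 : Matrix (Fin (M + 1)) (Fin (M + 1)) ℂ) (σ i) i -
          1 / 2 * (c * (skewShift ℂ M * hankelMatrix ℂ M b) (σ i) i)) := by
      intro c
      simp only [q, Matrix.det_apply']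
      simp
    rw [funext hq']
    fun_prop
  have hp0 : p 0 = 1 := by
    simp only [p]
    simp [pfaffian_blockJ]
  have hq0 : q 0 = 1 := by simp [q]
  have hpa : AnalyticOnNhd ℂ p Set.univ := hp.differentiableOn.analyticOnNhd isOpen_univ
  have hqa : AnalyticOnNhd ℂ q Set.univ := hq.differentiableOn.analyticOnNhd isOpen_univ
  have hev : p =ᶠ[𝓝 0] q := by
    have hne : ∀ᶠ c in 𝓝 (0 : ℂ), p c + q c ≠ 0 :=
      ((hp.continuous.add hq.continuous).continuousAt).eventually_ne (by
        change p 0 + q 0 ≠ 0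
        rw [hp0, hq0]
        norm_num)
    filter_upwards [hne] with c hc
    have h1 : (p c - q c) * (p c + q c) = 0 := by linear_combination hsq c
    exact sub_eq_zero.mp ((mul_eq_zero.mp h1).resolve_right hc)
  have := congrFun (hpa.eq_of_eventuallyEq hqa hev) 1
  simpa [p, q] using this

end HankelPfaffian

/-! ### Gaussian decay on vertical lines and shifts of contours. -/

section VerticalLines

/-- The Gaussian bound for integrands on vertical lines. -/
noncomputable def gaussBound (κ a y : ℝ) : ℝ := Real.exp (κ * |y| - a * y ^ 2)

theorem gaussBound_pos (κ a y : ℝ) : 0 < gaussBound κ a y := Real.exp_pos _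

theorem integrable_gaussBound (κ : ℝ) {a : ℝ} (ha : 0 < a) : Integrable (gaussBound κ a) := by
  have h : ∀ y, gaussBound κ a y ≤ Real.exp (κ ^ 2 / (2 * a)) * Real.exp (-(a / 2) * y ^ 2) := by
    intro y
    rw [gaussBound, ← Real.exp_add]
    apply Real.exp_le_exp.mpr
    have h1 : κ ^ 2 / (2 * a) + -(a / 2) * y ^ 2 - (κ * |y| - a * y ^ 2) =
        (κ - a * |y|) ^ 2 / (2 * a) := by
      field_simp
      rw [← sq_abs y]
      ring
    have h2 : 0 ≤ (κ - a * |y|) ^ 2 / (2 * a) := by positivity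
    linarith
  refine ((integrable_exp_neg_mul_sq (half_pos ha)).const_mul
    (Real.exp (κ ^ 2 / (2 * a)))).mono' ?_
    (Eventually.of_forall fun y => ?_)
  · unfold gaussBound
    fun_prop
  · rw [Real.norm_of_nonneg (gaussBound_pos _ _ _).le]
    exact h y

theorem tendsto_gaussBound (κ : ℝ) {a : ℝ} (ha : 0 < a) :
    Tendsto (gaussBound κ a) atTop (𝓝 0) := by
  refine Real.tendsto_exp_atBot.comp ?_
  have h1 : Tendsto (fun y : ℝ => y * (κ - a * y)) atTop atBot := by
    refine Tendsto.atTop_mul_atBot₀ tendsto_id ?_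
    refine tendsto_atBot_add_const_left _ κ ?_ |>.congr (fun y => (sub_eq_add_neg _ _).symm)
    exact tendsto_neg_atTop_atBot.comp (tendsto_id.const_mul_atTop ha)
  refine h1.congr' ?_
  filter_upwards [eventually_ge_atTop 0] with y hy
  rw [abs_of_nonneg hy]
  ring

/-- Cauchy's theorem on the rectangle of height 2T; the Gaussian bound, uniform in the abscissa,
makes the horizontal sides vanish as T → ∞. -/
theorem integral_vertical_eq_of_le (f : ℂ → ℂ) {a b : ℝ} (ha : 0 < a) (hab : a ≤ b)
    (hf : DifferentiableOn ℂ f {v | 0 < v.re}) {C κ c : ℝ} (hc : 0 < c)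
    (hb : ∀ x y : ℝ, a ≤ x → x ≤ b → ‖f (x + y * I)‖ ≤ C * gaussBound κ c y) :
    ∫ y : ℝ, f (a + y * I) = ∫ y : ℝ, f (b + y * I) := by
  have hcont : ∀ x : ℝ, 0 < x → Continuous fun y : ℝ => f (x + y * I) := by
    intro x hx
    refine hf.continuousOn.comp_continuous (by fun_prop) fun y => ?_
    simpa using hx
  have hint : ∀ x : ℝ, a ≤ x → x ≤ b → Integrable fun y : ℝ => f (x + y * I) := by
    intro x h1 h2
    exact ((integrable_gaussBound κ hc).const_mul C).mono'
      (hcont x (ha.trans_le h1)).aestronglyMeasurable (Eventually.of_forall fun y => hb x y h1 h2)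
  have hrect : ∀ T : ℝ, (∫ x in a..b, f (x + ((-T : ℝ) : ℂ) * I)) -
      (∫ x in a..b, f (x + (T : ℂ) * I)) + I • (∫ y in (-T)..T, f (b + y * I)) -
      I • (∫ y in (-T)..T, f (a + y * I)) = 0 := by
    intro T
    have h := integral_boundary_rect_eq_zero_of_differentiableOn f
      (a + ((-T : ℝ) : ℂ) * I) (b + (T : ℂ) * I) (hf.mono ?_)
    · simpa using h
    · intro v hv
      rw [mem_reProdIm] at hv
      have h1 := hv.1
      simp only [add_re, ofReal_re, mul_re, I_re, mul_zero, ofReal_im, I_im, mul_one, sub_self,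
        add_zero, Set.uIcc_of_le hab] at h1
      exact ha.trans_le h1.1
  have hvert : ∀ x : ℝ, a ≤ x → x ≤ b → Tendsto (fun T : ℝ => ∫ y in (-T)..T, f (x + y * I)) atTop
      (𝓝 (∫ y : ℝ, f (x + y * I))) := fun x h1 h2 =>
    intervalIntegral_tendsto_integral (hint x h1 h2) tendsto_neg_atTop_atBot tendsto_id
  have hhor : ∀ σ : ℝ, |σ| = 1 →
      Tendsto (fun T : ℝ => ∫ x in a..b, f (x + ((σ * T : ℝ) : ℂ) * I)) atTop (𝓝 0) := by
    intro σ hσ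
    have hlim : Tendsto (fun T => C * gaussBound κ c T * |b - a|) atTop (𝓝 0) := by
      simpa using ((tendsto_gaussBound κ hc).const_mul C).mul_const |b - a|
    refine squeeze_zero_norm (fun T => ?_) hlim
    refine intervalIntegral.norm_integral_le_of_norm_le_const fun x hx => ?_
    rw [Set.uIoc_of_le hab] at hx
    have h := hb x (σ * T) hx.1.le hx.2
    have h2 : gaussBound κ c (σ * T) = gaussBound κ c T := by
      unfold gaussBound
      rw [abs_mul, hσ, one_mul, mul_pow, ← sq_abs σ, hσ, one_pow, one_mul]
    rwa [h2] at h
  have hl := (((hhor (-1) (by simp)).sub (hhor 1 (by simp))).add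
    ((hvert b hab le_rfl).const_smul I)).sub ((hvert a le_rfl hab).const_smul I)
  have h0 : Tendsto (fun _ : ℝ => (0 : ℂ)) atTop (𝓝 0) := tendsto_const_nhds
  have hE := tendsto_nhds_unique (hl.congr fun T => by
    simpa using hrect T) h0
  simp only [sub_zero, zero_add, smul_eq_mul] at hE
  have h1 : I * (∫ y : ℝ, f (b + y * I)) = I * ∫ y : ℝ, f (a + y * I) := by
    linear_combination hE
  exact (mul_left_cancel₀ I_ne_zero h1).symm

/-- Since Re (a + iy)³ = a³ - 3ay², the cubic exponential is Gaussian in y when a > 0. This decay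
dominates every symbol below. -/
theorem norm_exp_cube (a y r : ℝ) :
    ‖exp (-(r : ℂ) * (a + y * I) + (a + y * I) ^ 3 / 3)‖ =
      Real.exp (a ^ 3 / 3 - r * a) * Real.exp (-a * y ^ 2) := by
  rw [Complex.norm_exp, ← Real.exp_add]
  congr 1
  have h : -(r : ℂ) * (a + y * I) + (a + y * I) ^ 3 / 3 =
      ((a ^ 3 / 3 - r * a + -a * y ^ 2 : ℝ) : ℂ) + ((-r * y + a ^ 2 * y - y ^ 3 / 3 : ℝ) : ℂ) * I := by
    push_cast
    linear_combination ((a : ℂ) * y ^ 2 + (y : ℂ) ^ 3 / 3 * I) * I_sq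
  rw [h, Complex.add_re, Complex.ofReal_re, Complex.re_ofReal_mul, I_re]
  ring

/-- Analytic functions on the right half plane of exponential growth along vertical lines. -/
structure IsSymbol (p : ℂ → ℂ) : Prop where
  differentiableOn : DifferentiableOn ℂ p {v | 0 < v.re}
  growth : ∀ a b : ℝ, 0 < a → a ≤ b → ∃ C κ : ℝ, 0 ≤ C ∧ 0 ≤ κ ∧
    ∀ x y : ℝ, a ≤ x → x ≤ b → ‖p (x + y * I)‖ ≤ C * Real.exp (κ * |y|)

theorem IsSymbol.continuous_line {p : ℂ → ℂ} (hp : IsSymbol p) {a : ℝ} (ha : 0 < a) :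
    Continuous fun y : ℝ => p (a + y * I) := by
  refine hp.differentiableOn.continuousOn.comp_continuous (by fun_prop) fun y => ?_
  simpa using ha

end VerticalLines

/-! ### Entries of the kernels as double contour integrals of a pair of symbols. -/

section PairEntries

/-- An entry of a matrix kernel with the symbols `p` and `q`. -/
noncomputable def pairEntry (p q : ℂ → ℂ) (a b r r' : ℝ) : ℂ :=
  doubleContour a b fun v w => p v * q w * contourWeight r r' v w

theorem doubleContour_eq (a b : ℝ) (F : ℂ → ℂ → ℂ) : doubleContour a b F =
    (1 / (4 * (Real.pi : ℂ) ^ 2)) * ∫ p : ℝ × ℝ, F (a + p.1 * I) (b + p.2 * I) := by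
  unfold doubleContour
  have h : ∀ z : ℂ, z * I * I = -z := fun z => by
    rw [mul_assoc, I_mul_I]
    ring
  simp_rw [h]
  rw [integral_neg, mul_neg, ← neg_mul]
  congr 1
  rw [mul_pow, mul_pow, I_sq]
  have : (Real.pi : ℂ) ≠ 0 := by exact_mod_cast Real.pi_ne_zero
  field_simp
  norm_num

theorem one_add_norm_line_le {a : ℝ} (ha : 0 < a) (y : ℝ) :
    1 + ‖(a : ℂ) + y * I‖ ≤ (1 + a) * Real.exp |y| := by
  have h1 : ‖(a : ℂ) + y * I‖ ≤ a + |y| := by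
    refine (norm_add_le _ _).trans ?_
    simp [abs_of_pos ha]
  have h2 := Real.add_one_le_exp |y|
  nlinarith [abs_nonneg y, mul_nonneg ha.le (abs_nonneg y)]

/-- The denominator has real part a + b, so it stays away from 0. Bounding |v - w| by (1 + |v|)(1 +
|w|) separates the variables, at the price of one exponential of |y| in each Gaussian. -/
theorem norm_contourWeight_le {a b : ℝ} (ha : 0 < a) (hb : 0 < b) (r r' y y' : ℝ) :
    ‖contourWeight r r' (a + y * I) (b + y' * I)‖ ≤
      ((1 + a) * (1 + b) / (a + b) * Real.exp (a ^ 3 / 3) * Real.exp (b ^ 3 / 3)) *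
        Real.exp (-(r * a) - r' * b) * (gaussBound 1 a y * gaussBound 1 b y') := by
  set v : ℂ := a + y * I with hv
  set w : ℂ := b + y' * I with hw
  have hvw : a + b ≤ ‖v + w‖ := by
    have h := Complex.re_le_norm (v + w)
    simpa [hv, hw] using h
  have h1 : ‖(v - w) / (v + w)‖ ≤ ((1 + a) * Real.exp |y|) * ((1 + b) * Real.exp |y'|) / (a + b) := by
    rw [norm_div]
    have h2 := one_add_norm_line_le ha y
    have h3 := one_add_norm_line_le hb y'
    have h4 : ‖v - w‖ ≤ (1 + ‖v‖) * (1 + ‖w‖) := by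
      refine (norm_sub_le _ _).trans ?_
      nlinarith [norm_nonneg v, norm_nonneg w, mul_nonneg (norm_nonneg v) (norm_nonneg w)]
    have h5 : ‖v - w‖ ≤ ((1 + a) * Real.exp |y|) * ((1 + b) * Real.exp |y'|) :=
      h4.trans (mul_le_mul h2 h3 (by positivity) (by positivity))
    exact div_le_div₀ (by positivity) h5 (by positivity) hvw
  have h6 : exp (-(r : ℂ) * v - (r' : ℂ) * w + (v ^ 3 + w ^ 3) / 3) =
      exp (-(r : ℂ) * v + v ^ 3 / 3) * exp (-(r' : ℂ) * w + w ^ 3 / 3) := by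
    rw [← Complex.exp_add]
    congr 1
    ring
  rw [contourWeight, norm_mul, h6, norm_mul, hv, hw, norm_exp_cube, norm_exp_cube, ← hv, ← hw]
  refine (mul_le_mul_of_nonneg_right h1 (by positivity)).trans (le_of_eq ?_)
  have e1 : gaussBound 1 a y = Real.exp |y| * Real.exp (-a * y ^ 2) := by
    rw [gaussBound, ← Real.exp_add]
    congr 1
    ring
  have e2 : gaussBound 1 b y' = Real.exp |y'| * Real.exp (-b * y' ^ 2) := by
    rw [gaussBound, ← Real.exp_add]
    congr 1
    ring
  have e3 : Real.exp (a ^ 3 / 3 - r * a) = Real.exp (a ^ 3 / 3) * Real.exp (-(r * a)) := by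
    rw [← Real.exp_add]
    congr 1
  have e4 : Real.exp (b ^ 3 / 3 - r' * b) = Real.exp (b ^ 3 / 3) * Real.exp (-(r' * b)) := by
    rw [← Real.exp_add]
    congr 1
  have e5 : Real.exp (-(r * a) - r' * b) = Real.exp (-(r * a)) * Real.exp (-(r' * b)) := by
    rw [← Real.exp_add]
    congr 1
  rw [e1, e2, e3, e4, e5]
  ring

/-- The constant in the bound of an entry in terms of the bounds of its symbols. -/
noncomputable def pairConst (κ a b : ℝ) : ℝ :=
  (1 + a) * (1 + b) / (a + b) * Real.exp (a ^ 3 / 3) * Real.exp (b ^ 3 / 3) *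
    ((∫ y, gaussBound (κ + 1) a y) * ∫ y, gaussBound (κ + 1) b y)

theorem gaussBound_mul_exp (κ κ' a y : ℝ) :
    Real.exp (κ * |y|) * gaussBound κ' a y = gaussBound (κ + κ') a y := by
  rw [gaussBound, gaussBound, ← Real.exp_add]
  congr 1
  ring

theorem norm_pairIntegrand_le {p q : ℂ → ℂ} {a b : ℝ} (ha : 0 < a) (hb : 0 < b) {C D κ : ℝ}
    (hC : 0 ≤ C) (hD : 0 ≤ D) {r r' y y' : ℝ}
    (hp : ‖p (a + y * I)‖ ≤ C * Real.exp (κ * |y|))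
    (hq : ‖q (b + y' * I)‖ ≤ D * Real.exp (κ * |y'|)) :
    ‖p (a + y * I) * q (b + y' * I) * contourWeight r r' (a + y * I) (b + y' * I)‖ ≤
      (C * D * ((1 + a) * (1 + b) / (a + b) * Real.exp (a ^ 3 / 3) * Real.exp (b ^ 3 / 3)) *
        Real.exp (-(r * a) - r' * b)) * (gaussBound (κ + 1) a y * gaussBound (κ + 1) b y') := by
  rw [norm_mul, norm_mul]
  refine (mul_le_mul (mul_le_mul hp hq (norm_nonneg _) (by positivity))
    (norm_contourWeight_le ha hb r r' y y') (norm_nonneg _) (by positivity)).trans (le_of_eq ?_)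
  rw [← gaussBound_mul_exp, ← gaussBound_mul_exp]
  ring

theorem integrable_gaussBound_prod (κ : ℝ) {a b : ℝ} (ha : 0 < a) (hb : 0 < b) :
    Integrable fun p : ℝ × ℝ => gaussBound κ a p.1 * gaussBound κ b p.2 :=
  (integrable_gaussBound κ ha).mul_prod (integrable_gaussBound κ hb)

theorem continuous_contourWeight_lines {a b : ℝ} (ha : 0 < a) (hb : 0 < b) :
    Continuous fun x : (ℝ × ℝ) × (ℝ × ℝ) =>
      contourWeight x.1.1 x.1.2 (a + x.2.1 * I) (b + x.2.2 * I) := by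
  unfold contourWeight
  refine Continuous.mul (Continuous.div (by fun_prop) (by fun_prop) fun x => ?_) (by fun_prop)
  intro h
  have := congrArg Complex.re h
  simp at this
  linarith

theorem continuous_pairIntegrand {p q : ℂ → ℂ} {a b : ℝ} (ha : 0 < a) (hb : 0 < b)
    (hp : Continuous fun y : ℝ => p (a + y * I)) (hq : Continuous fun y : ℝ => q (b + y * I)) :
    Continuous fun x : (ℝ × ℝ) × (ℝ × ℝ) => p (a + x.2.1 * I) * q (b + x.2.2 * I) *
      contourWeight x.1.1 x.1.2 (a + x.2.1 * I) (b + x.2.2 * I) :=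
  ((hp.comp (continuous_fst.comp continuous_snd)).mul
    (hq.comp (continuous_snd.comp continuous_snd))).mul (continuous_contourWeight_lines ha hb)

theorem continuous_pairIntegrand_right {p q : ℂ → ℂ} {a b : ℝ} (ha : 0 < a) (hb : 0 < b)
    (hp : Continuous fun y : ℝ => p (a + y * I)) (hq : Continuous fun y : ℝ => q (b + y * I))
    (r r' : ℝ) : Continuous fun x : ℝ × ℝ => p (a + x.1 * I) * q (b + x.2 * I) *
      contourWeight r r' (a + x.1 * I) (b + x.2 * I) := by
  refine ((hp.comp continuous_fst).mul (hq.comp continuous_snd)).mul ?_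
  unfold contourWeight
  refine Continuous.mul (Continuous.div (by fun_prop) (by fun_prop) fun x => ?_) (by fun_prop)
  intro h
  have := congrArg Complex.re h
  simp at this
  linarith

theorem measurable_pairEntry {p q : ℂ → ℂ} {a b : ℝ} (ha : 0 < a) (hb : 0 < b)
    (hp : Continuous fun y : ℝ => p (a + y * I)) (hq : Continuous fun y : ℝ => q (b + y * I)) :
    Measurable fun x : ℝ × ℝ => pairEntry p q a b x.1 x.2 := by
  unfold pairEntry
  simp_rw [doubleContour_eq]
  refine Measurable.const_mul ?_ _
  exact (continuous_pairIntegrand ha hb hp hq).stronglyMeasurable.integral_prod_right.measurable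

theorem integrable_pairIntegrand {p q : ℂ → ℂ} {a b : ℝ} (ha : 0 < a) (hb : 0 < b) {C D κ : ℝ}
    (hC : 0 ≤ C) (hD : 0 ≤ D)
    (hpc : Continuous fun y : ℝ => p (a + y * I)) (hqc : Continuous fun y : ℝ => q (b + y * I))
    (hp : ∀ y : ℝ, ‖p (a + y * I)‖ ≤ C * Real.exp (κ * |y|))
    (hq : ∀ y : ℝ, ‖q (b + y * I)‖ ≤ D * Real.exp (κ * |y|)) (r r' : ℝ) :
    Integrable fun x : ℝ × ℝ => p (a + x.1 * I) * q (b + x.2 * I) *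
      contourWeight r r' (a + x.1 * I) (b + x.2 * I) :=
  ((integrable_gaussBound_prod (κ + 1) ha hb).const_mul _).mono'
    (continuous_pairIntegrand_right ha hb hpc hqc r r').aestronglyMeasurable
    (Eventually.of_forall fun x => norm_pairIntegrand_le ha hb hC hD (hp x.1) (hq x.2))

theorem norm_pairEntry_le {p q : ℂ → ℂ} {a b : ℝ} (ha : 0 < a) (hb : 0 < b) {C D κ : ℝ}
    (hC : 0 ≤ C) (hD : 0 ≤ D)
    (hp : ∀ y : ℝ, ‖p (a + y * I)‖ ≤ C * Real.exp (κ * |y|))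
    (hq : ∀ y : ℝ, ‖q (b + y * I)‖ ≤ D * Real.exp (κ * |y|)) (r r' : ℝ) :
    ‖pairEntry p q a b r r'‖ ≤ C * D * pairConst κ a b * Real.exp (-(r * a) - r' * b) := by
  rw [pairEntry, doubleContour_eq, norm_mul]
  have h1 : ‖(1 / (4 * (Real.pi : ℂ) ^ 2))‖ ≤ 1 := by
    rw [norm_div, norm_one, norm_mul, norm_pow, Complex.norm_real, Real.norm_of_nonneg
      Real.pi_pos.le, div_le_one (by simp [Real.pi_pos])]
    have := Real.pi_gt_three
    norm_num
    nlinarith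
  have h2 := norm_integral_le_of_norm_le ((integrable_gaussBound_prod (κ + 1) ha hb).const_mul
    (C * D * ((1 + a) * (1 + b) / (a + b) * Real.exp (a ^ 3 / 3) * Real.exp (b ^ 3 / 3)) *
        Real.exp (-(r * a) - r' * b)))
    (Eventually.of_forall fun x : ℝ × ℝ => norm_pairIntegrand_le (r := r) (r' := r') ha hb hC hD
      (hp x.1) (hq x.2))
  have h3 : ∫ x : ℝ × ℝ, gaussBound (κ + 1) a x.1 * gaussBound (κ + 1) b x.2 =
      (∫ y, gaussBound (κ + 1) a y) * ∫ y, gaussBound (κ + 1) b y := integral_prod_mul _ _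
  rw [integral_const_mul, h3] at h2
  refine (mul_le_mul h1 h2 (norm_nonneg _) zero_le_one).trans (le_of_eq ?_)
  rw [pairConst]
  ring

theorem pairConst_nonneg (κ : ℝ) {a b : ℝ} (ha : 0 < a) (hb : 0 < b) : 0 ≤ pairConst κ a b := by
  unfold pairConst
  have h1 : 0 ≤ ∫ y, gaussBound (κ + 1) a y := integral_nonneg fun y => (gaussBound_pos _ _ _).le
  have h2 : 0 ≤ ∫ y, gaussBound (κ + 1) b y := integral_nonneg fun y => (gaussBound_pos _ _ _).le
  positivity

/-- Dominated convergence for double contour integrals. -/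
theorem tendsto_doubleContour {ι : Type*} {l : Filter ι} [l.IsCountablyGenerated]
    {F : ι → ℂ → ℂ → ℂ} {F' : ℂ → ℂ → ℂ} {a b : ℝ} (ha : 0 < a) (hb : 0 < b) {C κ : ℝ}
    (hc : ∀ᶠ i in l, Continuous fun x : ℝ × ℝ => F i (a + x.1 * I) (b + x.2 * I))
    (hbd : ∀ᶠ i in l, ∀ y y' : ℝ, ‖F i (a + y * I) (b + y' * I)‖ ≤
      C * (gaussBound κ a y * gaussBound κ b y'))
    (hlim : ∀ y y' : ℝ, Tendsto (fun i => F i (a + y * I) (b + y' * I)) l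
      (𝓝 (F' (a + y * I) (b + y' * I)))) :
    Tendsto (fun i => doubleContour a b (F i)) l (𝓝 (doubleContour a b F')) := by
  simp_rw [doubleContour_eq]
  refine Tendsto.const_mul _ ?_
  refine tendsto_integral_filter_of_dominated_convergence _
    (hc.mono fun i hi => hi.aestronglyMeasurable)
    (hbd.mono fun i hi => Eventually.of_forall fun x => hi x.1 x.2)
    ((integrable_gaussBound_prod κ ha hb).const_mul C)
    (Eventually.of_forall fun x => hlim x.1 x.2)

theorem tendsto_pairEntry {ι : Type*} {l : Filter ι} [l.IsCountablyGenerated]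
    {p q : ι → ℂ → ℂ} {p' q' : ℂ → ℂ} {a b : ℝ} (ha : 0 < a) (hb : 0 < b) {C D κ : ℝ}
    (hC : 0 ≤ C) (hD : 0 ≤ D)
    (hpc : ∀ᶠ i in l, Continuous fun y : ℝ => p i (a + y * I))
    (hqc : ∀ᶠ i in l, Continuous fun y : ℝ => q i (b + y * I))
    (hp : ∀ᶠ i in l, ∀ y : ℝ, ‖p i (a + y * I)‖ ≤ C * Real.exp (κ * |y|))
    (hq : ∀ᶠ i in l, ∀ y : ℝ, ‖q i (b + y * I)‖ ≤ D * Real.exp (κ * |y|))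
    (hpl : ∀ y : ℝ, Tendsto (fun i => p i (a + y * I)) l (𝓝 (p' (a + y * I))))
    (hql : ∀ y : ℝ, Tendsto (fun i => q i (b + y * I)) l (𝓝 (q' (b + y * I)))) (r r' : ℝ) :
    Tendsto (fun i => pairEntry (p i) (q i) a b r r') l (𝓝 (pairEntry p' q' a b r r')) := by
  refine tendsto_doubleContour ha hb (κ := κ + 1) (C := C * D * ((1 + a) * (1 + b) / (a + b) *
    Real.exp (a ^ 3 / 3) * Real.exp (b ^ 3 / 3)) * Real.exp (-(r * a) - r' * b)) ?_ ?_ fun y y' =>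
    ((hpl y).mul (hql y')).mul_const _
  · filter_upwards [hpc, hqc] with i h1 h2 using continuous_pairIntegrand_right ha hb h1 h2 r r'
  · filter_upwards [hp, hq] with i h1 h2 y y' using
      norm_pairIntegrand_le ha hb hC hD (h1 y) (h2 y')

theorem IsSymbol.bound₂ {p q : ℂ → ℂ} (hp : IsSymbol p) (hq : IsSymbol q) {a b a' b' : ℝ}
    (ha : 0 < a) (haa : a ≤ a') (hb : 0 < b) (hbb : b ≤ b') : ∃ C κ : ℝ, 0 ≤ C ∧ 0 ≤ κ ∧
    (∀ x y : ℝ, a ≤ x → x ≤ a' → ‖p (x + y * I)‖ ≤ C * Real.exp (κ * |y|)) ∧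
    (∀ x y : ℝ, b ≤ x → x ≤ b' → ‖q (x + y * I)‖ ≤ C * Real.exp (κ * |y|)) := by
  obtain ⟨C, κ, hC, hκ, h1⟩ := hp.growth a a' ha haa
  obtain ⟨D, κ', hD, hκ', h2⟩ := hq.growth b b' hb hbb
  refine ⟨max C D, max κ κ', le_max_of_le_left hC, le_max_of_le_left hκ, fun x y hx hx' => ?_,
    fun x y hx hx' => ?_⟩
  · refine (h1 x y hx hx').trans (mul_le_mul (le_max_left _ _) (Real.exp_le_exp.mpr ?_)
      (Real.exp_pos _).le (le_max_of_le_left hC))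
    exact mul_le_mul_of_nonneg_right (le_max_left _ _) (abs_nonneg y)
  · refine (h2 x y hx hx').trans (mul_le_mul (le_max_right _ _) (Real.exp_le_exp.mpr ?_)
      (Real.exp_pos _).le (le_max_of_le_left hC))
    exact mul_le_mul_of_nonneg_right (le_max_right _ _) (abs_nonneg y)

theorem pairEntry_eq_integral_integral {p q : ℂ → ℂ} (hp : IsSymbol p) (hq : IsSymbol q) {a b : ℝ}
    (ha : 0 < a) (hb : 0 < b) (r r' : ℝ) : pairEntry p q a b r r' =
    (1 / (4 * (Real.pi : ℂ) ^ 2)) * ∫ y' : ℝ, ∫ y : ℝ, p (a + y * I) * q (b + y' * I) *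
      contourWeight r r' (a + y * I) (b + y' * I) := by
  obtain ⟨C, κ, hC, hκ, h1, h2⟩ := hp.bound₂ hq ha le_rfl hb le_rfl
  rw [pairEntry, doubleContour_eq]
  congr 1
  exact integral_prod_symm (μ := (volume : Measure ℝ)) (ν := (volume : Measure ℝ)) _
    (integrable_pairIntegrand ha hb hC hC (hp.continuous_line ha)
    (hq.continuous_line hb) (fun y => h1 a y le_rfl le_rfl) (fun y => h2 b y le_rfl le_rfl) r r')

/-- The fraction (v - w)/(v + w) is antisymmetric. This exchange also lets a shift of the left
contour serve for the right one. -/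
theorem pairEntry_swap (p q : ℂ → ℂ) (a b r r' : ℝ) :
    pairEntry p q a b r r' = -pairEntry q p b a r' r := by
  rw [pairEntry, pairEntry, doubleContour_eq, doubleContour_eq, ← mul_neg, ← integral_neg]
  congr 1
  have h := (Measure.measurePreserving_swap (μ := (volume : Measure ℝ))
    (ν := (volume : Measure ℝ))).integral_comp' (f := MeasurableEquiv.prodComm)
    (fun x : ℝ × ℝ => p (a + x.1 * I) * q (b + x.2 * I) *
      contourWeight r r' (a + x.1 * I) (b + x.2 * I))
  refine h.symm.trans (integral_congr_ae (Eventually.of_forall fun x => ?_))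
  simp only [MeasurableEquiv.prodComm, MeasurableEquiv.coe_mk, Equiv.prodComm_apply,
    Prod.fst_swap, Prod.snd_swap, contourWeight]
  rw [show (b : ℂ) + x.1 * I + (a + x.2 * I) = a + x.2 * I + (b + x.1 * I) by ring,
    show -(r' : ℂ) * (b + x.1 * I) - r * (a + x.2 * I) +
      ((b + x.1 * I) ^ 3 + (a + x.2 * I) ^ 3) / 3 = -(r : ℂ) * (a + x.2 * I) -
      r' * (b + x.1 * I) + ((a + x.2 * I) ^ 3 + (b + x.1 * I) ^ 3) / 3 by ring,
    show (b : ℂ) + x.1 * I - (a + x.2 * I) = -(a + x.2 * I - (b + x.1 * I)) by ring]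
  ring

theorem pairEntry_shift_left_of_le {p q : ℂ → ℂ} (hp : IsSymbol p) (hq : IsSymbol q) {a a' b : ℝ}
    (ha : 0 < a) (haa : a ≤ a') (hb : 0 < b) (r r' : ℝ) :
    pairEntry p q a b r r' = pairEntry p q a' b r r' := by
  have ha' := ha.trans_le haa
  rw [pairEntry_eq_integral_integral hp hq ha hb, pairEntry_eq_integral_integral hp hq ha' hb]
  obtain ⟨C, κ, hC, hκ, h1, h2⟩ := hp.bound₂ hq ha haa hb le_rfl
  congr 2
  ext y'
  -- E bounds -rx - r'b for every abscissa x between a and a', whatever the signs of r and r'.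
  set E : ℝ := |r| * a' + |r'| * b
  refine integral_vertical_eq_of_le
    (fun v => p v * q (b + y' * I) * contourWeight r r' v (b + y' * I)) ha haa ?_
    (C := C * C * ((1 + a') * (1 + b) / (a + b) * Real.exp (a' ^ 3 / 3) * Real.exp (b ^ 3 / 3)) *
        Real.exp E * gaussBound (κ + 1) b y') (κ := κ + 1) ha ?_
  · refine (hp.differentiableOn.mul_const _).mul ?_
    unfold contourWeight
    refine DifferentiableOn.mul (DifferentiableOn.div (by fun_prop) (by fun_prop) ?_)
      (by fun_prop)
    intro v hv h
    have := congrArg Complex.re h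
    simp only [add_re, ofReal_re, mul_re, I_re, mul_zero, ofReal_im, I_im, mul_one, sub_self,
      add_zero, zero_re] at this
    have hv' : 0 < v.re := hv
    linarith
  · intro x y hx hx'
    have hx0 := ha.trans_le hx
    refine (norm_pairIntegrand_le hx0 hb hC hC (h1 x y hx hx') (h2 b y' le_rfl le_rfl)).trans ?_
    have e1 : gaussBound (κ + 1) x y ≤ gaussBound (κ + 1) a y := by
      unfold gaussBound
      gcongr
    have e2 : Real.exp (-(r * x) - r' * b) ≤ Real.exp E := by
      apply Real.exp_le_exp.mpr
      have h3 : -(r * x) ≤ |r| * a' := by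
        have := neg_abs_le r
        nlinarith [abs_nonneg r]
      have h4 : -(r' * b) ≤ |r'| * b := by
        have := neg_abs_le r'
        nlinarith
      simp only [E]
      linarith
    have e3 : (1 + x) * (1 + b) / (x + b) * Real.exp (x ^ 3 / 3) * Real.exp (b ^ 3 / 3) ≤
        (1 + a') * (1 + b) / (a + b) * Real.exp (a' ^ 3 / 3) * Real.exp (b ^ 3 / 3) := by
      gcongr
    have g1 := (gaussBound_pos (κ + 1) x y).le
    have g2 := (gaussBound_pos (κ + 1) b y').le
    have g3 := (gaussBound_pos (κ + 1) a y).le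
    calc C * C * ((1 + x) * (1 + b) / (x + b) * Real.exp (x ^ 3 / 3) * Real.exp (b ^ 3 / 3)) *
          Real.exp (-(r * x) - r' * b) * (gaussBound (κ + 1) x y * gaussBound (κ + 1) b y')
        ≤ C * C * ((1 + a') * (1 + b) / (a + b) * Real.exp (a' ^ 3 / 3) * Real.exp (b ^ 3 / 3)) *
          Real.exp E * (gaussBound (κ + 1) a y * gaussBound (κ + 1) b y') := by gcongr
      _ = _ := by ring

theorem pairEntry_contour_left {p q : ℂ → ℂ} (hp : IsSymbol p) (hq : IsSymbol q) {a a' b : ℝ}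
    (ha : 0 < a) (ha' : 0 < a') (hb : 0 < b) (r r' : ℝ) :
    pairEntry p q a b r r' = pairEntry p q a' b r r' := by
  rcases le_total a a' with h | h
  · exact pairEntry_shift_left_of_le hp hq ha h hb r r'
  · exact (pairEntry_shift_left_of_le hp hq ha' h hb r r').symm

/-- The entries do not depend on the contours. -/
theorem pairEntry_contour {p q : ℂ → ℂ} (hp : IsSymbol p) (hq : IsSymbol q) {a a' b b' : ℝ}
    (ha : 0 < a) (ha' : 0 < a') (hb : 0 < b) (hb' : 0 < b') (r r' : ℝ) :
    pairEntry p q a b r r' = pairEntry p q a' b' r r' := by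
  rw [pairEntry_contour_left hp hq ha ha' hb, pairEntry_swap,
    pairEntry_contour_left hq hp hb hb' ha', ← pairEntry_swap]

end PairEntries

/-! ### The symbols of the hard wall: uniform bounds and limits. -/

section Symbols

theorem norm_Gamma_le {z : ℂ} (hz : 0 < z.re) : ‖Complex.Gamma z‖ ≤ Real.Gamma z.re := by
  rw [Complex.Gamma_eq_integral hz, Complex.GammaIntegral, Real.Gamma_eq_integral hz]
  refine (norm_integral_le_integral_norm _).trans (le_of_eq ?_)
  refine setIntegral_congr_fun measurableSet_Ioi fun x hx => ?_
  have hx' : 0 < x := hx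
  simp only [norm_mul, Complex.norm_real, Real.norm_of_nonneg (Real.exp_pos _).le,
    Complex.norm_cpow_eq_rpow_re_of_pos hx', sub_re, one_re]

theorem exists_norm_Gamma_one_add_le (U : ℝ) : ∃ C, 0 ≤ C ∧
    ∀ z : ℂ, 0 ≤ z.re → z.re ≤ U → ‖Complex.Gamma (z + 1)‖ ≤ C := by
  have hc : ContinuousOn (fun u : ℝ => Real.Gamma (u + 1)) (Set.Icc 0 U) := by
    intro u hu
    refine ContinuousAt.continuousWithinAt ?_
    refine ContinuousAt.comp (g := Real.Gamma) ?_ (by fun_prop)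
    refine (Real.differentiableAt_Gamma fun m hm => ?_).continuousAt
    have : (0 : ℝ) ≤ m := Nat.cast_nonneg m
    linarith [hu.1]
  obtain ⟨C, hC⟩ := isCompact_Icc.exists_bound_of_continuousOn hc
  refine ⟨max C 0, le_max_right _ _, fun z h0 h1 => ?_⟩
  have h2 : 0 < (z + 1).re := by
    rw [add_re, one_re]
    linarith
  refine (norm_Gamma_le h2).trans ?_
  have := hC z.re ⟨h0, h1⟩
  rw [add_re, one_re]
  exact (le_abs_self _).trans (this.trans (le_max_left _ _))

theorem norm_cos_le_exp_norm (z : ℂ) : ‖Complex.cos z‖ ≤ Real.exp ‖z‖ := by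
  have h1 := norm_exp_le_exp_norm (z * I)
  have h2 := norm_exp_le_exp_norm (-z * I)
  rw [norm_mul, norm_I, mul_one] at h1 h2
  rw [norm_neg] at h2
  rw [Complex.cos, norm_div]
  have h3 := norm_add_le (exp (z * I)) (exp (-z * I))
  rw [show ‖(2 : ℂ)‖ = 2 by norm_num, div_le_iff₀ two_pos]
  linarith

/-- The factor ‖z‖ is what keeps sin z / z bounded uniformly down to z = 0, that is, as τ → 0. -/
theorem norm_sin_le_norm_mul_exp_norm (z : ℂ) : ‖Complex.sin z‖ ≤ 2 * ‖z‖ * Real.exp ‖z‖ := by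
  have hexp := Real.one_le_exp (norm_nonneg z)
  rw [Complex.sin, norm_div, norm_mul, norm_I, mul_one, show ‖(2 : ℂ)‖ = 2 by norm_num,
    div_le_iff₀ two_pos]
  by_cases hz : ‖z‖ ≤ 1
  · have h1 : ‖exp (-z * I) - 1‖ ≤ 2 * ‖z‖ := by
      have := norm_exp_sub_one_le (x := -z * I) (by simpa using hz)
      simpa using this
    have h2 : ‖exp (z * I) - 1‖ ≤ 2 * ‖z‖ := by
      have := norm_exp_sub_one_le (x := z * I) (by simpa using hz)
      simpa using this
    have h3 : exp (-z * I) - exp (z * I) = (exp (-z * I) - 1) - (exp (z * I) - 1) := by ring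
    rw [h3]
    refine (norm_sub_le _ _).trans ?_
    nlinarith [norm_nonneg z]
  · have h1 := norm_exp_le_exp_norm (z * I)
    have h2 := norm_exp_le_exp_norm (-z * I)
    rw [norm_mul, norm_I, mul_one] at h1 h2
    rw [norm_neg] at h2
    refine (norm_sub_le _ _).trans ?_
    push Not at hz
    nlinarith

/-- The first rescaled symbol of the hard wall kernel. -/
noncomputable def wallCos (τ : ℝ) (v : ℂ) : ℂ :=
  τ * Complex.Gamma (2 * v * τ) * Complex.cos (Real.pi * v * τ)

/-- The second rescaled symbol of the hard wall kernel. -/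
noncomputable def wallSin (τ : ℝ) (v : ℂ) : ℂ :=
  Complex.Gamma (2 * v * τ) * Complex.sin (Real.pi * v * τ) / Real.pi

/-- The functional equation Γ(2vτ) = Γ(2vτ + 1)/(2vτ) extracts the pole at τ = 0, which the
prefactor τ cancels; in `wallSin` the zero of the sine does it. Both the limits and the uniform
bounds are read off this form. -/
theorem wallCos_eq {τ : ℝ} (hτ : 0 < τ) {v : ℂ} (hv : v ≠ 0) : wallCos τ v =
    1 / (2 * v) * (Complex.Gamma (2 * v * τ + 1) * Complex.cos (Real.pi * v * τ)) := by
  have hτ' : (τ : ℂ) ≠ 0 := by exact_mod_cast hτ.ne'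
  rw [wallCos, Complex.Gamma_add_one _ (by simp [hv, hτ'])]
  field_simp

theorem wallSin_eq {τ : ℝ} (hτ : 0 < τ) {v : ℂ} (hv : v ≠ 0) : wallSin τ v =
    Complex.Gamma (2 * v * τ + 1) * (Complex.sin (Real.pi * v * τ) / (2 * (Real.pi * v * τ))) := by
  have hτ' : (τ : ℂ) ≠ 0 := by exact_mod_cast hτ.ne'
  have hπ : (Real.pi : ℂ) ≠ 0 := by exact_mod_cast Real.pi_ne_zero
  rw [wallSin, Complex.Gamma_add_one _ (by simp [hv, hτ'])]
  field_simp

theorem line_ne_zero {x : ℝ} (hx : 0 < x) (y : ℝ) : (x : ℂ) + y * I ≠ 0 := by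
  intro h
  have := congrArg Complex.re h
  simp at this
  exact hx.ne' this

theorem norm_line_le {x : ℝ} (hx : 0 < x) (y : ℝ) : ‖(x : ℂ) + y * I‖ ≤ x + |y| := by
  refine (norm_add_le _ _).trans ?_
  simp [abs_of_pos hx]

theorem le_norm_line {x : ℝ} (y : ℝ) : x ≤ ‖(x : ℂ) + y * I‖ := by
  simpa using Complex.re_le_norm ((x : ℂ) + y * I)

/-- Bounds on the symbols of the hard wall that are uniform in time. -/
theorem wall_bounds (T : ℝ) (hT : 0 < T) {a b : ℝ} (ha : 0 < a) (hab : a ≤ b) :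
    ∃ C κ : ℝ, 0 ≤ C ∧ 0 ≤ κ ∧ ∀ τ x y : ℝ, 0 < τ → τ ≤ T → a ≤ x → x ≤ b →
      ‖wallCos τ (x + y * I)‖ ≤ C * Real.exp (κ * |y|) ∧
      ‖wallSin τ (x + y * I)‖ ≤ C * Real.exp (κ * |y|) := by
  -- The real part of 2vτ lies between 0 and 2bT for all abscissas and all τ considered.
  obtain ⟨G, hG0, hG⟩ := exists_norm_Gamma_one_add_le (2 * b * T)
  have hb := ha.trans_le hab
  set E := Real.exp (Real.pi * T * b)
  -- One constant for both symbols: 1/(2a) bounds the factor 1/(2v) of the cosine symbol, and 1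
  -- suffices for the sine symbol.
  refine ⟨G * E * (1 + 1 / (2 * a)), Real.pi * T, by positivity, by positivity, ?_⟩
  intro τ x y hτ hτT hx hxb
  have hx0 := ha.trans_le hx
  set v : ℂ := x + y * I with hv
  have hv0 : v ≠ 0 := line_ne_zero hx0 y
  have hre : (2 * v * τ).re = 2 * x * τ := by
    simp [hv]
  have hg : ‖Complex.Gamma (2 * v * τ + 1)‖ ≤ G := by
    apply hG
    · rw [hre]
      positivity
    · rw [hre]
      gcongr
  have hn : ‖(Real.pi : ℂ) * v * τ‖ ≤ Real.pi * T * b + Real.pi * T * |y| := by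
    rw [norm_mul, norm_mul, Complex.norm_real, Complex.norm_real,
      Real.norm_of_nonneg Real.pi_pos.le, Real.norm_of_nonneg hτ.le]
    have h1 := norm_line_le hx0 y
    rw [← hv] at h1
    calc Real.pi * ‖v‖ * τ ≤ Real.pi * (b + |y|) * T := by
          gcongr
          linarith
      _ = _ := by ring
  have he : Real.exp ‖(Real.pi : ℂ) * v * τ‖ ≤ E * Real.exp (Real.pi * T * |y|) := by
    rw [← Real.exp_add]
    exact Real.exp_le_exp.mpr hn
  have hE : 0 < E := Real.exp_pos _
  constructor
  · rw [wallCos_eq hτ hv0, norm_mul, norm_mul]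
    have h1 : ‖1 / (2 * v)‖ ≤ 1 / (2 * a) := by
      rw [norm_div, norm_one, norm_mul, show ‖(2 : ℂ)‖ = 2 by norm_num]
      have := le_norm_line (x := x) y
      gcongr
      exact hx.trans this
    calc ‖1 / (2 * v)‖ * (‖Complex.Gamma (2 * v * τ + 1)‖ * ‖Complex.cos (Real.pi * v * τ)‖)
        ≤ (1 / (2 * a)) * (G * (E * Real.exp (Real.pi * T * |y|))) := by
          gcongr
          exact (norm_cos_le_exp_norm _).trans he
      _ ≤ _ := by
          have h2 : 0 ≤ G * E * Real.exp (Real.pi * T * |y|) := by positivity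
          nlinarith
  · rw [wallSin_eq hτ hv0, norm_mul, norm_div]
    have hpos : 0 < ‖(Real.pi : ℂ) * v * τ‖ := by
      simp [hv0, hτ.ne', Real.pi_ne_zero]
    have h1 : ‖Complex.sin (Real.pi * v * τ)‖ / ‖2 * ((Real.pi : ℂ) * v * τ)‖ ≤
        E * Real.exp (Real.pi * T * |y|) := by
      refine le_trans ?_ he
      rw [norm_mul 2, show ‖(2 : ℂ)‖ = 2 by norm_num, div_le_iff₀ (by positivity)]
      linarith [norm_sin_le_norm_mul_exp_norm (Real.pi * v * τ)]
    calc ‖Complex.Gamma (2 * v * τ + 1)‖ *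
          (‖Complex.sin (Real.pi * v * τ)‖ / ‖2 * ((Real.pi : ℂ) * v * τ)‖)
        ≤ G * (E * Real.exp (Real.pi * T * |y|)) := by gcongr
      _ ≤ _ := by
          have h2 : 0 ≤ G * E * Real.exp (Real.pi * T * |y|) := by positivity
          have h3 : 0 ≤ 1 / (2 * a) := by positivity
          nlinarith

theorem differentiableAt_Gamma_scaled {τ : ℝ} (hτ : 0 < τ) {v : ℂ} (hv : 0 < v.re) :
    DifferentiableAt ℂ (fun v : ℂ => Complex.Gamma (2 * v * τ)) v := by
  refine DifferentiableAt.comp (g := Complex.Gamma) v ?_ (by fun_prop)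
  refine Complex.differentiableAt_Gamma _ fun m hm => ?_
  have h := congrArg Complex.re hm
  simp at h
  have : (0 : ℝ) ≤ m := Nat.cast_nonneg m
  have : 0 < 2 * v.re * τ := by positivity
  linarith

theorem isSymbol_wallCos {τ : ℝ} (hτ : 0 < τ) : IsSymbol (wallCos τ) where
  differentiableOn := fun v hv => by
    refine DifferentiableAt.differentiableWithinAt ?_
    unfold wallCos
    exact ((differentiableAt_Gamma_scaled hτ hv).const_mul _).mul (by fun_prop)
  growth := fun a b ha hab => by
    obtain ⟨C, κ, hC, hκ, h⟩ := wall_bounds τ hτ ha hab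
    exact ⟨C, κ, hC, hκ, fun x y hx hx' => (h τ x y hτ le_rfl hx hx').1⟩

theorem isSymbol_wallSin {τ : ℝ} (hτ : 0 < τ) : IsSymbol (wallSin τ) where
  differentiableOn := fun v hv => by
    refine DifferentiableAt.differentiableWithinAt ?_
    unfold wallSin
    exact ((differentiableAt_Gamma_scaled hτ hv).mul (by fun_prop)).div_const _
  growth := fun a b ha hab => by
    obtain ⟨C, κ, hC, hκ, h⟩ := wall_bounds τ hτ ha hab
    exact ⟨C, κ, hC, hκ, fun x y hx hx' => (h τ x y hτ le_rfl hx hx').2⟩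

theorem tendsto_Gamma_scaled (v : ℂ) :
    Tendsto (fun τ : ℝ => Complex.Gamma (2 * v * τ + 1)) (𝓝[>] 0) (𝓝 1) := by
  have h1 : ContinuousAt Complex.Gamma 1 :=
    (Complex.differentiableAt_Gamma 1 fun m hm => by
      have h := congrArg Complex.re hm
      simp at h
      have : (0 : ℝ) ≤ m := Nat.cast_nonneg m
      linarith).continuousAt
  have h2 : Tendsto (fun τ : ℝ => 2 * v * (τ : ℂ) + 1) (𝓝 0) (𝓝 1) := by
    have : Continuous fun τ : ℝ => 2 * v * (τ : ℂ) + 1 := by fun_prop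
    simpa using this.tendsto 0
  have h3 := h1.tendsto.comp h2
  rw [Complex.Gamma_one] at h3
  exact h3.mono_left nhdsWithin_le_nhds

theorem tendsto_wallCos {v : ℂ} (hv : v ≠ 0) :
    Tendsto (fun τ : ℝ => wallCos τ v) (𝓝[>] 0) (𝓝 (1 / (2 * v))) := by
  have h2 : Tendsto (fun τ : ℝ => Complex.cos (Real.pi * v * τ)) (𝓝[>] 0) (𝓝 1) := by
    have : Continuous fun τ : ℝ => Complex.cos (Real.pi * v * τ) := by fun_prop
    have h := this.tendsto 0
    simp only [ofReal_zero, mul_zero, Complex.cos_zero] at h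
    exact h.mono_left nhdsWithin_le_nhds
  have h3 := ((tendsto_Gamma_scaled v).mul h2).const_mul (1 / (2 * v))
  rw [mul_one, mul_one] at h3
  refine h3.congr' ?_
  filter_upwards [self_mem_nhdsWithin] with τ hτ using (wallCos_eq hτ hv).symm

theorem tendsto_wallSin {v : ℂ} (hv : v ≠ 0) :
    Tendsto (fun τ : ℝ => wallSin τ v) (𝓝[>] 0) (𝓝 (1 / 2)) := by
  have hπ : (Real.pi : ℂ) ≠ 0 := by exact_mod_cast Real.pi_ne_zero
  have hd := hasDerivAt_iff_tendsto_slope_zero.mp (Complex.hasDerivAt_sin 0)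
  simp only [zero_add, Complex.sin_zero, sub_zero, smul_eq_mul, Complex.cos_zero] at hd
  have hz : Tendsto (fun τ : ℝ => (Real.pi : ℂ) * v * τ) (𝓝[>] 0) (𝓝[≠] 0) := by
    refine tendsto_nhdsWithin_iff.mpr ⟨?_, ?_⟩
    · have : Continuous fun τ : ℝ => (Real.pi : ℂ) * v * τ := by fun_prop
      have h := this.tendsto 0
      simp only [ofReal_zero, mul_zero] at h
      exact h.mono_left nhdsWithin_le_nhds
    · filter_upwards [self_mem_nhdsWithin] with τ hτ
      have : (τ : ℂ) ≠ 0 := by exact_mod_cast (ne_of_gt hτ)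
      simp [hv, hπ, this]
  have h3 := (tendsto_Gamma_scaled v).mul ((hd.comp hz).mul_const (1 / 2))
  rw [one_mul, one_mul] at h3
  refine h3.congr' ?_
  filter_upwards [self_mem_nhdsWithin] with τ hτ
  rw [wallSin_eq hτ hv]
  simp only [Function.comp_apply]
  congr 1
  rw [div_eq_mul_inv, mul_inv]
  ring

theorem isSymbol_inv : IsSymbol fun v => 1 / (2 * v) where
  differentiableOn := by
    refine DifferentiableOn.div (by fun_prop) (by fun_prop) fun v hv => ?_
    have : v ≠ 0 := by
      rintro rfl
      simp at hv
    simpa using this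
  growth := fun a b ha hab => by
    refine ⟨1 / (2 * a), 0, by positivity, le_rfl, fun x y hx _ => ?_⟩
    rw [zero_mul, Real.exp_zero, mul_one, norm_div, norm_one, norm_mul,
      show ‖(2 : ℂ)‖ = 2 by norm_num]
    have := le_norm_line (x := x) y
    gcongr
    exact hx.trans this

theorem isSymbol_const (c : ℂ) : IsSymbol fun _ => c where
  differentiableOn := by fun_prop
  growth := fun a b ha hab => ⟨‖c‖, 0, norm_nonneg _, le_rfl, fun x y _ _ => by simp⟩

end Symbols

/-! ### The β-symmetry and the reduction of all kernels to pairs of symbols. -/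

section PairKernels

/-- The matrix kernel with the symbols `p` and `q`. -/
noncomputable def pairKernel (p q : ℂ → ℂ) (a b : ℝ) : ℝ → ℝ → Matrix (Fin 2) (Fin 2) ℂ :=
  skewKernel (pairEntry p p a b) (pairEntry q q a b) (pairEntry p q a b)

theorem doubleContour_const_mul (a b : ℝ) (c : ℂ) (F : ℂ → ℂ → ℂ) :
    c * doubleContour a b F = doubleContour a b fun v w => c * F v w := by
  rw [doubleContour_eq, doubleContour_eq, integral_const_mul]
  ring

theorem gseKernel_eq (a b : ℝ) :
    gseKernel a b = pairKernel (fun v => 1 / (2 * v)) (fun _ => 1 / 2) a b := by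
  unfold gseKernel pairKernel pairEntry
  congr 1 <;>
  · funext r r'
    rw [doubleContour_const_mul]
    congr 1
    funext v w
    simp only [one_div, mul_inv]
    ring

theorem pairKernel_contour {p q : ℂ → ℂ} (hp : IsSymbol p) (hq : IsSymbol q) {a a' b b' : ℝ}
    (ha : 0 < a) (ha' : 0 < a') (hb : 0 < b) (hb' : 0 < b') :
    pairKernel p q a b = pairKernel p q a' b' := by
  unfold pairKernel
  congr 1 <;> funext r r'
  · exact pairEntry_contour hp hp ha ha' hb hb' r r'
  · exact pairEntry_contour hq hq ha ha' hb hb' r r'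
  · exact pairEntry_contour hp hq ha ha' hb hb' r r'

theorem rpow_sixth_sq {t : ℝ} (ht : 0 < t) :
    (t ^ (1 / 6 : ℝ) / √Real.pi) ^ 2 = t ^ (1 / 3 : ℝ) / Real.pi := by
  rw [div_pow, Real.sq_sqrt Real.pi_pos.le, ← Real.rpow_natCast, ← Real.rpow_mul ht.le]
  norm_num

theorem betaRescale_largeTimeKernel {t : ℝ} (ht : 0 < t) (a b : ℝ) :
    betaRescale (t ^ (1 / 6 : ℝ) / √Real.pi) (largeTimeKernel t a b) = gseKernel a b := by
  have hβ : (((t ^ (1 / 6 : ℝ) / √Real.pi : ℝ) : ℂ)) ^ 2 =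
      ((t ^ (1 / 3 : ℝ) : ℝ) : ℂ) / (Real.pi : ℂ) := by
    rw [← ofReal_pow, rpow_sixth_sq ht, ofReal_div]
  have hc : ((t ^ (1 / 3 : ℝ) : ℝ) : ℂ) ≠ 0 := by exact_mod_cast (Real.rpow_pos_of_pos ht _).ne'
  have hπ : (Real.pi : ℂ) ≠ 0 := by exact_mod_cast Real.pi_ne_zero
  funext r r'
  ext i j
  fin_cases i <;> fin_cases j <;>
    simp only [betaRescale, largeTimeKernel, gseKernel, skewKernel, hβ, Matrix.of_apply,
      Matrix.cons_val', Matrix.cons_val_zero, Matrix.cons_val_one, Fin.zero_eta, Fin.mk_one,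
      Matrix.cons_val_fin_one] <;> field_simp

/-- With τ = t^(-1/3) one has β² = 1/(πτ), so the common prefactor τ/π becomes τ², 1/π² and τ/π in
K₁₁, K₂₂ and K₁₂. These are the products of the prefactors τ and 1/π of the two symbols. -/
theorem betaRescale_hardWallKernel {t : ℝ} (ht : 0 < t) (a b : ℝ) :
    betaRescale (t ^ (1 / 6 : ℝ) / √Real.pi) (hardWallKernel t a b) =
      pairKernel (wallCos (t ^ (-(1 / 3) : ℝ))) (wallSin (t ^ (-(1 / 3) : ℝ))) a b := by
  have hτ : t ^ (1 / 3 : ℝ) = (t ^ (-(1 / 3) : ℝ))⁻¹ := by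
    rw [Real.rpow_neg ht.le, inv_inv]
  have hβ : (((t ^ (1 / 6 : ℝ) / √Real.pi : ℝ) : ℂ)) ^ 2 =
      1 / (((t ^ (-(1 / 3) : ℝ) : ℝ) : ℂ) * (Real.pi : ℂ)) := by
    rw [← ofReal_pow, rpow_sixth_sq ht, hτ]
    push_cast
    field_simp
  have hc : ((t ^ (-(1 / 3) : ℝ) : ℝ) : ℂ) ≠ 0 := by
    exact_mod_cast (Real.rpow_pos_of_pos ht _).ne'
  have hπ : (Real.pi : ℂ) ≠ 0 := by exact_mod_cast Real.pi_ne_zero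
  have h11 : ∀ x : ℂ, x / (1 / (((t ^ (-(1 / 3) : ℝ) : ℝ) : ℂ) * (Real.pi : ℂ))) =
      (((t ^ (-(1 / 3) : ℝ) : ℝ) : ℂ) * (Real.pi : ℂ)) * x := fun x => by
    rw [div_div_eq_mul_div, div_one, mul_comm]
  funext r r'
  ext i j
  fin_cases i <;> fin_cases j <;>
    simp only [betaRescale, hardWallKernel, pairKernel, pairEntry, skewKernel, hβ, Matrix.of_apply,
      Matrix.cons_val', Matrix.cons_val_zero, Matrix.cons_val_one, Fin.zero_eta, Fin.mk_one,
      Matrix.cons_val_fin_one, h11, doubleContour_const_mul, neg_inj] <;>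
    congr 1 <;> funext v w <;> simp only [wallCos, wallSin] <;> field_simp

/-- The rescaling is the congruence by the diagonal matrix with entries β⁻¹ and β at each site,
whose determinant is 1. -/
theorem blockPfaffian_betaRescale {β : ℝ} (hβ : β ≠ 0) (K : ℝ → ℝ → Matrix (Fin 2) (Fin 2) ℂ)
    {n : ℕ} (r : Fin n → ℝ) :
    blockPfaffian (blockMatrix (betaRescale β K) r) = blockPfaffian (blockMatrix K r) := by
  have hβ' : (β : ℂ) ≠ 0 := by exact_mod_cast hβ
  set B : Matrix (Fin n × Fin 2) (Fin n × Fin 2) ℂ :=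
    Matrix.diagonal fun x => if x.2 = 0 then (β : ℂ)⁻¹ else β with hB
  have hdet : B.det = 1 := by
    rw [hB, Matrix.det_diagonal, Fintype.prod_prod_type]
    simp [hβ']
  have h : blockMatrix (betaRescale β K) r = B.transpose * blockMatrix K r * B := by
    ext ⟨p, i⟩ ⟨q, j⟩
    rw [hB, Matrix.diagonal_transpose, Matrix.mul_diagonal, Matrix.diagonal_mul]
    fin_cases i <;> fin_cases j <;> simp [blockMatrix, betaRescale] <;> field_simp
  rw [blockPfaffian_eq_pfaffian, blockPfaffian_eq_pfaffian, h, pfaffian_congruence, hdet, one_mul]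

theorem pfaffianIntegrand_betaRescale {β : ℝ} (hβ : β ≠ 0) (χ : ℝ → ℝ)
    (K : ℝ → ℝ → Matrix (Fin 2) (Fin 2) ℂ) :
    pfaffianIntegrand χ (betaRescale β K) = pfaffianIntegrand χ K := by
  funext n r
  rw [pfaffianIntegrand, pfaffianIntegrand, blockPfaffian_betaRescale hβ]

theorem fredholmPfaffian_betaRescale {β : ℝ} (hβ : β ≠ 0) (χ : ℝ → ℝ)
    (K : ℝ → ℝ → Matrix (Fin 2) (Fin 2) ℂ) :
    fredholmPfaffian χ (betaRescale β K) = fredholmPfaffian χ K := by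
  rw [fredholmPfaffian, fredholmPfaffian, pfaffianIntegrand_betaRescale hβ]

theorem fredholmPfaffianConverges_betaRescale {β : ℝ} (hβ : β ≠ 0) (χ : ℝ → ℝ)
    (K : ℝ → ℝ → Matrix (Fin 2) (Fin 2) ℂ) :
    FredholmPfaffianConverges χ (betaRescale β K) ↔ FredholmPfaffianConverges χ K := by
  rw [FredholmPfaffianConverges, FredholmPfaffianConverges, pfaffianIntegrand_betaRescale hβ]

end PairKernels

/-! ### Fermi factor and cutoff against the exponential growth of the kernels. -/

section Domination

theorem integrable_exp_neg_mul_abs_sub (s : ℝ) {δ : ℝ} (hδ : 0 < δ) :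
    Integrable fun r : ℝ => Real.exp (-(δ * |r - s|)) := by
  have h : Integrable fun r : ℝ => Real.exp (-(δ * |r|)) := by
    have h1 : IntegrableOn (fun r : ℝ => Real.exp (-(δ * |r|))) (Set.Ioi 0) := by
      refine (integrableOn_exp_mul_Ioi (neg_lt_zero.mpr hδ) 0).congr_fun (fun r hr => ?_)
        measurableSet_Ioi
      have hr' : 0 < r := hr
      simp [abs_of_pos hr']
    have h2 : IntegrableOn (fun r : ℝ => Real.exp (-(δ * |r|))) (Set.Iic 0) := by
      refine (integrableOn_exp_mul_Iic hδ 0).congr_fun (fun r hr => ?_) measurableSet_Iic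
      have hr' : r ≤ 0 := hr
      simp [abs_of_nonpos hr']
    have h3 := h2.union h1
    rwa [Set.Iic_union_Ioi, integrableOn_univ] at h3
  exact h.comp_sub_right s

theorem cutoff_mul_exp_le (s : ℝ) {δ : ℝ} (r : ℝ) :
    |cutoff s r| * Real.exp (-(δ * r)) ≤ Real.exp (-(δ * s)) * Real.exp (-(δ * |r - s|)) := by
  by_cases hr : s ≤ r
  · rw [cutoff, Set.indicator_of_mem (Set.mem_Ici.mpr hr), Pi.one_apply, abs_one, one_mul,
      abs_of_nonneg (by linarith), ← Real.exp_add]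
    apply Real.exp_le_exp.mpr
    linarith
  · rw [cutoff, Set.indicator_of_notMem (by simpa using hr), abs_zero, zero_mul]
    positivity

theorem fermiFactor_eq (t s r : ℝ) : fermiFactor t (Real.exp (-s * t ^ (1 / 3 : ℝ))) r =
    1 / (1 + Real.exp (-(t ^ (1 / 3 : ℝ) * (r - s)))) := by
  rw [fermiFactor]
  have h : Real.exp (-(t ^ (1 / 3 : ℝ)) * r) = Real.exp (-s * t ^ (1 / 3 : ℝ)) *
      Real.exp (-(t ^ (1 / 3 : ℝ) * (r - s))) := by
    rw [← Real.exp_add]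
    congr 1
    ring
  rw [h]
  have := Real.exp_pos (-s * t ^ (1 / 3 : ℝ))
  field_simp

/-- To the right of s the Fermi factor is at most 1 and exp(-γr) decays. To the left the factor is
at most exp(t^(1/3)(r - s)), which wins when γ < t^(1/3). With γ = 2a this is the constraint a <
t^(1/3)/2 on the contour. -/
theorem fermiFactor_mul_exp_le (t s : ℝ) {δ γ : ℝ} (hδ : δ ≤ γ) (hδ' : δ ≤ t ^ (1 / 3 : ℝ) - γ)
    (r : ℝ) : |fermiFactor t (Real.exp (-s * t ^ (1 / 3 : ℝ))) r| * Real.exp (-(γ * r)) ≤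
      Real.exp (-(γ * s)) * Real.exp (-(δ * |r - s|)) := by
  rw [fermiFactor_eq, abs_of_pos (by positivity)]
  set θ := t ^ (1 / 3 : ℝ)
  rcases le_total s r with hr | hr
  · have h1 : 1 / (1 + Real.exp (-(θ * (r - s)))) ≤ 1 := by
      rw [div_le_one (by positivity)]
      linarith [Real.exp_pos (-(θ * (r - s)))]
    calc _ ≤ 1 * Real.exp (-(γ * r)) := by gcongr
      _ ≤ _ := by
        rw [one_mul, ← Real.exp_add]
        apply Real.exp_le_exp.mpr
        rw [abs_of_nonneg (by linarith)]
        nlinarith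
  · have h1 : 1 / (1 + Real.exp (-(θ * (r - s)))) ≤ Real.exp (θ * (r - s)) := by
      rw [div_le_iff₀ (by positivity), mul_add, ← Real.exp_add, add_neg_cancel, Real.exp_zero]
      linarith [Real.exp_pos (θ * (r - s))]
    calc _ ≤ Real.exp (θ * (r - s)) * Real.exp (-(γ * r)) := by gcongr
      _ ≤ _ := by
        rw [← Real.exp_add, ← Real.exp_add]
        apply Real.exp_le_exp.mpr
        rw [abs_of_nonpos (by linarith)]
        nlinarith

theorem tendsto_rpow_third : Tendsto (fun t : ℝ => t ^ (1 / 3 : ℝ)) atTop atTop :=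
  tendsto_rpow_atTop (by norm_num)

/-- The point r = s is excluded because the factor is 1/2 there for all t, while the cutoff is 1. -/
theorem tendsto_fermiFactor (s r : ℝ) (hr : r ≠ s) :
    Tendsto (fun t => fermiFactor t (Real.exp (-s * t ^ (1 / 3 : ℝ))) r) atTop
      (𝓝 (cutoff s r)) := by
  simp_rw [fermiFactor_eq]
  rcases lt_or_gt_of_ne hr with h | h
  · have h0 : cutoff s r = 0 := Set.indicator_of_notMem (by simpa using h) _
    rw [h0]
    have h1 : Tendsto (fun t : ℝ => -(t ^ (1 / 3 : ℝ) * (r - s))) atTop atTop := by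
      have := tendsto_rpow_third.atTop_mul_const (show 0 < s - r by linarith)
      exact this.congr fun t => by ring
    have h2 := tendsto_atTop_add_const_left _ 1 (Real.tendsto_exp_atTop.comp h1)
    refine (tendsto_inv_atTop_zero.comp h2).congr fun t => ?_
    simp only [Function.comp_apply, one_div]
  · have h0 : cutoff s r = 1 := Set.indicator_of_mem (Set.mem_Ici.mpr h.le) _
    rw [h0]
    have h1 : Tendsto (fun t : ℝ => t ^ (1 / 3 : ℝ) * (r - s)) atTop atTop :=
      tendsto_rpow_third.atTop_mul_const (by linarith)
    have h2 := (Real.tendsto_exp_neg_atTop_nhds_zero.comp h1).const_add 1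
    simpa using (h2.inv₀ (by norm_num))

theorem measurable_fermiFactor (t z : ℝ) : Measurable (fermiFactor t z) := by
  unfold fermiFactor
  fun_prop

theorem measurable_cutoff (s : ℝ) : Measurable (cutoff s) :=
  measurable_one.indicator measurableSet_Ici

end Domination

/-! ### Convergence of the hard-wall kernel and of its Fredholm Pfaffian. -/

section HardWallLimit

theorem norm_pairKernel_le {p q : ℂ → ℂ} {a : ℝ} (ha : 0 < a) {C κ : ℝ} (hC : 0 ≤ C)
    (hp : ∀ y : ℝ, ‖p (a + y * I)‖ ≤ C * Real.exp (κ * |y|))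
    (hq : ∀ y : ℝ, ‖q (a + y * I)‖ ≤ C * Real.exp (κ * |y|)) (r r' : ℝ) (i j : Fin 2) :
    ‖pairKernel p q a a r r' i j‖ ≤ C * C * pairConst κ a a * Real.exp (-(r * a) - r' * a) := by
  fin_cases i <;> fin_cases j <;>
    simp only [pairKernel, skewKernel, Matrix.of_apply, Matrix.cons_val', Matrix.cons_val_zero,
      Matrix.cons_val_one, Fin.zero_eta, Fin.mk_one, Matrix.cons_val_fin_one, norm_neg]
  · exact norm_pairEntry_le ha ha hC hC hp hp r r'
  · exact norm_pairEntry_le ha ha hC hC hp hq r r'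
  · rw [show -(r * a) - r' * a = -(r' * a) - r * a by ring]
    exact norm_pairEntry_le ha ha hC hC hp hq r' r
  · exact norm_pairEntry_le ha ha hC hC hq hq r r'

theorem measurable_pairKernel {p q : ℂ → ℂ} {a b : ℝ} (ha : 0 < a) (hb : 0 < b)
    (hp : IsSymbol p) (hq : IsSymbol q) (i j : Fin 2) :
    Measurable fun x : ℝ × ℝ => pairKernel p q a b x.1 x.2 i j := by
  fin_cases i <;> fin_cases j <;>
    simp only [pairKernel, skewKernel, Matrix.of_apply, Matrix.cons_val', Matrix.cons_val_zero,
      Matrix.cons_val_one, Fin.zero_eta, Fin.mk_one, Matrix.cons_val_fin_one]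
  · exact measurable_pairEntry ha hb (hp.continuous_line ha) (hp.continuous_line hb)
  · exact measurable_pairEntry ha hb (hp.continuous_line ha) (hq.continuous_line hb)
  · exact ((measurable_pairEntry ha hb (hp.continuous_line ha) (hq.continuous_line hb)).comp
      measurable_swap).neg
  · exact measurable_pairEntry ha hb (hq.continuous_line ha) (hq.continuous_line hb)

/-- The exponential bound of the kernels, as a function of one variable. -/
noncomputable def expBound (C a r : ℝ) : ℝ := √(C + 1) * Real.exp (-(r * a))

/-- The Hadamard bounds divide by this function; C + 1 instead of C keeps it positive when C = 0. -/
theorem expBound_pos {C : ℝ} (hC : 0 ≤ C) (a r : ℝ) : 0 < expBound C a r := by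
  unfold expBound
  positivity

theorem le_expBound_mul {C : ℝ} (hC : 0 ≤ C) (a r r' : ℝ) :
    C * Real.exp (-(r * a) - r' * a) ≤ expBound C a r * expBound C a r' := by
  have h : expBound C a r * expBound C a r' = (√(C + 1) * √(C + 1)) *
      Real.exp (-(r * a) - r' * a) := by
    rw [expBound, expBound, sub_eq_add_neg, Real.exp_add]
    ring
  rw [h, Real.mul_self_sqrt (by linarith)]
  gcongr
  linarith

theorem expBound_sq {C : ℝ} (hC : 0 ≤ C) (a r : ℝ) :
    expBound C a r ^ 2 = (C + 1) * Real.exp (-(2 * a * r)) := by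
  rw [expBound, mul_pow, Real.sq_sqrt (by linarith), ← Real.exp_nat_mul]
  congr 2
  push_cast
  ring

/-- With the same abscissa a on both contours, the bound on the entries is a product of one function
at r and at r', and its square has the rate 2a that the weight must compensate. -/
theorem pairKernel_dominated {p q : ℂ → ℂ} {a : ℝ} (ha : 0 < a) (hps : IsSymbol p)
    (hqs : IsSymbol q) {C κ : ℝ} (hC : 0 ≤ C)
    (hp : ∀ y : ℝ, ‖p (a + y * I)‖ ≤ C * Real.exp (κ * |y|))
    (hq : ∀ y : ℝ, ‖q (a + y * I)‖ ≤ C * Real.exp (κ * |y|)) {χ : ℝ → ℝ} (hχ : Measurable χ)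
    {s δ : ℝ} (hb : ∀ r, |χ r| * Real.exp (-(2 * a * r)) ≤
      Real.exp (-(2 * a * s)) * Real.exp (-(δ * |r - s|))) :
    PfaffianDominated χ (pairKernel p q a a) (expBound (C * C * pairConst κ a a) a)
      (fun r => (C * C * pairConst κ a a + 1) * (Real.exp (-(2 * a * s)) *
        Real.exp (-(δ * |r - s|)))) where
  measurable_weight := hχ
  measurable_kernel := measurable_pairKernel ha ha hps hqs
  bound := fun r r' _ _ i j => (norm_pairKernel_le ha hC hp hq r r' i j).trans
    (le_expBound_mul (mul_nonneg (mul_nonneg hC hC) (pairConst_nonneg κ ha ha)) a r r')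
  bound_weight := fun r => by
    have h0 := mul_nonneg (mul_nonneg hC hC) (pairConst_nonneg κ ha ha)
    rw [expBound_sq h0, mul_left_comm]
    exact mul_le_mul_of_nonneg_left (hb r) (by linarith)

theorem tendsto_rpow_neg_third :
    Tendsto (fun t : ℝ => t ^ (-(1 / 3) : ℝ)) atTop (𝓝[>] 0) := by
  refine tendsto_nhdsWithin_iff.mpr ⟨tendsto_rpow_neg_atTop (by norm_num), ?_⟩
  filter_upwards [eventually_gt_atTop 0] with t ht using Real.rpow_pos_of_pos ht _

theorem tendsto_pairKernel_wall (r r' : ℝ) :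
    Tendsto (fun τ : ℝ => pairKernel (wallCos τ) (wallSin τ) 1 1 r r') (𝓝[>] 0)
      (𝓝 (pairKernel (fun v => 1 / (2 * v)) (fun _ => 1 / 2) 1 1 r r')) := by
  obtain ⟨C, κ, hC, hκ, h⟩ := wall_bounds 1 one_pos one_pos (le_refl 1)
  have hev : ∀ᶠ τ : ℝ in 𝓝[>] 0, 0 < τ ∧ τ ≤ 1 := by
    filter_upwards [Ioc_mem_nhdsGT (zero_lt_one (α := ℝ))] with τ hτ using hτ
  have hcc : ∀ᶠ τ : ℝ in 𝓝[>] 0, Continuous fun y : ℝ => wallCos τ ((1 : ℝ) + y * I) := by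
    filter_upwards [hev] with τ hτ using (isSymbol_wallCos hτ.1).continuous_line one_pos
  have hsc : ∀ᶠ τ : ℝ in 𝓝[>] 0, Continuous fun y : ℝ => wallSin τ ((1 : ℝ) + y * I) := by
    filter_upwards [hev] with τ hτ using (isSymbol_wallSin hτ.1).continuous_line one_pos
  have hcb : ∀ᶠ τ : ℝ in 𝓝[>] 0, ∀ y : ℝ, ‖wallCos τ ((1 : ℝ) + y * I)‖ ≤
      C * Real.exp (κ * |y|) := by
    filter_upwards [hev] with τ hτ y using (h τ 1 y hτ.1 hτ.2 le_rfl le_rfl).1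
  have hsb : ∀ᶠ τ : ℝ in 𝓝[>] 0, ∀ y : ℝ, ‖wallSin τ ((1 : ℝ) + y * I)‖ ≤
      C * Real.exp (κ * |y|) := by
    filter_upwards [hev] with τ hτ y using (h τ 1 y hτ.1 hτ.2 le_rfl le_rfl).2
  have hcl : ∀ y : ℝ, Tendsto (fun τ : ℝ => wallCos τ ((1 : ℝ) + y * I)) (𝓝[>] 0)
      (𝓝 (1 / (2 * ((1 : ℝ) + y * I)))) := fun y => tendsto_wallCos (line_ne_zero one_pos y)
  have hsl : ∀ y : ℝ, Tendsto (fun τ : ℝ => wallSin τ ((1 : ℝ) + y * I)) (𝓝[>] 0)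
      (𝓝 (1 / 2)) := fun y => tendsto_wallSin (line_ne_zero one_pos y)
  refine tendsto_pi_nhds.mpr fun i => tendsto_pi_nhds.mpr fun j => ?_
  fin_cases i <;> fin_cases j <;>
    simp only [pairKernel, skewKernel, Matrix.of_apply, Matrix.cons_val', Matrix.cons_val_zero,
      Matrix.cons_val_one, Fin.zero_eta, Fin.mk_one, Matrix.cons_val_fin_one]
  · exact tendsto_pairEntry (p' := fun v => 1 / (2 * v)) (q' := fun v => 1 / (2 * v))
      one_pos one_pos hC hC hcc hcc hcb hcb hcl hcl r r'
  · exact tendsto_pairEntry (p' := fun v => 1 / (2 * v)) (q' := fun _ => 1 / 2)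
      one_pos one_pos hC hC hcc hsc hcb hsb hcl hsl r r'
  · exact (tendsto_pairEntry (p' := fun v => 1 / (2 * v)) (q' := fun _ => 1 / 2)
      one_pos one_pos hC hC hcc hsc hcb hsb hcl hsl r' r).neg
  · exact tendsto_pairEntry (p' := fun _ => 1 / 2) (q' := fun _ => 1 / 2)
      one_pos one_pos hC hC hsc hsc hsb hsb hsl hsl r r'

theorem gseKernel_eq_one {a b : ℝ} (ha : 0 < a) (hb : 0 < b) :
    gseKernel a b = pairKernel (fun v => 1 / (2 * v)) (fun _ => 1 / 2) 1 1 := by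
  rw [gseKernel_eq]
  exact pairKernel_contour isSymbol_inv (isSymbol_const _) ha one_pos hb one_pos

theorem betaRescale_hardWallKernel_contour {t : ℝ} (ht : 0 < t) {a b a' : ℝ} (ha : 0 < a)
    (hb : 0 < b) (ha' : 0 < a') :
    betaRescale (t ^ (1 / 6 : ℝ) / √Real.pi) (hardWallKernel t a b) =
      pairKernel (wallCos (t ^ (-(1 / 3) : ℝ))) (wallSin (t ^ (-(1 / 3) : ℝ))) a' a' := by
  have hτ := Real.rpow_pos_of_pos ht (-(1 / 3))
  rw [betaRescale_hardWallKernel ht]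
  exact pairKernel_contour (isSymbol_wallCos hτ) (isSymbol_wallSin hτ) ha ha' hb ha'

/-- The contours may vary with t: the symbols are analytic on the whole right half plane, so at each
t both abscissas can be moved to 1 before the limit is taken. -/
theorem tendsto_betaRescale_hardWallKernel {cv cw : ℝ → ℝ} (hcv : ∀ t, 0 < t → 0 < cv t)
    (hcw : ∀ t, 0 < t → 0 < cw t) {a b : ℝ} (ha : 0 < a) (hb : 0 < b) (r r' : ℝ) :
    Tendsto (fun t : ℝ => betaRescale (t ^ (1 / 6 : ℝ) / √Real.pi)
      (hardWallKernel t (cv t) (cw t)) r r') atTop (𝓝 (gseKernel a b r r')) := by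
  rw [gseKernel_eq_one ha hb]
  refine ((tendsto_pairKernel_wall r r').comp tendsto_rpow_neg_third).congr' ?_
  filter_upwards [eventually_gt_atTop 0] with t ht
  rw [betaRescale_hardWallKernel_contour ht (hcv t ht) (hcw t ht) one_pos]
  rfl

theorem beta_ne_zero {t : ℝ} (ht : 0 < t) : t ^ (1 / 6 : ℝ) / √Real.pi ≠ 0 := by
  have := Real.rpow_pos_of_pos ht (1 / 6)
  have := Real.pi_pos
  positivity

theorem hardWall_converges (s : ℝ) {t a b : ℝ} (ht : 0 < t) (ha : 0 < a)
    (hat : a < t ^ (1 / 3 : ℝ) / 2) (hb : 0 < b) : FredholmPfaffianConverges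
      (fermiFactor t (Real.exp (-s * t ^ (1 / 3 : ℝ)))) (hardWallKernel t a b) := by
  have hτ := Real.rpow_pos_of_pos ht (-(1 / 3))
  rw [← fredholmPfaffianConverges_betaRescale (beta_ne_zero ht),
    betaRescale_hardWallKernel_contour ht ha hb ha]
  obtain ⟨C, κ, hC, hκ, h⟩ := wall_bounds _ hτ ha (le_refl a)
  have hC' := mul_nonneg (mul_nonneg hC hC) (pairConst_nonneg κ ha ha)
  -- The second term is positive exactly when a < t^(1/3)/2.
  set δ := min (2 * a) (t ^ (1 / 3 : ℝ) - 2 * a)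
  have hδ : 0 < δ := lt_min (by linarith) (by linarith)
  refine (pairKernel_dominated (s := s) (δ := δ) ha (isSymbol_wallCos hτ) (isSymbol_wallSin hτ) hC
    (fun y => (h _ a y hτ le_rfl le_rfl le_rfl).1) (fun y => (h _ a y hτ le_rfl le_rfl le_rfl).2)
    (measurable_fermiFactor _ _) (fun r => fermiFactor_mul_exp_le t s (min_le_left _ _)
      (min_le_right _ _) r)).converges (fun r => expBound_pos hC' a r) ?_
  exact ((integrable_exp_neg_mul_abs_sub s hδ).const_mul _).const_mul _

theorem gse_symbol_bounds {a : ℝ} (ha : 0 < a) : ∃ C κ : ℝ, 0 ≤ C ∧ 0 ≤ κ ∧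
    (∀ y : ℝ, ‖1 / (2 * ((a : ℂ) + y * I))‖ ≤ C * Real.exp (κ * |y|)) ∧
    (∀ y : ℝ, ‖(1 / 2 : ℂ)‖ ≤ C * Real.exp (κ * |y|)) := by
  obtain ⟨C, κ, hC, hκ, h1, h2⟩ :=
    isSymbol_inv.bound₂ (isSymbol_const (1 / 2)) ha (le_refl a) ha (le_refl a)
  exact ⟨C, κ, hC, hκ, fun y => h1 a y le_rfl le_rfl, fun y => h2 a y le_rfl le_rfl⟩

theorem gse_converges (s : ℝ) {a b : ℝ} (ha : 0 < a) (hb : 0 < b) :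
    FredholmPfaffianConverges (cutoff s) (gseKernel a b) := by
  rw [gseKernel_eq_one ha hb]
  obtain ⟨C, κ, hC, hκ, h1, h2⟩ := gse_symbol_bounds one_pos
  have hC' := mul_nonneg (mul_nonneg hC hC) (pairConst_nonneg κ one_pos one_pos)
  refine (pairKernel_dominated (s := s) (δ := 2 * 1) one_pos isSymbol_inv (isSymbol_const _) hC
    h1 h2 (measurable_cutoff s) (fun r => cutoff_mul_exp_le s r)).converges
    (fun r => expBound_pos hC' 1 r) ?_
  exact ((integrable_exp_neg_mul_abs_sub s (by norm_num)).const_mul _).const_mul _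

theorem largeTime_converges (s : ℝ) {t a b : ℝ} (ht : 0 < t) (ha : 0 < a) (hb : 0 < b) :
    FredholmPfaffianConverges (cutoff s) (largeTimeKernel t a b) := by
  rw [← fredholmPfaffianConverges_betaRescale (beta_ne_zero ht), betaRescale_largeTimeKernel ht]
  exact gse_converges s ha hb

theorem fredholmPfaffian_largeTimeKernel (s : ℝ) {t : ℝ} (ht : 0 < t) (a b : ℝ) :
    fredholmPfaffian (cutoff s) (largeTimeKernel t a b) =
      fredholmPfaffian (cutoff s) (gseKernel a b) := by
  rw [← fredholmPfaffian_betaRescale (beta_ne_zero ht), betaRescale_largeTimeKernel ht]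

theorem tendsto_fredholmPfaffian_hardWall (s : ℝ) {cv cw : ℝ → ℝ} (hcv : ∀ t, 0 < t → 0 < cv t)
    (hcw : ∀ t, 0 < t → 0 < cw t) {a b : ℝ} (ha : 0 < a) (hb : 0 < b) :
    Tendsto (fun t : ℝ => fredholmPfaffian (fermiFactor t (Real.exp (-s * t ^ (1 / 3 : ℝ))))
      (hardWallKernel t (cv t) (cw t))) atTop
      (𝓝 (fredholmPfaffian (cutoff s) (gseKernel a b))) := by
  rw [gseKernel_eq_one ha hb]
  obtain ⟨C, κ, hC, hκ, h⟩ := wall_bounds 1 one_pos one_pos (le_refl 1)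
  have hC' := mul_nonneg (mul_nonneg hC hC) (pairConst_nonneg κ one_pos one_pos)
  have hmain := fredholmPfaffian_tendsto (l := atTop)
    (χ := fun t => fermiFactor t (Real.exp (-s * t ^ (1 / 3 : ℝ))))
    (K := fun t => pairKernel (wallCos (t ^ (-(1 / 3) : ℝ))) (wallSin (t ^ (-(1 / 3) : ℝ))) 1 1)
    (χ' := cutoff s) (K' := pairKernel (fun v => 1 / (2 * v)) (fun _ => 1 / 2) 1 1)
    (g := expBound (C * C * pairConst κ 1 1) 1)
    (G := fun r => (C * C * pairConst κ 1 1 + 1) * (Real.exp (-(2 * 1 * s)) *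
        Real.exp (-(2 * |r - s|)))) (fun r => expBound_pos hC' 1 r)
    (((integrable_exp_neg_mul_abs_sub s two_pos).const_mul _).const_mul _) ?_
    (P := fun r => r ≠ s) (Measure.ae_ne volume s) (fun r hr => tendsto_fermiFactor s r hr)
    (fun r r' _ _ _ _ => (tendsto_pairKernel_wall r r').comp tendsto_rpow_neg_third)
  · refine hmain.congr' ?_
    filter_upwards [eventually_gt_atTop 0] with t ht
    rw [← betaRescale_hardWallKernel_contour ht (hcv t ht) (hcw t ht) one_pos,
      fredholmPfaffian_betaRescale (beta_ne_zero ht)]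
  -- On the abscissa 1 the kernel grows at the rate γ = 2; t^(1/3) ≥ 4 gives the decay rate δ = 2 on
  -- both sides of s.
  · filter_upwards [eventually_gt_atTop 0, tendsto_rpow_third.eventually_ge_atTop 4,
      (tendsto_rpow_neg_third.eventually (Ioc_mem_nhdsGT (zero_lt_one (α := ℝ))))] with t ht h4 hτ
    exact pairKernel_dominated one_pos (isSymbol_wallCos hτ.1) (isSymbol_wallSin hτ.1) hC
      (fun y => (h _ 1 y hτ.1 hτ.2 le_rfl le_rfl).1) (fun y => (h _ 1 y hτ.1 hτ.2 le_rfl le_rfl).2)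
      (measurable_fermiFactor _ _)
      (fun r => fermiFactor_mul_exp_le t s (by norm_num) (by linarith) r)

end HardWallLimit

/-! ### The Airy function and its tail as contour integrals. -/

section AiryTransform

/-- The integral `(1 / (2 i π)) ∫ p v exp (v ^ 3 / 3 - x v) dv` over the line `a + iℝ`. -/
noncomputable def airyTransform (p : ℂ → ℂ) (a x : ℝ) : ℂ :=
  (1 / (2 * (Real.pi : ℂ))) *
    ∫ y : ℝ, p (a + y * I) * exp (-(x : ℂ) * (a + y * I) + (a + y * I) ^ 3 / 3)

theorem norm_airyIntegrand_le {p : ℂ → ℂ} {a C κ x y : ℝ}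
    (hp : ‖p (a + y * I)‖ ≤ C * Real.exp (κ * |y|)) :
    ‖p (a + y * I) * exp (-(x : ℂ) * (a + y * I) + (a + y * I) ^ 3 / 3)‖ ≤
      C * Real.exp (a ^ 3 / 3 - x * a) * gaussBound κ a y := by
  rw [norm_mul, norm_exp_cube]
  refine (mul_le_mul_of_nonneg_right hp (by positivity)).trans (le_of_eq ?_)
  rw [gaussBound, sub_eq_add_neg (κ * |y|), Real.exp_add, neg_mul]
  ring

theorem norm_one_div_two_pi_le : ‖(1 / (2 * (Real.pi : ℂ)))‖ ≤ 1 := by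
  rw [norm_div, norm_one, norm_mul, Complex.norm_real, Real.norm_of_nonneg Real.pi_pos.le,
    div_le_one (by simp [Real.pi_pos])]
  have := Real.pi_gt_three
  norm_num
  linarith

/-- The constant in the bound of an Airy transform. -/
noncomputable def airyConst (κ a : ℝ) : ℝ := Real.exp (a ^ 3 / 3) * ∫ y, gaussBound κ a y

theorem airyConst_nonneg (κ a : ℝ) : 0 ≤ airyConst κ a :=
  mul_nonneg (Real.exp_pos _).le (integral_nonneg fun y => (gaussBound_pos _ _ _).le)

theorem norm_airyTransform_le {p : ℂ → ℂ} {a : ℝ} (ha : 0 < a) {C κ : ℝ}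
    (hp : ∀ y : ℝ, ‖p (a + y * I)‖ ≤ C * Real.exp (κ * |y|)) (x : ℝ) :
    ‖airyTransform p a x‖ ≤ C * airyConst κ a * Real.exp (-(x * a)) := by
  rw [airyTransform, norm_mul]
  have h := norm_integral_le_of_norm_le
    ((integrable_gaussBound κ ha).const_mul (C * Real.exp (a ^ 3 / 3 - x * a)))
    (Eventually.of_forall fun y => norm_airyIntegrand_le (x := x) (hp y))
  rw [integral_const_mul] at h
  refine (mul_le_mul norm_one_div_two_pi_le h (norm_nonneg _) zero_le_one).trans (le_of_eq ?_)
  rw [airyConst, sub_eq_add_neg, Real.exp_add]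
  ring

theorem continuous_airyIntegrand {p : ℂ → ℂ} {a : ℝ} (hp : Continuous fun y : ℝ => p (a + y * I))
    (x : ℝ) : Continuous fun y : ℝ =>
      p (a + y * I) * exp (-(x : ℂ) * (a + y * I) + (a + y * I) ^ 3 / 3) :=
  hp.mul (by fun_prop)

theorem integrable_airyIntegrand {p : ℂ → ℂ} {a : ℝ} (ha : 0 < a) {C κ : ℝ}
    (hpc : Continuous fun y : ℝ => p (a + y * I))
    (hp : ∀ y : ℝ, ‖p (a + y * I)‖ ≤ C * Real.exp (κ * |y|)) (x : ℝ) :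
    Integrable fun y : ℝ => p (a + y * I) * exp (-(x : ℂ) * (a + y * I) + (a + y * I) ^ 3 / 3) :=
  ((integrable_gaussBound κ ha).const_mul _).mono'
    (continuous_airyIntegrand hpc x).aestronglyMeasurable
    (Eventually.of_forall fun y => norm_airyIntegrand_le (hp y))

/-- Dominated convergence for Airy transforms. -/
theorem tendsto_airyTransform {ι : Type*} {l : Filter ι} [l.IsCountablyGenerated]
    {p : ι → ℂ → ℂ} {p' : ℂ → ℂ} {X : ι → ℝ} {x a : ℝ} (ha : 0 < a) {C κ : ℝ} (hC : 0 ≤ C)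
    (hpc : ∀ᶠ i in l, Continuous fun y : ℝ => p i (a + y * I))
    (hp : ∀ᶠ i in l, ∀ y : ℝ, ‖p i (a + y * I)‖ ≤ C * Real.exp (κ * |y|))
    (hpl : ∀ y : ℝ, Tendsto (fun i => p i (a + y * I)) l (𝓝 (p' (a + y * I))))
    (hX : Tendsto X l (𝓝 x)) :
    Tendsto (fun i => airyTransform (p i) a (X i)) l (𝓝 (airyTransform p' a x)) := by
  unfold airyTransform
  refine Tendsto.const_mul _ ?_
  have hX1 : ∀ᶠ i in l, x - 1 ≤ X i := hX.eventually (eventually_ge_nhds (by linarith))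
  refine tendsto_integral_filter_of_dominated_convergence
    (fun y => C * Real.exp (a ^ 3 / 3 - (x - 1) * a) * gaussBound κ a y)
    (hpc.mono fun i hi => (continuous_airyIntegrand hi _).aestronglyMeasurable) ?_
    ((integrable_gaussBound κ ha).const_mul _) (Eventually.of_forall fun y => ?_)
  · filter_upwards [hp, hX1] with i h1 h2
    refine Eventually.of_forall fun y => (norm_airyIntegrand_le (h1 y)).trans ?_
    have := (gaussBound_pos κ a y).le
    gcongr
  · refine (hpl y).mul ((Complex.continuous_exp.tendsto _).comp ?_)
    refine Tendsto.add_const _ (Tendsto.mul_const _ ?_)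
    exact ((Complex.continuous_ofReal.tendsto _).comp hX).neg

theorem continuous_airyTransform {p : ℂ → ℂ} {a : ℝ} (ha : 0 < a) {C κ : ℝ} (hC : 0 ≤ C)
    (hpc : Continuous fun y : ℝ => p (a + y * I))
    (hp : ∀ y : ℝ, ‖p (a + y * I)‖ ≤ C * Real.exp (κ * |y|)) :
    Continuous fun x => airyTransform p a x :=
  continuous_iff_continuousAt.mpr fun _ => tendsto_airyTransform (p := fun _ => p) ha hC
    (Eventually.of_forall fun _ => hpc) (Eventually.of_forall fun _ => hp)
    (fun _ => tendsto_const_nhds) tendsto_id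

theorem airyTransform_contour_of_le {p : ℂ → ℂ} (hp : IsSymbol p) {a a' : ℝ} (ha : 0 < a)
    (haa : a ≤ a') (x : ℝ) : airyTransform p a x = airyTransform p a' x := by
  obtain ⟨C, κ, hC, hκ, h⟩ := hp.growth a a' ha haa
  rw [airyTransform, airyTransform]
  congr 1
  refine integral_vertical_eq_of_le
    (fun v => p v * exp (-(x : ℂ) * v + v ^ 3 / 3)) ha haa
    (C := C * Real.exp (a' ^ 3 / 3 + |x| * a')) (κ := κ) ?_ ha ?_
  · exact hp.differentiableOn.mul (by fun_prop)
  · intro r y hr hr'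
    refine (norm_airyIntegrand_le (h r y hr hr')).trans ?_
    have hr0 := ha.trans_le hr
    have e1 : gaussBound κ r y ≤ gaussBound κ a y := by
      unfold gaussBound
      gcongr
    have e2 : r ^ 3 / 3 - x * r ≤ a' ^ 3 / 3 + |x| * a' := by
      have h1 : r ^ 3 ≤ a' ^ 3 := by gcongr
      have h2 : -(x * r) ≤ |x| * a' := by
        have := neg_abs_le x
        nlinarith [abs_nonneg x]
      linarith
    have := (gaussBound_pos κ r y).le
    gcongr

theorem airyTransform_contour {p : ℂ → ℂ} (hp : IsSymbol p) {a a' : ℝ} (ha : 0 < a)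
    (ha' : 0 < a') (x : ℝ) : airyTransform p a x = airyTransform p a' x := by
  rcases le_total a a' with h | h
  · exact airyTransform_contour_of_le hp ha h x
  · exact (airyTransform_contour_of_le hp ha' h x).symm

/-- Conjugation reflects the vertical line, and y ↦ -y undoes it: a symbol that commutes with
conjugation has a real transform. -/
theorem conj_airyTransform {p : ℂ → ℂ} (hp : ∀ v, (starRingEnd ℂ) (p v) = p ((starRingEnd ℂ) v))
    (a x : ℝ) : (starRingEnd ℂ) (airyTransform p a x) = airyTransform p a x := by
  rw [airyTransform, map_mul, ← integral_conj]
  congr 1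
  · simp [map_ofNat]
  · rw [← integral_neg_eq_self]
    congr 1
    ext y
    rw [map_mul, hp, ← Complex.exp_conj]
    simp [map_ofNat]

theorem isSymbol_one : IsSymbol fun _ => (1 : ℂ) := isSymbol_const 1

theorem airyAi_eq_one (x : ℝ) : (airyAi x : ℂ) = airyTransform (fun _ => 1) 1 x := by
  have h : (1 / (2 * I * (Real.pi : ℂ))) *
      ∫ y : ℝ, exp ((1 + (y : ℂ) * I) ^ 3 / 3 - (x : ℂ) * (1 + (y : ℂ) * I)) * I =
      airyTransform (fun _ => 1) 1 x := by
    rw [integral_mul_const, airyTransform]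
    have : ∀ J : ℂ, (1 / (2 * I * (Real.pi : ℂ))) * (J * I) = (1 / (2 * (Real.pi : ℂ))) * J := by
      intro J
      have := I_ne_zero
      field_simp
    rw [this]
    congr 2
    ext y
    rw [one_mul]
    congr 1
    push_cast
    ring
  rw [airyAi, h]
  exact Complex.conj_eq_iff_re.mp (conj_airyTransform (fun v => by simp) 1 x)

theorem airyAi_eq {a : ℝ} (ha : 0 < a) (x : ℝ) :
    (airyAi x : ℂ) = airyTransform (fun _ => 1) a x := by
  rw [airyAi_eq_one, airyTransform_contour isSymbol_one one_pos ha]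

theorem norm_one_le_exp (y : ℝ) : ‖(1 : ℂ)‖ ≤ 1 * Real.exp (0 * |y|) := by simp

/-- The constant in the exponential bound of the Airy function. -/
noncomputable def airyBound : ℝ := airyConst 0 1

theorem airyBound_nonneg : 0 ≤ airyBound := airyConst_nonneg _ _

theorem abs_airyAi_le (x : ℝ) : |airyAi x| ≤ airyBound * Real.exp (-x) := by
  have h := norm_airyTransform_le (p := fun _ => 1) one_pos (C := 1) (κ := 0)
    (fun y => norm_one_le_exp y) x
  rw [← airyAi_eq_one, Complex.norm_real, Real.norm_eq_abs] at h
  simpa [airyBound] using h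

theorem continuous_airyAi : Continuous airyAi := by
  have h := continuous_airyTransform (p := fun _ => 1) one_pos (C := 1) (κ := 0) zero_le_one
    continuous_const (fun y => norm_one_le_exp y)
  have h2 := Complex.continuous_re.comp h
  refine h2.congr fun x => ?_
  rw [Function.comp_apply, ← airyAi_eq_one, Complex.ofReal_re]

end AiryTransform

section AiryTail

theorem norm_inv_line_le (y : ℝ) : ‖1 / (((1 : ℝ) : ℂ) + y * I)‖ ≤ 1 * Real.exp (0 * |y|) := by
  have h := le_norm_line (x := 1) y
  rw [zero_mul, Real.exp_zero, mul_one, norm_div, norm_one]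
  exact (div_le_one (by linarith)).mpr h

theorem continuous_inv_line : Continuous fun y : ℝ => 1 / (((1 : ℝ) : ℂ) + y * I) :=
  continuous_const.div (by fun_prop) fun y => line_ne_zero one_pos y

/-- The integral of the Airy function over a half line. -/
noncomputable def airyTail (x : ℝ) : ℝ := ∫ u in Set.Ioi (0 : ℝ), airyAi (x + u)

theorem integrableOn_exp_shift (x : ℝ) {c : ℝ} (hc : 0 < c) :
    IntegrableOn (fun u : ℝ => Real.exp (-(c * (x + u)))) (Set.Ioi 0) := by
  have h : IntegrableOn (fun u : ℝ => Real.exp (-(c * x)) * Real.exp (-c * u)) (Set.Ioi 0) :=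
    (integrableOn_exp_mul_Ioi (neg_lt_zero.mpr hc) 0).const_mul _
  refine h.congr_fun (fun u _ => ?_) measurableSet_Ioi
  simp only
  rw [← Real.exp_add]
  congr 1
  ring

/-- Integrating exp(-uv) over u > 0 multiplies the symbol by 1/v, by Fubini on the line Re v = 1. -/
theorem airyTail_eq (x : ℝ) : (airyTail x : ℂ) = airyTransform (fun v => 1 / v) 1 x := by
  rw [airyTail, ← integral_complex_ofReal, airyTransform]
  simp_rw [airyAi_eq_one, airyTransform]
  rw [integral_const_mul]
  congr 1
  have hint : Integrable (Function.uncurry fun (u y : ℝ) => (1 : ℂ) *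
      exp (-((x + u : ℝ) : ℂ) * ((1 : ℝ) + y * I) + ((1 : ℝ) + y * I) ^ 3 / 3))
      ((volume.restrict (Set.Ioi 0)).prod volume) := by
    have hb : Integrable (fun z : ℝ × ℝ => Real.exp (1 / 3) * (Real.exp (-(1 * (x + z.1))) *
      gaussBound 0 1 z.2)) ((volume.restrict (Set.Ioi 0)).prod volume) :=
      ((integrableOn_exp_shift x one_pos).mul_prod (integrable_gaussBound 0 one_pos)).const_mul _
    refine hb.mono' (Continuous.aestronglyMeasurable ?_) (Eventually.of_forall fun z => ?_)
    · simp only [Function.uncurry_def]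
      fun_prop
    · refine (norm_airyIntegrand_le (p := fun _ => 1) (norm_one_le_exp z.2)).trans (le_of_eq ?_)
      rw [one_mul, sub_eq_add_neg, Real.exp_add]
      norm_num
      ring
  rw [integral_integral_swap hint]
  congr 1
  ext y
  have hne := line_ne_zero one_pos y
  set v : ℂ := (1 : ℝ) + y * I
  have hv : v.re = 1 := by simp [v]
  have h1 : ∀ u : ℝ, (1 : ℂ) * exp (-((x + u : ℝ) : ℂ) * v + v ^ 3 / 3) =
      exp (-(x : ℂ) * v + v ^ 3 / 3) * exp (-v * u) := by
    intro u
    rw [one_mul, ← Complex.exp_add]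
    congr 1
    push_cast
    ring
  simp_rw [h1]
  rw [integral_const_mul, integral_exp_mul_complex_Ioi (by simp [hv]) 0]
  simp
  field_simp

theorem abs_airyTail_le (x : ℝ) : |airyTail x| ≤ airyBound * Real.exp (-x) := by
  have h := norm_airyTransform_le (p := fun v => 1 / v) one_pos (C := 1) (κ := 0)
    (fun y => norm_inv_line_le y) x
  rw [← airyTail_eq, Complex.norm_real, Real.norm_eq_abs] at h
  simpa [airyBound] using h

theorem continuous_airyTail : Continuous airyTail := by
  have h := continuous_airyTransform (p := fun v => 1 / v) one_pos (C := 1) (κ := 0) zero_le_one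
    continuous_inv_line (fun y => norm_inv_line_le y)
  have h2 := Complex.continuous_re.comp h
  refine h2.congr fun x => ?_
  rw [Function.comp_apply, ← airyTail_eq, Complex.ofReal_re]

/-- The mean value inequality on the right half plane, where the derivative of exp(-w) has modulus
at most 1. -/
theorem norm_one_sub_exp_neg_le {z : ℂ} (hz : 0 ≤ z.re) : ‖1 - exp (-z)‖ ≤ ‖z‖ := by
  have h := Convex.norm_image_sub_le_of_norm_deriv_le (f := fun w : ℂ => exp (-w)) (C := 1)
    (s := {w : ℂ | 0 ≤ w.re}) (x := z) (y := 0) (fun w _ => by fun_prop) (fun w hw => ?_)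
    (convex_halfSpace_re_ge 0) hz (by simp)
  · simpa using h
  · have hd : HasDerivAt (fun w : ℂ => exp (-w)) (exp (-w) * -1) w :=
      (Complex.hasDerivAt_exp (-w)).comp w (hasDerivAt_neg w)
    have hw' : 0 ≤ w.re := hw
    rw [hd.deriv, norm_mul, Complex.norm_exp]
    simpa using hw'

/-- The symbol of a difference quotient. -/
noncomputable def diffSymbol (h : ℝ) (v : ℂ) : ℂ := (1 - exp (-(h * v))) / (h * v)

theorem norm_diffSymbol_le {h : ℝ} (hh : 0 < h) {v : ℂ} (hv : 0 < v.re) : ‖diffSymbol h v‖ ≤ 1 := by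
  have hne : (h : ℂ) * v ≠ 0 := mul_ne_zero (by exact_mod_cast hh.ne') fun h0 => by simp [h0] at hv
  rw [diffSymbol, norm_div, div_le_one (norm_pos_iff.mpr hne)]
  exact norm_one_sub_exp_neg_le (by simpa using (mul_pos hh hv).le)

theorem tendsto_diffSymbol {v : ℂ} (hv : v ≠ 0) :
    Tendsto (fun h : ℝ => diffSymbol h v) (𝓝[>] 0) (𝓝 1) := by
  have hd : HasDerivAt (fun h : ℝ => exp (-(h * v))) (exp (-(((0 : ℝ) : ℂ) * v)) * (-(1 * v)))
      (0 : ℝ) :=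
    ((ofRealCLM.hasDerivAt (x := (0 : ℝ))).mul_const v).neg.cexp
  have h1 := hd.tendsto_slope_zero_right
  simp only [zero_add, ofReal_zero, zero_mul, neg_zero, exp_zero, one_mul] at h1
  have h2 := (h1.div_const v).neg
  rw [neg_div, div_self hv, neg_neg] at h2
  refine h2.congr' ?_
  filter_upwards [self_mem_nhdsWithin] with h hh
  have hh' : (h : ℂ) ≠ 0 := by exact_mod_cast (Set.mem_Ioi.mp hh).ne'
  simp only [diffSymbol, real_smul, ofReal_inv]
  field_simp
  ring

theorem continuous_diffSymbol {h : ℝ} (hh : 0 < h) {a : ℝ} (ha : 0 < a) :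
    Continuous fun y : ℝ => diffSymbol h (a + y * I) := by
  unfold diffSymbol
  refine Continuous.div (by fun_prop) (by fun_prop) fun y => ?_
  exact mul_ne_zero (by exact_mod_cast hh.ne') (line_ne_zero ha y)

/-- A shift by h multiplies the symbol by exp(-hv). The quotient symbol has modulus at most 1 on the
right half plane for all h > 0, so difference quotients of the tail obey the bound of the Airy
function uniformly in h and converge to Ai. -/
theorem airyTail_diff {h : ℝ} (hh : 0 < h) (x : ℝ) :
    (((airyTail x - airyTail (x + h)) / h : ℝ) : ℂ) = airyTransform (diffSymbol h) 1 x := by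
  have hI := integrable_airyIntegrand (p := fun v => 1 / v) one_pos (C := 1) (κ := 0)
    continuous_inv_line (fun y => norm_inv_line_le y)
  push_cast
  rw [airyTail_eq, airyTail_eq, airyTransform, airyTransform, airyTransform, ← mul_sub,
    ← integral_sub (hI x) (hI (x + h)), mul_div_assoc, ← integral_div]
  congr 2
  ext y
  have hne := line_ne_zero one_pos y
  set v : ℂ := (1 : ℝ) + y * I
  have hh' : (h : ℂ) ≠ 0 := by exact_mod_cast hh.ne'
  have e : exp (-((x + h : ℝ) : ℂ) * v + v ^ 3 / 3) =
      exp (-(x : ℂ) * v + v ^ 3 / 3) * exp (-(h * v)) := by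
    rw [← Complex.exp_add]
    congr 1
    push_cast
    ring
  rw [e, diffSymbol]
  field_simp

theorem abs_airyTail_diff_le {h : ℝ} (hh : 0 < h) (x : ℝ) :
    |(airyTail x - airyTail (x + h)) / h| ≤ airyBound * Real.exp (-x) := by
  have h := norm_airyTransform_le (p := diffSymbol h) one_pos (C := 1) (κ := 0)
    (fun y => by simpa using norm_diffSymbol_le hh (by simp)) x
  rw [← airyTail_diff hh, Complex.norm_real, Real.norm_eq_abs] at h
  simpa [airyBound] using h

theorem tendsto_airyTail_diff {ι : Type*} {l : Filter ι} [l.IsCountablyGenerated] {h X : ι → ℝ}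
    {x : ℝ} (hh : Tendsto h l (𝓝[>] 0)) (hX : Tendsto X l (𝓝 x)) :
    Tendsto (fun i => (airyTail (X i) - airyTail (X i + h i)) / h i) l (𝓝 (airyAi x)) := by
  have hpos : ∀ᶠ i in l, 0 < h i := hh.eventually self_mem_nhdsWithin
  have h1 := tendsto_airyTransform (p := fun i => diffSymbol (h i)) (p' := fun _ => 1) (X := X)
    one_pos (C := 1) (κ := 0) zero_le_one
    (hpos.mono fun i hi => continuous_diffSymbol hi one_pos)
    (hpos.mono fun i hi y => by simpa using norm_diffSymbol_le hi (by simp))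
    (fun y => (tendsto_diffSymbol (line_ne_zero one_pos y)).comp hh) hX
  rw [← airyAi_eq_one] at h1
  have h2 := (Complex.continuous_re.tendsto _).comp h1
  rw [Complex.ofReal_re] at h2
  refine h2.congr' ?_
  filter_upwards [hpos] with i hi
  rw [Function.comp_apply, ← airyTail_diff hi, Complex.ofReal_re]

end AiryTail

/-! ### Domination at the common rate 1/2, and convergence of the scalar determinant. -/

section ExponentialDomination

theorem abs_mul_expBound_le {χ : ℝ → ℝ} {s : ℝ} (hχ : ∀ r, |χ r| ≤ cutoff s r) {C : ℝ} (hC : 0 ≤ C)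
    (r : ℝ) : |χ r| * expBound C (1 / 2) r ^ 2 ≤
      (C + 1) * (Real.exp (-s) * Real.exp (-(1 * |r - s|))) := by
  have h1 := cutoff_mul_exp_le s (δ := 1) r
  have h2 := (hχ r).trans (le_abs_self _)
  rw [expBound_sq hC, mul_left_comm]
  refine mul_le_mul_of_nonneg_left ?_ (by linarith)
  rw [show -(2 * (1 / 2) * r) = -(1 * r) by ring]
  rw [one_mul s] at h1
  exact (mul_le_mul_of_nonneg_right h2 (Real.exp_pos _).le).trans h1

theorem integrable_exp_weight (C s : ℝ) :
    Integrable fun r : ℝ => (C + 1) * (Real.exp (-s) * Real.exp (-(1 * |r - s|))) :=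
  ((integrable_exp_neg_mul_abs_sub s one_pos).const_mul _).const_mul _

theorem le_expBound_half_mul {C : ℝ} (hC : 0 ≤ C) (r r' : ℝ) :
    C * Real.exp (-((r + r') / 2)) ≤ expBound C (1 / 2) r * expBound C (1 / 2) r' := by
  have h := le_expBound_mul hC (1 / 2) r r'
  rwa [show -(r * (1 / 2)) - r' * (1 / 2) = -((r + r') / 2) by ring] at h

/-- The rate 1/2, below the natural rate 1, keeps an exponential in reserve. It pays for the factor
1/h in the last row of the discrete operator, in `abs_diffEntry_le`. -/
theorem detDominated_of_le {χ : ℝ → ℝ} {K : ℝ → ℝ → ℝ} {s C : ℝ} (hχm : Measurable χ)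
    (hχ : ∀ r, |χ r| ≤ cutoff s r) (hK : Measurable fun p : ℝ × ℝ => K p.1 p.2) (hC : 0 ≤ C)
    (hb : ∀ r r', χ r ≠ 0 → χ r' ≠ 0 → |K r r'| ≤ C * Real.exp (-((r + r') / 2))) :
    DetDominated χ K (expBound C (1 / 2))
      (fun r => (C + 1) * (Real.exp (-s) * Real.exp (-(1 * |r - s|)))) where
  measurable_weight := hχm
  measurable_kernel := hK
  bound := fun r r' h h' => (hb r r' h h').trans (le_expBound_half_mul hC r r')
  bound_weight := abs_mul_expBound_le hχ hC

theorem pfaffianDominated_of_le {χ : ℝ → ℝ} {K : ℝ → ℝ → Matrix (Fin 2) (Fin 2) ℂ} {s C : ℝ}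
    (hχm : Measurable χ) (hχ : ∀ r, |χ r| ≤ cutoff s r)
    (hK : ∀ i j, Measurable fun p : ℝ × ℝ => K p.1 p.2 i j) (hC : 0 ≤ C)
    (hb : ∀ r r', χ r ≠ 0 → χ r' ≠ 0 → ∀ i j, ‖K r r' i j‖ ≤ C * Real.exp (-((r + r') / 2))) :
    PfaffianDominated χ K (expBound C (1 / 2))
      (fun r => (C + 1) * (Real.exp (-s) * Real.exp (-(1 * |r - s|)))) where
  measurable_weight := hχm
  measurable_kernel := hK
  bound := fun r r' h h' i j => (hb r r' h h' i j).trans (le_expBound_half_mul hC r r')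
  bound_weight := abs_mul_expBound_le hχ hC

theorem abs_cutoff_le (s r : ℝ) : |cutoff s r| ≤ cutoff s r := by
  by_cases hr : s ≤ r <;> simp [cutoff, hr]

theorem cutoff_ne_zero_iff (s r : ℝ) : cutoff s r ≠ 0 ↔ s ≤ r := by
  simp [cutoff, Set.indicator_apply]

theorem exp_neg_add_le {s r r' : ℝ} (hr : s ≤ r) (hr' : s ≤ r') :
    Real.exp (-(r + r')) ≤ Real.exp (-s) * Real.exp (-((r + r') / 2)) := by
  rw [← Real.exp_add]
  exact Real.exp_le_exp.mpr (by linarith)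

end ExponentialDomination

section GldKernel

theorem abs_airyKernel_le (x y : ℝ) :
    |airyKernel x y| ≤ airyBound ^ 2 * Real.exp (-(x + y)) := by
  have hb : IntegrableOn (fun u : ℝ => airyBound ^ 2 * Real.exp (-(2 * ((x + y) / 2 + u))))
    (Set.Ioi 0) := (integrableOn_exp_shift ((x + y) / 2) two_pos).const_mul _
  have h : ‖airyKernel x y‖ ≤
      ∫ u in Set.Ioi (0 : ℝ), airyBound ^ 2 * Real.exp (-(2 * ((x + y) / 2 + u))) := by
    refine norm_integral_le_of_norm_le hb (Eventually.of_forall fun u => ?_)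
    rw [norm_mul, Real.norm_eq_abs, Real.norm_eq_abs]
    refine (mul_le_mul (abs_airyAi_le _) (abs_airyAi_le _) (abs_nonneg _)
      (mul_nonneg airyBound_nonneg (Real.exp_pos _).le)).trans (le_of_eq ?_)
    rw [mul_mul_mul_comm, ← Real.exp_add, ← sq]
    congr 2
    ring
  have h2 : ∫ u in Set.Ioi (0 : ℝ), airyBound ^ 2 * Real.exp (-(2 * ((x + y) / 2 + u))) =
      airyBound ^ 2 * Real.exp (-(x + y)) * (1 / 2) := by
    have e : ∀ u : ℝ, airyBound ^ 2 * Real.exp (-(2 * ((x + y) / 2 + u))) =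
        airyBound ^ 2 * Real.exp (-(x + y)) * Real.exp (-2 * u) := by
      intro u
      rw [mul_assoc, ← Real.exp_add]
      congr 2
      ring
    simp_rw [e]
    rw [integral_const_mul, integral_exp_mul_Ioi (by norm_num) 0]
    norm_num
  rw [h2] at h
  refine h.trans ?_
  have : 0 ≤ airyBound ^ 2 * Real.exp (-(x + y)) := by positivity
  linarith

theorem gldKernel_eq (x y : ℝ) :
    gldKernel x y = airyKernel x y - (1 / 2) * airyAi x * airyTail y := rfl

theorem abs_gldKernel_le (x y : ℝ) :
    |gldKernel x y| ≤ 2 * airyBound ^ 2 * Real.exp (-(x + y)) := by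
  have h1 := abs_airyKernel_le x y
  have h2 : |(1 / 2) * airyAi x * airyTail y| ≤ airyBound ^ 2 * Real.exp (-(x + y)) := by
    rw [abs_mul, abs_mul, abs_of_pos (by norm_num : (0 : ℝ) < 1 / 2), mul_assoc]
    have h3 := mul_le_mul (abs_airyAi_le x) (abs_airyTail_le y) (abs_nonneg _)
      (mul_nonneg airyBound_nonneg (Real.exp_pos _).le)
    rw [mul_mul_mul_comm, ← Real.exp_add, ← sq, ← neg_add] at h3
    have : 0 ≤ |airyAi x| * |airyTail y| := by positivity
    linarith
  rw [gldKernel_eq]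
  refine (abs_sub _ _).trans ?_
  linarith

theorem measurable_gldKernel : Measurable fun p : ℝ × ℝ => gldKernel p.1 p.2 := by
  have hA := continuous_airyAi
  have hB := continuous_airyTail
  have h1 : Measurable fun p : ℝ × ℝ => airyKernel p.1 p.2 := by
    have hc : Continuous fun q : (ℝ × ℝ) × ℝ => airyAi (q.1.1 + q.2) * airyAi (q.1.2 + q.2) := by
      fun_prop
    exact hc.stronglyMeasurable.integral_prod_right.measurable
  simp_rw [gldKernel_eq]
  exact h1.sub (Continuous.measurable (by fun_prop))

theorem gldKernel_dominated (s : ℝ) : ∃ C : ℝ, 0 ≤ C ∧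
    DetDominated (cutoff s) gldKernel (expBound C (1 / 2))
      (fun r => (C + 1) * (Real.exp (-s) * Real.exp (-(1 * |r - s|)))) := by
  have hC : 0 ≤ 2 * airyBound ^ 2 * Real.exp (-s) := by positivity
  refine ⟨_, hC, detDominated_of_le (measurable_cutoff s) (abs_cutoff_le s) measurable_gldKernel
    hC fun r r' hr hr' => (abs_gldKernel_le r r').trans ?_⟩
  rw [mul_assoc _ (Real.exp (-s))]
  rw [cutoff_ne_zero_iff] at hr hr'
  exact mul_le_mul_of_nonneg_left (exp_neg_add_le hr hr') (by positivity)

theorem gld_converges (s : ℝ) : FredholmDetConverges (cutoff s) gldKernel := by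
  obtain ⟨C, hC, h⟩ := gldKernel_dominated s
  exact h.converges (expBound_pos hC _) (integrable_exp_weight C s)

end GldKernel

/-! ### The discretization: a shrinking mesh on a growing window. -/

section Mesh

/-- The mesh of the discretization. -/
noncomputable def mesh (m : ℕ) : ℝ := 1 / ((m : ℝ) + 1)

/-- The number of cells of the discretization. -/
def meshCells (m : ℕ) : ℕ := (m + 1) ^ 2

theorem mesh_pos (m : ℕ) : 0 < mesh m := by
  unfold mesh
  positivity

theorem mesh_le_one (m : ℕ) : mesh m ≤ 1 := by
  unfold mesh
  rw [div_le_one (by positivity)]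
  linarith [Nat.cast_nonneg (α := ℝ) m]

/-- The cells have length 1/(m + 1) and together cover [s, s + m + 1), so a single limit in m
removes both the mesh and the truncation. -/
theorem meshCells_mul_mesh (m : ℕ) : (meshCells m : ℝ) * mesh m = m + 1 := by
  unfold meshCells mesh
  push_cast
  field_simp

theorem tendsto_mesh : Tendsto mesh atTop (𝓝[>] 0) :=
  tendsto_nhdsWithin_iff.mpr ⟨tendsto_one_div_add_atTop_nhds_zero_nat,
    Eventually.of_forall mesh_pos⟩

theorem tendsto_mesh_zero : Tendsto mesh atTop (𝓝 0) :=
  tendsto_one_div_add_atTop_nhds_zero_nat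

/-- The left end of the cell that contains `r`. -/
noncomputable def node (s h r : ℝ) : ℝ := s + cellIndex s h r * h

theorem node_le {s h r : ℝ} (hh : 0 < h) (hr : s ≤ r) : node s h r ≤ r := by
  have h1 := ((mem_cell_iff hh _ r).mpr ⟨hr, rfl⟩).1
  exact h1

theorem lt_node_add {s h r : ℝ} (hh : 0 < h) (hr : s ≤ r) : r < node s h r + h := by
  have h1 := ((mem_cell_iff hh _ r).mpr ⟨hr, rfl⟩).2
  unfold node
  linarith

theorem tendsto_node {s r : ℝ} (hr : s ≤ r) :
    Tendsto (fun m => node s (mesh m) r) atTop (𝓝 r) := by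
  have h1 : Tendsto (fun m => r - mesh m) atTop (𝓝 r) := by
    simpa using tendsto_mesh_zero.const_sub r
  refine tendsto_of_tendsto_of_tendsto_of_le_of_le h1 tendsto_const_nhds (fun m => ?_) fun m => ?_
  · have := lt_node_add (mesh_pos m) hr
    simp only
    linarith
  · exact node_le (mesh_pos m) hr

theorem abs_stepCutoff_le (s h : ℝ) (M : ℕ) (r : ℝ) : |stepCutoff s h M r| ≤ cutoff s r := by
  by_cases h0 : stepCutoff s h M r = 0
  · rw [h0, abs_zero]
    exact (abs_nonneg _).trans (abs_cutoff_le s r)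
  · have h1 := (stepCutoff_ne_zero_iff M r).mp h0
    rw [stepCutoff, Set.indicator_of_mem (Set.mem_Ico.mpr h1), cutoff,
      Set.indicator_of_mem (Set.mem_Ici.mpr h1.1)]
    simp

theorem tendsto_stepCutoff (s r : ℝ) {N : ℕ → ℕ} (hN : ∀ m, meshCells m ≤ N m) :
    Tendsto (fun m => stepCutoff s (mesh m) (N m) r) atTop (𝓝 (cutoff s r)) := by
  by_cases hr : s ≤ r
  · refine tendsto_const_nhds.congr' ?_
    have h1 : ∀ᶠ m : ℕ in atTop, r - s < (m : ℝ) + 1 :=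
      (tendsto_atTop_add_const_right _ 1 tendsto_natCast_atTop_atTop).eventually_gt_atTop (r - s)
    filter_upwards [h1] with m hm
    have h2 : (meshCells m : ℝ) * mesh m ≤ (N m : ℝ) * mesh m :=
      mul_le_mul_of_nonneg_right (by exact_mod_cast hN m) (mesh_pos m).le
    rw [meshCells_mul_mesh] at h2
    rw [cutoff, Set.indicator_of_mem (Set.mem_Ici.mpr hr), stepCutoff,
      Set.indicator_of_mem (Set.mem_Ico.mpr ⟨hr, by linarith⟩)]
  · refine tendsto_const_nhds.congr fun m => ?_
    rw [cutoff, Set.indicator_of_notMem (by simpa using hr), stepCutoff,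
      Set.indicator_of_notMem (by simp [hr])]

theorem measurable_cell_kernel {α : Type*} [MeasurableSpace α] (s h : ℝ) (A : ℕ → ℕ → α) :
    Measurable fun p : ℝ × ℝ => A (cellIndex s h p.1) (cellIndex s h p.2) := by
  have h1 : Measurable fun q : ℕ × ℕ => A q.1 q.2 := measurable_of_countable _
  exact h1.comp (((measurable_cellIndex s h).comp measurable_fst).prodMk
    ((measurable_cellIndex s h).comp measurable_snd))

end Mesh

section DoubleContourBounds

theorem norm_one_div_four_pi_sq_le : ‖(1 / (4 * (Real.pi : ℂ) ^ 2))‖ ≤ 1 := by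
  rw [norm_div, norm_one, norm_mul, norm_pow, Complex.norm_real, Real.norm_of_nonneg
    Real.pi_pos.le, div_le_one (by simp [Real.pi_pos])]
  have := Real.pi_gt_three
  norm_num
  nlinarith

theorem norm_doubleContour_le {F : ℂ → ℂ → ℂ} {a b : ℝ} (ha : 0 < a) (hb : 0 < b) {C κ : ℝ}
    (hF : ∀ y y' : ℝ, ‖F (a + y * I) (b + y' * I)‖ ≤ C * (gaussBound κ a y * gaussBound κ b y')) :
    ‖doubleContour a b F‖ ≤ C * ((∫ y, gaussBound κ a y) * ∫ y, gaussBound κ b y) := by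
  rw [doubleContour_eq, norm_mul]
  have h2 := norm_integral_le_of_norm_le ((integrable_gaussBound_prod κ ha hb).const_mul C)
    (Eventually.of_forall fun x : ℝ × ℝ => hF x.1 x.2)
  have h3 : ∫ x : ℝ × ℝ, gaussBound κ a x.1 * gaussBound κ b x.2 =
      (∫ y, gaussBound κ a y) * ∫ y, gaussBound κ b y := integral_prod_mul _ _
  rw [integral_const_mul, h3] at h2
  simpa using mul_le_mul norm_one_div_four_pi_sq_le h2 (norm_nonneg _) zero_le_one

theorem airyTransform_mul_airyTransform (p q : ℂ → ℂ) (a b x y : ℝ) :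
    airyTransform p a x * airyTransform q b y = doubleContour a b fun v w =>
      p v * q w * exp (-(x : ℂ) * v + v ^ 3 / 3) * exp (-(y : ℂ) * w + w ^ 3 / 3) := by
  rw [airyTransform, airyTransform, doubleContour_eq, mul_mul_mul_comm]
  congr 1
  · ring
  · have h := integral_prod_mul (μ := (volume : Measure ℝ)) (ν := (volume : Measure ℝ))
      (fun t : ℝ => p (a + t * I) * exp (-(x : ℂ) * (a + t * I) + (a + t * I) ^ 3 / 3))
      (fun t : ℝ => q (b + t * I) * exp (-(y : ℂ) * (b + t * I) + (b + t * I) ^ 3 / 3))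
    rw [← h]
    refine integral_congr_ae (Eventually.of_forall fun z => ?_)
    simp only
    ring

end DoubleContourBounds

/-! ### The discrete kernel as a double contour integral. -/

section StepWeight

/-- The discrete form of `(v - w) / (v + w)`. -/
noncomputable def stepWeight (h : ℝ) (M : ℕ) (v w : ℂ) : ℂ :=
  (exp (-(h * w)) - exp (-(h * v))) * ∑ l ∈ Finset.range M, exp (-(h * (v + w))) ^ l

theorem exp_neg_mesh_le {h : ℝ} (hh : 0 < h) (hh1 : h ≤ 1) :
    Real.exp (-(2 * h)) ≤ 1 - 2 * h / 3 := by
  have h1 : 1 + 2 * h ≤ Real.exp (2 * h) := by linarith [Real.add_one_le_exp (2 * h)]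
  rw [Real.exp_neg, inv_le_comm₀ (Real.exp_pos _) (by linarith)]
  refine le_trans ?_ h1
  rw [inv_eq_one_div, div_le_iff₀ (by linarith)]
  nlinarith

theorem norm_geom_sum_le {q : ℂ} {c : ℝ} (hq : ‖q‖ ≤ 1 - c) (hc : 0 < c) (M : ℕ) :
    ‖∑ l ∈ Finset.range M, q ^ l‖ ≤ 1 / c := by
  have h0 := norm_nonneg q
  have hs := (summable_geometric_of_lt_one h0 (by linarith)).sum_le_tsum (Finset.range M)
    (fun i _ => pow_nonneg h0 i)
  rw [tsum_geometric_of_lt_one h0 (by linarith)] at hs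
  refine (norm_sum_le _ _).trans ?_
  simp_rw [norm_pow]
  refine hs.trans ?_
  rw [inv_eq_one_div]
  exact one_div_le_one_div_of_le hc (by linarith)

/-- The difference of exponentials is O(h) and the geometric sum is O(1/h) uniformly in M, because
its ratio has modulus exp(-2h) on the lines Re v = Re w = 1. The powers of h cancel. -/
theorem norm_stepWeight_le {h : ℝ} (hh : 0 < h) (hh1 : h ≤ 1) (M : ℕ) (y y' : ℝ) :
    ‖stepWeight h M ((1 : ℝ) + y * I) ((1 : ℝ) + y' * I)‖ ≤
      3 * (Real.exp |y| * Real.exp |y'|) := by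
  set v : ℂ := (1 : ℝ) + y * I with hv
  set w : ℂ := (1 : ℝ) + y' * I with hw
  have hvr : v.re = 1 := by simp [hv]
  have hwr : w.re = 1 := by simp [hw]
  have h1 : ‖exp (-(h * w)) - exp (-(h * v))‖ ≤ h * (2 * (Real.exp |y| * Real.exp |y'|)) := by
    have e : exp (-(h * w)) - exp (-(h * v)) = (1 - exp (-(h * v))) - (1 - exp (-(h * w))) := by
      ring
    have h2 : ‖1 - exp (-(h * v))‖ ≤ h * (1 + |y|) := by
      refine (norm_one_sub_exp_neg_le (by simp [hvr, hh.le])).trans ?_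
      rw [norm_mul, Complex.norm_real, Real.norm_of_nonneg hh.le]
      exact mul_le_mul_of_nonneg_left (norm_line_le one_pos y) hh.le
    have h3 : ‖1 - exp (-(h * w))‖ ≤ h * (1 + |y'|) := by
      refine (norm_one_sub_exp_neg_le (by simp [hwr, hh.le])).trans ?_
      rw [norm_mul, Complex.norm_real, Real.norm_of_nonneg hh.le]
      exact mul_le_mul_of_nonneg_left (norm_line_le one_pos y') hh.le
    have h4 := Real.add_one_le_exp |y|
    have h5 := Real.add_one_le_exp |y'|
    have h6 : (1 + |y|) + (1 + |y'|) ≤ 2 * (Real.exp |y| * Real.exp |y'|) := by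
      have := abs_nonneg y
      have := abs_nonneg y'
      nlinarith
    rw [e]
    refine (norm_sub_le _ _).trans ((add_le_add h2 h3).trans ?_)
    rw [← mul_add]
    exact mul_le_mul_of_nonneg_left h6 hh.le
  have h2 : ‖∑ l ∈ Finset.range M, exp (-(h * (v + w))) ^ l‖ ≤ 1 / (2 * h / 3) := by
    refine norm_geom_sum_le ?_ (by positivity) M
    rw [Complex.norm_exp]
    refine le_trans (le_of_eq ?_) (exp_neg_mesh_le hh hh1)
    congr 1
    simp only [neg_re, mul_re, ofReal_re, add_re, hvr, hwr, ofReal_im, zero_mul, sub_zero]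
    ring
  rw [stepWeight, norm_mul]
  refine (mul_le_mul h1 h2 (norm_nonneg _) (by positivity)).trans (le_of_eq ?_)
  field_simp

theorem continuous_stepWeight (h : ℝ) (M : ℕ) : Continuous fun x : ℝ × ℝ =>
    stepWeight h M ((1 : ℝ) + x.1 * I) ((1 : ℝ) + x.2 * I) := by
  unfold stepWeight
  fun_prop

/-- Summing the geometric series leaves difference symbols, which tend to 1, and a tail exp(-Mh(v +
w)), which tends to 0 when the window grows. -/
theorem stepWeight_eq {h : ℝ} (hh : 0 < h) (M : ℕ) {v w : ℂ} (hv : 0 < v.re) (hw : 0 < w.re) :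
    stepWeight h M v w = (diffSymbol h v * v - diffSymbol h w * w) /
      (diffSymbol h (v + w) * (v + w)) * (1 - exp (-(((M : ℝ) * h : ℝ) * (v + w)))) := by
  have hv0 : v ≠ 0 := fun h0 => by simp [h0] at hv
  have hw0 : w ≠ 0 := fun h0 => by simp [h0] at hw
  have hvw : v + w ≠ 0 := fun h0 => by
    have := congrArg Complex.re h0
    simp at this
    linarith
  have hh0 : (h : ℂ) ≠ 0 := by exact_mod_cast hh.ne'
  have hz : exp (-(h * (v + w))) ≠ 1 := by
    intro h0
    have h1 := congrArg norm h0
    rw [Complex.norm_exp, norm_one, Real.exp_eq_one_iff] at h1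
    simp at h1
    rcases h1 with h1 | h1 <;> linarith
  have hz' : 1 - exp (-(h * (v + w))) ≠ 0 := sub_ne_zero.mpr (Ne.symm hz)
  have hz'' : exp (-(h * (v + w))) - 1 ≠ 0 := sub_ne_zero.mpr hz
  rw [stepWeight, geom_sum_eq hz, ← Complex.exp_nat_mul]
  have e : (M : ℂ) * -(h * (v + w)) = -(((M : ℝ) * h : ℝ) * (v + w)) := by
    push_cast
    ring
  rw [e, diffSymbol, diffSymbol, diffSymbol]
  set E := exp (-(((M : ℝ) * h : ℝ) * (v + w)))
  set z := exp (-(h * (v + w)))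
  set zv := exp (-(h * v))
  set zw := exp (-(h * w))
  have e1 : (1 - zv) / (h * v) * v - (1 - zw) / (h * w) * w = (zw - zv) / h := by
    field_simp
    ring
  have e2 : (1 - z) / (h * (v + w)) * (v + w) = (1 - z) / h := by field_simp
  rw [e1, e2, div_div_div_cancel_right₀ hh0, ← neg_sub 1 E, ← neg_sub 1 z, neg_div_neg_eq]
  ring

theorem tendsto_stepWeight {v w : ℂ} (hv : 0 < v.re) (hw : 0 < w.re) :
    Tendsto (fun m => stepWeight (mesh m) (meshCells m) v w) atTop (𝓝 ((v - w) / (v + w))) := by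
  have hv0 : v ≠ 0 := fun h0 => by simp [h0] at hv
  have hw0 : w ≠ 0 := fun h0 => by simp [h0] at hw
  have hvw' : 0 < (v + w).re := by simpa using add_pos hv hw
  have hvw : v + w ≠ 0 := fun h0 => by simp [h0] at hvw'
  have hd : ∀ z : ℂ, z ≠ 0 → Tendsto (fun m => diffSymbol (mesh m) z) atTop (𝓝 1) :=
    fun z hz => (tendsto_diffSymbol hz).comp tendsto_mesh
  have hE : Tendsto (fun m : ℕ => exp (-((((meshCells m : ℕ) : ℝ) * mesh m : ℝ) * (v + w)))) atTop
      (𝓝 0) := by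
    rw [tendsto_zero_iff_norm_tendsto_zero]
    simp_rw [Complex.norm_exp, meshCells_mul_mesh]
    refine Real.tendsto_exp_atBot.comp ?_
    have h1 : Tendsto (fun m : ℕ => ((m : ℝ) + 1) * (v + w).re) atTop atTop :=
      (tendsto_atTop_add_const_right _ 1 tendsto_natCast_atTop_atTop).atTop_mul_const hvw'
    refine (tendsto_neg_atTop_atBot.comp h1).congr fun m => ?_
    simp only [Function.comp_apply, neg_re, re_ofReal_mul]
  have h := ((((hd v hv0).mul_const v).sub ((hd w hw0).mul_const w)).div
    ((hd (v + w) hvw).mul_const (v + w)) (by simpa using hvw)).mul (hE.const_sub 1)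
  simp only [one_mul, sub_zero, mul_one] at h
  exact h.congr fun m => (stepWeight_eq (mesh_pos m) _ hv hw).symm

end StepWeight

section SiteKernel

theorem sum_mul_shiftMatrix_mul {R : Type*} [Field R] {M : ℕ} (u v : Fin (M + 1) → R) :
    ∑ i, ∑ j, u i * shiftMatrix R M i j * v j = ∑ l : Fin M, u l.castSucc * v l.succ := by
  rw [Finset.sum_comm, Fin.sum_univ_succ, Finset.sum_eq_zero, zero_add]
  · refine Finset.sum_congr rfl fun k _ => ?_
    rw [Finset.sum_eq_single k.castSucc]
    · simp [shiftMatrix]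
    · intro i _ hi
      have : ¬ ((i : ℕ) + 1 = (k.succ : Fin (M + 1))) := by
        intro h
        apply hi
        rw [Fin.ext_iff]
        simpa using h
      simp only [shiftMatrix, Matrix.of_apply, if_neg this, mul_zero, zero_mul]
    · simp
  · intro i _
    simp [shiftMatrix]

/-- The discrete kernel built from two sequences. -/
noncomputable def seqKernel (M : ℕ) (x : Fin 2 → ℕ → ℂ) (j k : ℕ) : Matrix (Fin 2) (Fin 2) ℂ :=
  Matrix.of fun a c => (1 / 4) * ∑ l ∈ Finset.range M,
    (x a (l + j) * x c (l + 1 + k) - x a (l + 1 + j) * x c (l + k))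

theorem siteKernel_eq (M : ℕ) (x : Fin 2 → ℕ → ℂ) : siteKernel M (x 0) (x 1) =
    Matrix.of fun y z : Fin M × Fin 2 => seqKernel M x y.1 z.1 y.2 z.2 := by
  have hX : ∀ l (y : Fin M × Fin 2), siteVectors M (x 0) (x 1) l y = x y.2 (l + y.1) := by
    rintro l ⟨j, a⟩
    fin_cases a <;> simp [siteVectors]
  ext y z
  have h1 := sum_mul_shiftMatrix_mul (fun i : Fin (M + 1) => x y.2 (i + y.1))
    (fun i : Fin (M + 1) => x z.2 (i + z.1))
  have h2 := sum_mul_shiftMatrix_mul (fun i : Fin (M + 1) => x z.2 (i + z.1))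
    (fun i : Fin (M + 1) => x y.2 (i + y.1))
  rw [Finset.sum_comm] at h2
  simp only [Fin.val_castSucc, Fin.val_succ] at h1 h2
  rw [Matrix.of_apply, seqKernel, Matrix.of_apply, Finset.sum_range]
  simp only [siteKernel, Matrix.mul_apply, Matrix.transpose_apply, Matrix.smul_apply, hX,
    skewShift, Matrix.sub_apply, smul_eq_mul]
  rw [Finset.sum_sub_distrib, h1.symm]
  have h3 : ∑ l : Fin M, x y.2 (↑l + 1 + ↑y.1) * x z.2 (↑l + ↑z.1) =
      ∑ l : Fin M, x z.2 (↑l + ↑z.1) * x y.2 (↑l + 1 + ↑y.1) :=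
    Finset.sum_congr rfl fun l _ => mul_comm _ _
  rw [h3, h2.symm, ← Finset.sum_sub_distrib, Finset.mul_sum]
  simp_rw [Finset.sum_mul]
  rw [Finset.sum_comm]
  refine Finset.sum_congr rfl fun i _ => ?_
  rw [← Finset.sum_sub_distrib, Finset.mul_sum]
  refine Finset.sum_congr rfl fun j _ => ?_
  ring

end SiteKernel

section StepKernel

/-- The symbols of the two sequences of the discretization. -/
noncomputable def siteSymbol (h : ℝ) : Fin 2 → ℂ → ℂ := ![fun v => 1 / v, diffSymbol h]

/-- The two sequences of the discretization. -/
noncomputable def siteSeq (s h : ℝ) : Fin 2 → ℕ → ℝ :=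
  ![fun n => airyTail (s + n * h), fun n => (airyTail (s + n * h) - airyTail (s + n * h + h)) / h]

theorem siteSeq_eq (s : ℝ) {h : ℝ} (hh : 0 < h) (a : Fin 2) (n : ℕ) :
    (siteSeq s h a n : ℂ) = airyTransform (siteSymbol h a) 1 (s + n * h) := by
  fin_cases a
  · exact airyTail_eq _
  · exact airyTail_diff hh _

theorem continuous_siteSymbol {h : ℝ} (hh : 0 < h) (a : Fin 2) :
    Continuous fun y : ℝ => siteSymbol h a ((1 : ℝ) + y * I) := by
  fin_cases a
  · exact continuous_inv_line
  · exact continuous_diffSymbol hh one_pos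

theorem norm_siteSymbol_le {h : ℝ} (hh : 0 < h) (a : Fin 2) (y : ℝ) :
    ‖siteSymbol h a ((1 : ℝ) + y * I)‖ ≤ 1 * Real.exp (0 * |y|) := by
  fin_cases a
  · exact norm_inv_line_le y
  · rw [zero_mul, Real.exp_zero, mul_one]
    exact norm_diffSymbol_le hh (by simp)

theorem tendsto_siteSymbol (a : Fin 2) (y : ℝ) :
    Tendsto (fun m => siteSymbol (mesh m) a ((1 : ℝ) + y * I)) atTop
      (𝓝 ((![fun v => 1 / v, fun _ => 1] : Fin 2 → ℂ → ℂ) a ((1 : ℝ) + y * I))) := by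
  fin_cases a
  · exact tendsto_const_nhds
  · exact (tendsto_diffSymbol (line_ne_zero one_pos y)).comp tendsto_mesh

/-- The integrand of the double contour form of the discrete kernel. -/
noncomputable def stepIntegrand (p q : ℂ → ℂ) (h : ℝ) (M : ℕ) (x y : ℝ) (v w : ℂ) : ℂ :=
  p v * q w * stepWeight h M v w *
    (exp (-(x : ℂ) * v + v ^ 3 / 3) * exp (-(y : ℂ) * w + w ^ 3 / 3))

theorem norm_stepIntegrand_le {h : ℝ} (hh : 0 < h) (hh1 : h ≤ 1) (M : ℕ) (a c : Fin 2)
    (x y t t' : ℝ) : ‖stepIntegrand (siteSymbol h a) (siteSymbol h c) h M x y ((1 : ℝ) + t * I)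
      ((1 : ℝ) + t' * I)‖ ≤ 3 * Real.exp 1 * Real.exp (-(x + y)) *
        (gaussBound 1 1 t * gaussBound 1 1 t') := by
  have h1 := norm_siteSymbol_le hh a t
  have h2 := norm_siteSymbol_le hh c t'
  rw [zero_mul, Real.exp_zero, mul_one] at h1 h2
  have h3 := norm_stepWeight_le hh hh1 M t t'
  have e1 : ∀ r : ℝ, gaussBound 1 1 r = Real.exp |r| * Real.exp (-1 * r ^ 2) := by
    intro r
    rw [gaussBound, ← Real.exp_add]
    congr 1
    ring
  rw [stepIntegrand, norm_mul, norm_mul, norm_mul, norm_mul, norm_exp_cube, norm_exp_cube, e1, e1]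
  have e2 : Real.exp (1 ^ 3 / 3 - x * 1) * Real.exp (1 ^ 3 / 3 - y * 1) ≤
      Real.exp 1 * Real.exp (-(x + y)) := by
    rw [← Real.exp_add, ← Real.exp_add]
    exact Real.exp_le_exp.mpr (by linarith)
  have h4 : ‖siteSymbol h a ((1 : ℝ) + t * I)‖ * ‖siteSymbol h c ((1 : ℝ) + t' * I)‖ ≤ 1 * 1 :=
    mul_le_mul h1 h2 (norm_nonneg _) zero_le_one
  calc _ ≤ (1 * 1 * (3 * (Real.exp |t| * Real.exp |t'|))) *
        (Real.exp (1 ^ 3 / 3 - x * 1) * Real.exp (-1 * t ^ 2) *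
          (Real.exp (1 ^ 3 / 3 - y * 1) * Real.exp (-1 * t' ^ 2))) := by gcongr
    _ = (3 * (Real.exp |t| * Real.exp |t'|) * (Real.exp (-1 * t ^ 2) * Real.exp (-1 * t' ^ 2))) *
        (Real.exp (1 ^ 3 / 3 - x * 1) * Real.exp (1 ^ 3 / 3 - y * 1)) := by ring
    _ ≤ (3 * (Real.exp |t| * Real.exp |t'|) * (Real.exp (-1 * t ^ 2) * Real.exp (-1 * t' ^ 2))) *
        (Real.exp 1 * Real.exp (-(x + y))) := by gcongr
    _ = _ := by ring

theorem continuous_stepIntegrand {h : ℝ} (hh : 0 < h) (M : ℕ) (a c : Fin 2) (x y : ℝ) :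
    Continuous fun z : ℝ × ℝ => stepIntegrand (siteSymbol h a) (siteSymbol h c) h M x y
      ((1 : ℝ) + z.1 * I) ((1 : ℝ) + z.2 * I) := by
  unfold stepIntegrand
  exact ((((continuous_siteSymbol hh a).comp continuous_fst).mul
    ((continuous_siteSymbol hh c).comp continuous_snd)).mul (continuous_stepWeight h M)).mul
    (by fun_prop)

/-- Raising both indices by l multiplies the integrand by exp(-lh(v + w)), so the sum over l is
geometric. The antisymmetrized unit shift supplies the factor exp(-hw) - exp(-hv). -/
theorem seqKernel_siteSeq (s : ℝ) {h : ℝ} (hh : 0 < h) (M j k : ℕ) (a c : Fin 2) :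
    seqKernel M (fun a n => (siteSeq s h a n : ℂ)) j k a c = (1 / 4) * doubleContour 1 1
      (stepIntegrand (siteSymbol h a) (siteSymbol h c) h M (s + j * h) (s + k * h)) := by
  rw [seqKernel, Matrix.of_apply]
  congr 1
  simp_rw [siteSeq_eq s hh, airyTransform_mul_airyTransform, doubleContour_eq]
  have hint : ∀ x y : ℝ, Integrable fun z : ℝ × ℝ =>
      siteSymbol h a ((1 : ℝ) + z.1 * I) * siteSymbol h c ((1 : ℝ) + z.2 * I) *
      exp (-(x : ℂ) * ((1 : ℝ) + z.1 * I) + ((1 : ℝ) + z.1 * I) ^ 3 / 3) *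
      exp (-(y : ℂ) * ((1 : ℝ) + z.2 * I) + ((1 : ℝ) + z.2 * I) ^ 3 / 3) := by
    intro x y
    have h1 := (integrable_airyIntegrand one_pos (continuous_siteSymbol hh a)
      (norm_siteSymbol_le hh a) x).mul_prod (integrable_airyIntegrand one_pos
      (continuous_siteSymbol hh c) (norm_siteSymbol_le hh c) y)
    refine h1.congr (Eventually.of_forall fun z => ?_)
    simp only
    ring
  simp_rw [← mul_sub, ← integral_sub (hint _ _) (hint _ _)]
  rw [← Finset.mul_sum]
  congr 1
  refine (integral_finsetSum _ fun l _ => (hint _ _).sub (hint _ _)).symm.trans ?_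
  congr 1
  ext z
  set v : ℂ := (1 : ℝ) + z.1 * I
  set w : ℂ := (1 : ℝ) + z.2 * I
  have e : ∀ (n l : ℕ) (u : ℂ), exp (-((s + ((l + n : ℕ) : ℝ) * h : ℝ) : ℂ) * u + u ^ 3 / 3) =
      exp (-((s + (n : ℝ) * h : ℝ) : ℂ) * u + u ^ 3 / 3) * exp (-(h * u)) ^ l := by
    intro n l u
    rw [← Complex.exp_nat_mul, ← Complex.exp_add]
    congr 1
    push_cast
    ring
  have e' : exp (-(h * (v + w))) = exp (-(h * v)) * exp (-(h * w)) := by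
    rw [← Complex.exp_add]
    congr 1
    ring
  rw [stepIntegrand, stepWeight, e', Finset.mul_sum, Finset.mul_sum, Finset.sum_mul]
  refine Finset.sum_congr rfl fun l _ => ?_
  simp only [Pi.sub_apply]
  rw [e j l, e k l, e j (l + 1), e k (l + 1), mul_pow, pow_succ, pow_succ]
  simp only [v, w]
  ring

/-- The constant in the bound of the discrete kernels. -/
noncomputable def stepConst : ℝ :=
  3 * Real.exp 1 * ((∫ y, gaussBound 1 1 y) * ∫ y, gaussBound 1 1 y)

theorem stepConst_nonneg : 0 ≤ stepConst := by
  have h1 : 0 ≤ ∫ y, gaussBound 1 1 y := integral_nonneg fun y => (gaussBound_pos _ _ _).le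
  unfold stepConst
  positivity

theorem norm_seqKernel_siteSeq_le (s : ℝ) {h : ℝ} (hh : 0 < h) (hh1 : h ≤ 1) (M j k : ℕ)
    (a c : Fin 2) : ‖seqKernel M (fun a n => (siteSeq s h a n : ℂ)) j k a c‖ ≤
      stepConst * Real.exp (-((s + j * h) + (s + k * h))) := by
  rw [seqKernel_siteSeq s hh, norm_mul]
  have h1 := norm_doubleContour_le one_pos one_pos
    (norm_stepIntegrand_le hh hh1 M a c (s + j * h) (s + k * h))
  have h2 : ‖(1 / 4 : ℂ)‖ ≤ 1 := by norm_num
  refine (mul_le_mul h2 h1 (norm_nonneg _) zero_le_one).trans (le_of_eq ?_)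
  rw [stepConst]
  ring

theorem tendsto_seqKernel {s r r' : ℝ} (hr : s ≤ r) (hr' : s ≤ r') (a c : Fin 2) :
    Tendsto (fun m => seqKernel (meshCells m) (fun a n => (siteSeq s (mesh m) a n : ℂ))
      (cellIndex s (mesh m) r) (cellIndex s (mesh m) r') a c) atTop
      (𝓝 ((1 / 4) * doubleContour 1 1 fun v w =>
        (![fun v => 1 / v, fun _ => 1] : Fin 2 → ℂ → ℂ) a v *
        (![fun v => 1 / v, fun _ => 1] : Fin 2 → ℂ → ℂ) c w * contourWeight r r' v w)) := by
  simp_rw [fun m => seqKernel_siteSeq s (mesh_pos m)]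
  refine Tendsto.const_mul _ ?_
  have hx := tendsto_node hr
  have hy := tendsto_node hr'
  have hev : ∀ᶠ m in atTop, r - 1 ≤ node s (mesh m) r ∧ r' - 1 ≤ node s (mesh m) r' :=
    (hx.eventually (eventually_ge_nhds (by linarith))).and
      (hy.eventually (eventually_ge_nhds (by linarith)))
  refine tendsto_doubleContour one_pos one_pos (κ := 1)
    (C := 3 * Real.exp 1 * Real.exp (-((r - 1) + (r' - 1))))
    (Eventually.of_forall fun m => continuous_stepIntegrand (mesh_pos m) _ a c _ _) ?_ ?_
  · filter_upwards [hev] with m hm t t'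
    refine (norm_stepIntegrand_le (mesh_pos m) (mesh_le_one m) _ a c _ _ t t').trans ?_
    have h1 := (gaussBound_pos 1 1 t).le
    have h2 := (gaussBound_pos 1 1 t').le
    have h3 := hm.1
    have h4 := hm.2
    unfold node at h3 h4
    gcongr
  · intro t t'
    have hw := tendsto_stepWeight (v := (1 : ℝ) + t * I) (w := (1 : ℝ) + t' * I) (by simp) (by simp)
    have he : ∀ {X : ℕ → ℝ} {x : ℝ} (u : ℂ), Tendsto X atTop (𝓝 x) →
        Tendsto (fun m => exp (-(X m : ℂ) * u + u ^ 3 / 3)) atTop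
          (𝓝 (exp (-(x : ℂ) * u + u ^ 3 / 3))) := by
      intro X x u hX
      have hc : Continuous fun x : ℝ => exp (-(x : ℂ) * u + u ^ 3 / 3) := by fun_prop
      exact (hc.tendsto x).comp hX
    have h := (((tendsto_siteSymbol a t).mul (tendsto_siteSymbol c t')).mul hw).mul
      ((he ((1 : ℝ) + t * I) hx).mul (he ((1 : ℝ) + t' * I) hy))
    refine h.trans (le_of_eq ?_)
    congr 1
    rw [contourWeight, ← Complex.exp_add, mul_assoc]
    congr 3
    ring

end StepKernel

/-! ### The discrete determinants converge to the Fredholm Pfaffian of the GSE kernel. -/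

section PfaffianLimit

theorem node_ge_sub_one {s r : ℝ} (m : ℕ) (hr : s ≤ r) : r - 1 ≤ node s (mesh m) r := by
  have := lt_node_add (mesh_pos m) hr
  have := mesh_le_one m
  linarith

theorem exp_node_le {s r r' : ℝ} (m : ℕ) (hr : s ≤ r) (hr' : s ≤ r') :
    Real.exp (-((node s (mesh m) r + node s (mesh m) r') / 2)) ≤
      Real.exp 1 * Real.exp (-((r + r') / 2)) := by
  rw [← Real.exp_add]
  have := node_ge_sub_one m hr
  have := node_ge_sub_one m hr'
  exact Real.exp_le_exp.mpr (by linarith)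

theorem le_node {s h : ℝ} (hh : 0 < h) (r : ℝ) : s ≤ node s h r := by
  unfold node
  have : (0 : ℝ) ≤ cellIndex s h r * h := by positivity
  linarith

theorem doubleContour_quarter {p q p' q' : ℂ → ℂ} (h : ∀ v w, p v * q w = 1 / 4 * (p' v * q' w))
    (r r' : ℝ) : pairEntry p q 1 1 r r' =
      (1 / 4) * doubleContour 1 1 fun v w => p' v * q' w * contourWeight r r' v w := by
  rw [doubleContour_const_mul, pairEntry]
  congr 1
  ext v w
  rw [h]
  ring

theorem pairKernel_apply (r r' : ℝ) (i j : Fin 2) :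
    pairKernel (fun v => 1 / (2 * v)) (fun _ => 1 / 2) 1 1 r r' i j =
      (1 / 4) * doubleContour 1 1 fun v w =>
        (![fun v => 1 / v, fun _ => 1] : Fin 2 → ℂ → ℂ) i v *
        (![fun v => 1 / v, fun _ => 1] : Fin 2 → ℂ → ℂ) j w * contourWeight r r' v w := by
  fin_cases i <;> fin_cases j <;>
    simp only [pairKernel, skewKernel, Matrix.of_apply, Matrix.cons_val', Matrix.cons_val_zero,
      Matrix.cons_val_one, Fin.zero_eta, Fin.mk_one, Matrix.cons_val_fin_one]
  · exact doubleContour_quarter (fun v w => by ring) r r'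
  · exact doubleContour_quarter (q' := fun _ => 1) (fun v w => by ring) r r'
  -- The sign and the transposition in the definition of K₂₁ are exactly undone by the antisymmetry
  -- in (v, w).
  · rw [pairEntry_swap, neg_neg]
    exact doubleContour_quarter (p' := fun _ => 1) (fun v w => by ring) r r'
  · exact doubleContour_quarter (p' := fun _ => 1) (q' := fun _ => 1) (fun v w => by ring) r r'

/-- Each determinant is a finite Pfaffian, hence the Fredholm Pfaffian of a step kernel. That kernel
converges pointwise to the GSE kernel, under a domination uniform in m. -/
theorem tendsto_pfaffian_step (s : ℝ) {a b : ℝ} (ha : 0 < a) (hb : 0 < b) :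
    Tendsto (fun m => (1 - (1 / 2 : ℂ) • (skewShift ℂ (meshCells m) *
      hankelMatrix ℂ (meshCells m) fun n => (airyTail (s + n * mesh m) : ℂ))).det) atTop
      (𝓝 (fredholmPfaffian (cutoff s) (gseKernel a b))) := by
  have hstep : ∀ m, (1 - (1 / 2 : ℂ) • (skewShift ℂ (meshCells m) *
      hankelMatrix ℂ (meshCells m) fun n => (airyTail (s + n * mesh m) : ℂ))).det =
      fredholmPfaffian (stepCutoff s (mesh m) (meshCells m)) fun r r' =>
        seqKernel (meshCells m) (fun a n => (siteSeq s (mesh m) a n : ℂ))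
          (cellIndex s (mesh m) r) (cellIndex s (mesh m) r') := by
    intro m
    have hne : (mesh m : ℂ) ≠ 0 := by exact_mod_cast (mesh_pos m).ne'
    have h1 := pfaffian_blockJ_sub (M := meshCells m)
      (fun n => (siteSeq s (mesh m) 0 n : ℂ)) (fun n => (siteSeq s (mesh m) 1 n : ℂ)) (mesh m)
      (fun k => by
        simp only [siteSeq, Matrix.cons_val_zero, Matrix.cons_val_one]
        rw [show s + ((k + 1 : ℕ) : ℝ) * mesh m = s + k * mesh m + mesh m by push_cast; ring]
        push_cast
        field_simp)
    rw [fredholmPfaffian_step (mesh_pos m), ← siteKernel_eq]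
    exact h1.symm
  simp_rw [hstep]
  rw [gseKernel_eq_one ha hb]
  have hC : 0 ≤ stepConst * Real.exp (-s) * Real.exp 1 :=
    mul_nonneg (mul_nonneg stepConst_nonneg (Real.exp_pos _).le) (Real.exp_pos _).le
  refine fredholmPfaffian_tendsto (expBound_pos hC (1 / 2)) (integrable_exp_weight _ s)
    (Eventually.of_forall fun m => pfaffianDominated_of_le (measurable_stepCutoff s _ _)
      (abs_stepCutoff_le s _ _) (fun i j => measurable_cell_kernel s (mesh m) fun x y =>
        seqKernel (meshCells m) (fun a n => (siteSeq s (mesh m) a n : ℂ)) x y i j) hC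
      fun r r' hr hr' i j => ?_)
    (P := fun _ => True) (Eventually.of_forall fun _ => trivial)
    (fun r _ => tendsto_stepCutoff s r fun m => le_rfl) fun r r' _ _ hr hr' => ?_
  · have h1 := ((stepCutoff_ne_zero_iff _ _).mp hr).1
    have h2 := ((stepCutoff_ne_zero_iff _ _).mp hr').1
    refine (norm_seqKernel_siteSeq_le s (mesh_pos m) (mesh_le_one m) _ _ _ i j).trans ?_
    rw [mul_assoc, mul_assoc]
    refine mul_le_mul_of_nonneg_left ?_ stepConst_nonneg
    refine (exp_neg_add_le (le_node (mesh_pos m) r) (le_node (mesh_pos m) r')).trans ?_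
    exact mul_le_mul_of_nonneg_left (exp_node_le m h1 h2) (Real.exp_pos _).le
  · rw [cutoff_ne_zero_iff] at hr hr'
    refine tendsto_pi_nhds.mpr fun i => tendsto_pi_nhds.mpr fun j => ?_
    refine (tendsto_seqKernel hr hr' i j).trans (le_of_eq ?_)
    exact congrArg 𝓝 (pairKernel_apply r r' i j).symm

end PfaffianLimit

/-! ### The discrete Hankel difference converges to the kernel Ai(x + y - s). -/

section DeterminantLimit

/-- Convergence is asked only for r, r' > s. The point s always lies in the cell of index 0, where
discrete entries are irregular, and a single point is negligible. The matrices have one cell more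
than the mesh count because Hankel matrices have size M + 1. -/
theorem tendsto_det_mesh {A : ℕ → ℕ → ℕ → ℝ} {K : ℝ → ℝ → ℝ} {s C : ℝ} (hC : 0 ≤ C)
    (hb : ∀ m j k, j ≤ meshCells m → k ≤ meshCells m → |A m j k| ≤
      C * Real.exp (-(((s + j * mesh m) + (s + k * mesh m)) / 2)))
    (hlim : ∀ r r', s < r → s < r' → Tendsto
      (fun m => A m (cellIndex s (mesh m) r) (cellIndex s (mesh m) r')) atTop (𝓝 (K r r'))) :
    Tendsto (fun m => (1 - mesh m • Matrix.of fun x y : Fin (meshCells m + 1) => A m x y).det) atTop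
      (𝓝 (fredholmDet (cutoff s) K)) := by
  simp_rw [fun m => (fredholmDet_step (s := s) (mesh_pos m) (meshCells m + 1) (A m)).symm]
  have hC' : 0 ≤ C * Real.exp 1 := by positivity
  refine fredholmDet_tendsto (expBound_pos hC' (1 / 2)) (integrable_exp_weight _ s)
    (Eventually.of_forall fun m => detDominated_of_le (measurable_stepCutoff s _ _)
      (abs_stepCutoff_le s _ _) (measurable_cell_kernel s (mesh m) (A m)) hC'
      fun r r' hr hr' => ?_)
    (P := fun x => x ≠ s) (by simp [ae_iff])
    (fun r _ => tendsto_stepCutoff s r fun m => Nat.le_succ _) fun r r' hne hne' hr hr' => ?_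
  · have h1 := ((stepCutoff_ne_zero_iff _ _).mp hr).1
    have h2 := ((stepCutoff_ne_zero_iff _ _).mp hr').1
    refine (hb m _ _ (Nat.lt_succ_iff.mp (cellIndex_lt (mesh_pos m) hr))
      (Nat.lt_succ_iff.mp (cellIndex_lt (mesh_pos m) hr'))).trans ?_
    rw [mul_assoc]
    exact mul_le_mul_of_nonneg_left (exp_node_le m h1 h2) hC
  · rw [cutoff_ne_zero_iff] at hr hr'
    exact hlim r r' (lt_of_le_of_ne hr (Ne.symm hne)) (lt_of_le_of_ne hr' (Ne.symm hne'))

end DeterminantLimit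

section HankelDiffLimit

/-- The entries of `hankelDiff`, divided by the mesh. -/
noncomputable def diffEntry (s : ℝ) (m j k : ℕ) : ℝ :=
  (1 / 2) * ((if j = meshCells m then airyTail (s + (j + k : ℕ) * mesh m) / mesh m else
    (airyTail (s + (j + k : ℕ) * mesh m) - airyTail (s + (j + k : ℕ) * mesh m + mesh m)) / mesh m) +
    if j = 0 then 0 else (airyTail (s + (j + k : ℕ) * mesh m - mesh m) -
      airyTail (s + (j + k : ℕ) * mesh m - mesh m + mesh m)) / mesh m)

theorem shiftMatrix_mul_apply {R : Type*} [Field R] {M : ℕ}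
    (X : Matrix (Fin (M + 1)) (Fin (M + 1)) R) (i k : Fin (M + 1)) :
    (shiftMatrix R M * X) i k = if h : (i : ℕ) + 1 < M + 1 then X ⟨i + 1, h⟩ k else 0 := by
  rw [Matrix.mul_apply]
  split_ifs with h
  · rw [Finset.sum_eq_single ⟨i + 1, h⟩]
    · simp [shiftMatrix]
    · intro l _ hl
      have : ¬ ((i : ℕ) + 1 = l) := fun h0 => hl (Fin.ext h0.symm)
      simp [shiftMatrix, this]
    · simp
  · refine Finset.sum_eq_zero fun l _ => ?_
    have : ¬ ((i : ℕ) + 1 = l) := by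
      have := l.2
      omega
    simp [shiftMatrix, this]

theorem shiftMatrix_transpose_mul_apply {R : Type*} [Field R] {M : ℕ}
    (X : Matrix (Fin (M + 1)) (Fin (M + 1)) R) (i k : Fin (M + 1)) :
    ((shiftMatrix R M).transpose * X) i k =
      if h : (i : ℕ) = 0 then 0 else X ⟨i - 1, by omega⟩ k := by
  rw [Matrix.mul_apply]
  split_ifs with h
  · refine Finset.sum_eq_zero fun l _ => ?_
    have : ¬ ((l : ℕ) + 1 = i) := by omega
    simp [shiftMatrix, this]
  · rw [Finset.sum_eq_single ⟨i - 1, by omega⟩]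
    · have : (i : ℕ) - 1 + 1 = i := by omega
      simp [shiftMatrix, this]
    · intro l _ hl
      have : ¬ ((l : ℕ) + 1 = i) := fun h0 => hl (Fin.ext (by simp; omega))
      simp [shiftMatrix, this]
    · simp

/-- Row j averages the forward differences at j and j - 1. The two ends are special: row 0 has no
predecessor, and the last row has no successor, so the tail itself is left over, divided by the
mesh. -/
theorem hankelDiff_eq (s : ℝ) (m : ℕ) :
    hankelDiff ℝ (meshCells m) (fun n => airyTail (s + n * mesh m)) =
      mesh m • Matrix.of fun j k : Fin (meshCells m + 1) => diffEntry s m j k := by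
  have hne := (mesh_pos m).ne'
  have hD : ∀ j k : Fin (meshCells m + 1), ((1 - shiftMatrix ℝ (meshCells m)) *
      hankelMatrix ℝ (meshCells m) fun n => airyTail (s + n * mesh m)) j k =
      if (j : ℕ) = meshCells m then airyTail (s + ((j : ℕ) + k : ℕ) * mesh m) else
        airyTail (s + ((j : ℕ) + k : ℕ) * mesh m) -
          airyTail (s + ((j : ℕ) + k : ℕ) * mesh m + mesh m) := by
    intro j k
    have hj := j.2
    rw [sub_mul, one_mul, Matrix.sub_apply, shiftMatrix_mul_apply]
    by_cases h : (j : ℕ) = meshCells m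
    · rw [if_pos h, dif_neg (by omega), sub_zero]
      rfl
    · rw [if_neg h, dif_pos (by omega)]
      simp only [hankelMatrix, Matrix.of_apply]
      congr 2
      push_cast
      ring
  ext j k
  have hj := j.2
  rw [hankelDiff, Matrix.smul_apply, mul_assoc, add_mul, one_mul, Matrix.add_apply,
    shiftMatrix_transpose_mul_apply, hD, Matrix.smul_apply, Matrix.of_apply, diffEntry]
  simp only [hD, smul_eq_mul]
  by_cases h0 : (j : ℕ) = 0
  · rw [dif_pos h0, if_pos h0]
    split_ifs <;>
      · field_simp
        ring
  · rw [dif_neg h0, if_neg h0]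
    have h1 : ¬ ((j : ℕ) - 1 = meshCells m) := by omega
    have h2 : s + (((j : ℕ) - 1 + k : ℕ) : ℝ) * mesh m =
        s + ((j : ℕ) + k : ℕ) * mesh m - mesh m := by
      have : ((j : ℕ) + k : ℕ) = ((j : ℕ) - 1 + k) + 1 := by omega
      rw [this]
      push_cast
      ring
    rw [if_neg h1, h2]
    split_ifs <;> field_simp

theorem exp_neg_sub_le {s x y : ℝ} (hx : s ≤ x) (hy : s ≤ y) :
    Real.exp (-(x + y - s)) ≤ Real.exp (-((x + y) / 2)) :=
  Real.exp_le_exp.mpr (by linarith)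

/-- The interior is controlled by the bound on difference quotients. In the last row, 1/h = m + 1 is
offset because the node is at s + m + 1, which frees a factor exp(-(m + 1)/2). The two halves have
the constants 2 and 4, with average 3. -/
theorem abs_diffEntry_le (s : ℝ) (m j k : ℕ) : |diffEntry s m j k| ≤
    3 * airyBound * Real.exp (-(((s + j * mesh m) + (s + k * mesh m)) / 2)) := by
  have hh := mesh_pos m
  have hh1 := mesh_le_one m
  have hA := airyBound_nonneg
  set x := s + j * mesh m with hx
  set y := s + k * mesh m with hy
  have hxs : s ≤ x := by
    have : (0 : ℝ) ≤ j * mesh m := by positivity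
    linarith
  have hys : s ≤ y := by
    have : (0 : ℝ) ≤ k * mesh m := by positivity
    linarith
  have hX : s + (j + k : ℕ) * mesh m = x + y - s := by
    rw [hx, hy]
    push_cast
    ring
  rw [diffEntry, hX]
  set E := Real.exp (-((x + y) / 2)) with hE
  have hE0 : 0 < E := Real.exp_pos _
  have h1 : |if j = meshCells m then airyTail (x + y - s) / mesh m else
      (airyTail (x + y - s) - airyTail (x + y - s + mesh m)) / mesh m| ≤ 2 * (airyBound * E) := by
    split_ifs with hj
    · have e1 : x = s + (m + 1) := by rw [hx, hj, meshCells_mul_mesh]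
      have e2 : Real.exp (-(x + y - s)) ≤ E * Real.exp (-(((m : ℝ) + 1) / 2)) := by
        rw [hE, ← Real.exp_add]
        exact Real.exp_le_exp.mpr (by linarith)
      have e3 : ((m : ℝ) + 1) * Real.exp (-(((m : ℝ) + 1) / 2)) ≤ 2 := by
        have := Real.add_one_le_exp (((m : ℝ) + 1) / 2)
        rw [Real.exp_neg, ← div_eq_mul_inv, div_le_iff₀ (Real.exp_pos _)]
        linarith
      have e4 : airyTail (x + y - s) / mesh m = airyTail (x + y - s) * (m + 1) := by
        rw [mesh]
        field_simp
      have hm : (0 : ℝ) < (m : ℝ) + 1 := by positivity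
      rw [e4, abs_mul, abs_of_pos hm]
      calc |airyTail (x + y - s)| * (m + 1)
          ≤ airyBound * (E * Real.exp (-(((m : ℝ) + 1) / 2))) * (m + 1) := by
            refine mul_le_mul_of_nonneg_right ((abs_airyTail_le _).trans ?_) hm.le
            gcongr
        _ = airyBound * E * (((m : ℝ) + 1) * Real.exp (-(((m : ℝ) + 1) / 2))) := by ring
        _ ≤ airyBound * E * 2 := by gcongr
        _ = _ := by ring
    · refine (abs_airyTail_diff_le hh _).trans ?_
      have := mul_le_mul_of_nonneg_left (exp_neg_sub_le hxs hys) hA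
      have : 0 ≤ airyBound * E := by positivity
      linarith
  have h2 : |if j = 0 then 0 else (airyTail (x + y - s - mesh m) -
      airyTail (x + y - s - mesh m + mesh m)) / mesh m| ≤ 4 * (airyBound * E) := by
    have h0 : 0 ≤ airyBound * E := by positivity
    split_ifs
    · rw [abs_zero]
      linarith
    · refine (abs_airyTail_diff_le hh _).trans ?_
      have e1 : Real.exp (-(x + y - s - mesh m)) ≤ 4 * E := by
        have e2 : Real.exp (-(x + y - s - mesh m)) ≤ Real.exp 1 * E := by
          rw [hE, ← Real.exp_add]
          exact Real.exp_le_exp.mpr (by linarith)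
        have := Real.exp_one_lt_d9
        nlinarith
      have := mul_le_mul_of_nonneg_left e1 hA
      linarith
  rw [abs_mul, abs_of_pos (by norm_num : (0 : ℝ) < 1 / 2)]
  have := (abs_add_le _ _).trans (add_le_add h1 h2)
  linarith

/-- For fixed r > s the index of its cell is eventually neither the first nor the last, so both
terms are genuine difference quotients of the tail near r + y - s. -/
theorem tendsto_diffEntry {s r y : ℝ} (hr : s < r) {k : ℕ → ℕ}
    (hk : Tendsto (fun m => s + k m * mesh m) atTop (𝓝 y)) :
    Tendsto (fun m => diffEntry s m (cellIndex s (mesh m) r) (k m)) atTop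
      (𝓝 (airyAi (r + y - s))) := by
  have hX : Tendsto (fun m => s + (cellIndex s (mesh m) r + k m : ℕ) * mesh m) atTop
      (𝓝 (r + y - s)) := by
    refine (((tendsto_node hr.le).add hk).sub_const s).congr fun m => ?_
    rw [node]
    push_cast
    ring
  have h1 := tendsto_airyTail_diff tendsto_mesh hX
  have hX' := hX.sub tendsto_mesh_zero
  rw [sub_zero] at hX'
  have h2 := tendsto_airyTail_diff tendsto_mesh hX'
  have h3 := (h1.add h2).const_mul (1 / 2)
  rw [show 1 / 2 * (airyAi (r + y - s) + airyAi (r + y - s)) = airyAi (r + y - s) by ring] at h3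
  refine h3.congr' ?_
  have hn0 : ∀ᶠ m in atTop, s < node s (mesh m) r :=
    (tendsto_node hr.le).eventually (eventually_gt_nhds hr)
  have hn1 : ∀ᶠ m : ℕ in atTop, r - s < (m : ℝ) + 1 :=
    (tendsto_atTop_add_const_right _ 1 tendsto_natCast_atTop_atTop).eventually_gt_atTop (r - s)
  filter_upwards [hn0, hn1] with m h0 h1
  have e0 : cellIndex s (mesh m) r ≠ 0 := by
    intro h
    rw [node, h] at h0
    simp at h0
  have e1 : cellIndex s (mesh m) r ≠ meshCells m := by
    intro h
    have := node_le (mesh_pos m) hr.le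
    rw [node, h, meshCells_mul_mesh] at this
    linarith
  rw [diffEntry, if_neg e0, if_neg e1]

theorem tendsto_det_hankelDiff (s ε : ℝ) (hε : |ε| = 1) :
    Tendsto (fun m => (1 - ε • hankelDiff ℝ (meshCells m) (fun n => airyTail (s + n * mesh m))).det)
      atTop (𝓝 (fredholmDet (cutoff s) fun r r' => ε * airyAi (r + r' - s))) := by
  have h := tendsto_det_mesh (s := s) (A := fun m j k => ε * diffEntry s m j k)
    (K := fun r r' => ε * airyAi (r + r' - s)) (C := 3 * airyBound)
    (mul_nonneg (by norm_num) airyBound_nonneg)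
    (fun m j k _ _ => by
      rw [abs_mul, hε, one_mul]
      exact abs_diffEntry_le s m j k)
    (fun r r' hr hr' => (tendsto_diffEntry hr (tendsto_node hr'.le)).const_mul ε)
  refine h.congr fun m => ?_
  rw [hankelDiff_eq, smul_comm]
  rfl

end HankelDiffLimit

/-! ### The discrete product T(T - EH/2) converges to the scalar kernel. -/

section GldLimit

/-- The entries of the discrete form of the scalar kernel. -/
noncomputable def gldEntry (s : ℝ) (m j k : ℕ) : ℝ :=
  mesh m * ∑ l ∈ Finset.range (meshCells m + 1), diffEntry s m j l * diffEntry s m l k -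
    (1 / 2) * diffEntry s m j 0 * airyTail (s + k * mesh m)

theorem hankelDiff_mul_eq (s : ℝ) (m : ℕ) :
    hankelDiff ℝ (meshCells m) (fun n => airyTail (s + n * mesh m)) *
      (hankelDiff ℝ (meshCells m) (fun n => airyTail (s + n * mesh m)) - (1 / 2 : ℝ) •
        (cornerMatrix ℝ (meshCells m) *
          hankelMatrix ℝ (meshCells m) fun n => airyTail (s + n * mesh m))) =
      mesh m • Matrix.of fun j k : Fin (meshCells m + 1) => gldEntry s m j k := by
  have hc : ∀ l k, (cornerMatrix ℝ (meshCells m) *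
      hankelMatrix ℝ (meshCells m) fun n => airyTail (s + n * mesh m)) l k =
      if l = 0 then airyTail (s + (k : ℕ) * mesh m) else 0 := by
    intro l k
    rw [Matrix.mul_apply, Finset.sum_eq_single 0]
    · by_cases hl : l = 0 <;> simp [cornerMatrix, hankelMatrix, hl]
    · intro i _ hi
      simp [cornerMatrix, hi]
    · simp
  ext j k
  rw [hankelDiff_eq, Matrix.mul_apply, Matrix.smul_apply, Matrix.of_apply, gldEntry,
    Finset.sum_range]
  simp only [Matrix.sub_apply, Matrix.smul_apply, Matrix.of_apply, hc, smul_eq_mul, mul_sub]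
  rw [Finset.sum_sub_distrib]
  congr 1
  · rw [Finset.mul_sum, Finset.mul_sum]
    exact Finset.sum_congr rfl fun l _ => by ring
  · rw [Finset.sum_eq_single 0]
    · simp only [if_true, Fin.val_zero]
      ring
    · intro l _ hl
      simp [hl]
    · simp

theorem integral_stepCutoff_mul {s h : ℝ} (hh : 0 < h) (M : ℕ) (g : ℕ → ℝ) :
    ∫ u, stepCutoff s h M u * g (cellIndex s h u) = h * ∑ l ∈ Finset.range M, g l := by
  have e : ∀ u, stepCutoff s h M u * g (cellIndex s h u) =
      ∑ l ∈ Finset.range M, (cell s h l).indicator (fun _ => g l) u := by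
    intro u
    rw [stepCutoff_eq_sum hh, Finset.sum_range, Finset.sum_mul]
    refine Finset.sum_congr rfl fun l _ => ?_
    by_cases hu : u ∈ cell s h l
    · rw [Set.indicator_of_mem hu, Set.indicator_of_mem hu, ((mem_cell_iff hh l u).mp hu).2]
      simp
    · rw [Set.indicator_of_notMem hu, Set.indicator_of_notMem hu, zero_mul]
  have hm : ∀ l : ℕ, MeasurableSet (cell s h l) := fun l => measurableSet_Ico
  have hv : ∀ l : ℕ, volume (cell s h l) = ENNReal.ofReal h := by
    intro l
    rw [cell, Real.volume_Ico]
    congr 1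
    ring
  simp_rw [e]
  rw [integral_finsetSum, Finset.mul_sum]
  · refine Finset.sum_congr rfl fun l _ => ?_
    rw [integral_indicator_const _ (hm l), Measure.real, hv, ENNReal.toReal_ofReal hh.le,
      smul_eq_mul]
  · intro l _
    exact (integrable_indicator_iff (hm l)).mpr (integrableOn_const (by simp [hv]))

/-- The sum over l is geometric with ratio exp(-h), hence at most 2/h, and the mesh in front cancels
it: 9 · 2 = 18 for the product and 2 for the rank-one term, within 30. -/
theorem abs_gldEntry_le (s : ℝ) (m j k : ℕ) : |gldEntry s m j k| ≤
    (30 * airyBound ^ 2 * Real.exp (-s)) *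
      Real.exp (-(((s + j * mesh m) + (s + k * mesh m)) / 2)) := by
  have hh := mesh_pos m
  have hh1 := mesh_le_one m
  have hA := airyBound_nonneg
  set x := s + j * mesh m with hx
  set y := s + k * mesh m with hy
  have hys : s ≤ y := by
    have : (0 : ℝ) ≤ k * mesh m := by positivity
    linarith
  set E := Real.exp (-((x + y) / 2)) with hE
  have hE0 : 0 < E := Real.exp_pos _
  have h1 : |mesh m * ∑ l ∈ Finset.range (meshCells m + 1),
      diffEntry s m j l * diffEntry s m l k| ≤ 18 * airyBound ^ 2 * Real.exp (-s) * E := by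
    have e1 : ∀ l : ℕ, |diffEntry s m j l * diffEntry s m l k| ≤
        9 * airyBound ^ 2 * E * Real.exp (-s) * Real.exp (-mesh m) ^ l := by
      intro l
      rw [abs_mul]
      refine (mul_le_mul (abs_diffEntry_le s m j l) (abs_diffEntry_le s m l k) (abs_nonneg _)
        (by positivity)).trans (le_of_eq ?_)
      have e : Real.exp (-(((s + j * mesh m) + (s + l * mesh m)) / 2)) *
          Real.exp (-(((s + l * mesh m) + (s + k * mesh m)) / 2)) =
          E * Real.exp (-s) * Real.exp (-mesh m) ^ l := by
        rw [← Real.exp_nat_mul, hE, ← Real.exp_add, ← Real.exp_add, ← Real.exp_add, hx, hy]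
        congr 1
        ring
      rw [mul_mul_mul_comm, e]
      ring
    have e2 : Real.exp (-mesh m) ≤ 1 - mesh m / 2 := by
      have h1 : 1 + mesh m ≤ Real.exp (mesh m) := by linarith [Real.add_one_le_exp (mesh m)]
      rw [Real.exp_neg, inv_le_comm₀ (Real.exp_pos _) (by linarith)]
      refine le_trans ?_ h1
      rw [inv_eq_one_div, div_le_iff₀ (by linarith)]
      nlinarith
    have e3 : ∑ l ∈ Finset.range (meshCells m + 1), Real.exp (-mesh m) ^ l ≤ 1 / (mesh m / 2) := by
      have hs := (summable_geometric_of_lt_one (Real.exp_pos (-mesh m)).le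
        (by linarith)).sum_le_tsum (Finset.range (meshCells m + 1))
        (fun i _ => pow_nonneg (Real.exp_pos _).le i)
      rw [tsum_geometric_of_lt_one (Real.exp_pos _).le (by linarith), inv_eq_one_div] at hs
      exact hs.trans (one_div_le_one_div_of_le (by linarith) (by linarith))
    rw [abs_mul, abs_of_pos hh]
    calc mesh m * |∑ l ∈ Finset.range (meshCells m + 1), diffEntry s m j l * diffEntry s m l k|
        ≤ mesh m * ∑ l ∈ Finset.range (meshCells m + 1),
            9 * airyBound ^ 2 * E * Real.exp (-s) * Real.exp (-mesh m) ^ l := by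
          gcongr
          exact (Finset.abs_sum_le_sum_abs _ _).trans (Finset.sum_le_sum fun l _ => e1 l)
      _ ≤ mesh m * (9 * airyBound ^ 2 * E * Real.exp (-s) * (1 / (mesh m / 2))) := by
          rw [← Finset.mul_sum]
          gcongr
      _ = _ := by
          field_simp
          ring
  have h2 : |(1 / 2) * diffEntry s m j 0 * airyTail y| ≤
      2 * airyBound ^ 2 * Real.exp (-s) * E := by
    rw [abs_mul, abs_mul, abs_of_pos (by norm_num : (0 : ℝ) < 1 / 2)]
    have e1 := abs_diffEntry_le s m j 0
    have e2 := abs_airyTail_le y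
    rw [Nat.cast_zero, zero_mul, add_zero] at e1
    have e3 : Real.exp (-((x + s) / 2)) * Real.exp (-y) ≤ Real.exp (-s) * E := by
      rw [hE, ← Real.exp_add, ← Real.exp_add]
      exact Real.exp_le_exp.mpr (by linarith)
    calc 1 / 2 * |diffEntry s m j 0| * |airyTail y|
        ≤ 1 / 2 * (3 * airyBound * Real.exp (-((x + s) / 2))) * (airyBound * Real.exp (-y)) := by
          gcongr
      _ = 3 / 2 * airyBound ^ 2 * (Real.exp (-((x + s) / 2)) * Real.exp (-y)) := by ring
      _ ≤ 3 / 2 * airyBound ^ 2 * (Real.exp (-s) * E) := by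
          exact mul_le_mul_of_nonneg_left e3 (by positivity)
      _ ≤ _ := by
          have : 0 ≤ airyBound ^ 2 * (Real.exp (-s) * E) := by positivity
          nlinarith
  rw [gldEntry]
  refine (abs_sub _ _).trans ((add_le_add h1 h2).trans ?_)
  have : 0 ≤ airyBound ^ 2 * Real.exp (-s) * E := by positivity
  nlinarith

/-- Translating the variable by s exhibits the Airy kernel as the square of the operator on [s, ∞)
with kernel Ai(x + y - s), the limit of T. -/
theorem airyKernel_eq_shift (s r r' : ℝ) : airyKernel r r' =
    ∫ u, cutoff s u * (airyAi (r + u - s) * airyAi (u + r' - s)) := by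
  have h1 : airyKernel r r' = ∫ u, (Set.Ioi (0 : ℝ)).indicator
      (fun u => airyAi (r + u) * airyAi (r' + u)) u := by
    rw [integral_indicator measurableSet_Ioi]
    rfl
  rw [h1, ← integral_sub_right_eq_self _ s]
  refine integral_congr_ae ?_
  have hne : ∀ᵐ u : ℝ, u ≠ s := by simp [ae_iff]
  filter_upwards [hne] with u hu
  by_cases h : s < u
  · rw [Set.indicator_of_mem (by simpa using h), cutoff, Set.indicator_of_mem (Set.mem_Ici.mpr h.le),
      Pi.one_apply, one_mul]
    congr 2 <;> ring
  · have h' : ¬ s ≤ u := fun h0 => h (lt_of_le_of_ne h0 (Ne.symm hu))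
    rw [Set.indicator_of_notMem (by simpa using h), cutoff, Set.indicator_of_notMem (by simpa using h'),
      zero_mul]

/-- The matrix product is a Riemann sum, written as the integral of a step function so that
dominated convergence applies. The corner term samples T at column 0, the point s, where its kernel
is Ai(r). -/
theorem tendsto_gldEntry {s r r' : ℝ} (hr : s < r) (hr' : s < r') :
    Tendsto (fun m => gldEntry s m (cellIndex s (mesh m) r) (cellIndex s (mesh m) r')) atTop
      (𝓝 (gldKernel r r')) := by
  rw [gldKernel_eq]
  have h0 : Tendsto (fun m => diffEntry s m (cellIndex s (mesh m) r) 0) atTop (𝓝 (airyAi r)) := by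
    have := tendsto_diffEntry (k := fun _ => 0) (y := s) hr (by simp)
    rwa [show r + s - s = r by ring] at this
  have h1 : Tendsto (fun m => airyTail (s + cellIndex s (mesh m) r' * mesh m)) atTop
      (𝓝 (airyTail r')) := (continuous_airyTail.tendsto r').comp (tendsto_node hr'.le)
  refine Tendsto.sub ?_ ((h0.const_mul (1 / 2)).mul h1)
  rw [airyKernel_eq_shift s]
  simp_rw [fun m j k => (integral_stepCutoff_mul (s := s) (mesh_pos m) (meshCells m + 1)
    fun l => diffEntry s m j l * diffEntry s m l k).symm]
  have hA := airyBound_nonneg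
  refine tendsto_integral_filter_of_dominated_convergence
    (fun u => 9 * airyBound ^ 2 * Real.exp 2 * Real.exp (-((r + r') / 2)) *
      (Real.exp (-(1 * s)) * Real.exp (-(1 * |u - s|)))) ?_ ?_ ?_ ?_
  · refine Eventually.of_forall fun m => Measurable.aestronglyMeasurable ?_
    refine (measurable_stepCutoff _ _ _).mul ?_
    exact (measurable_of_countable fun l : ℕ => diffEntry s m (cellIndex s (mesh m) r) l *
      diffEntry s m l (cellIndex s (mesh m) r')).comp (measurable_cellIndex s (mesh m))
  · refine Eventually.of_forall fun m => Eventually.of_forall fun u => ?_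
    by_cases hu : s ≤ u
    · have e1 := abs_diffEntry_le s m (cellIndex s (mesh m) r) (cellIndex s (mesh m) u)
      have e2 := abs_diffEntry_le s m (cellIndex s (mesh m) u) (cellIndex s (mesh m) r')
      have e3 : Real.exp (-(((s + cellIndex s (mesh m) r * mesh m) +
          (s + cellIndex s (mesh m) u * mesh m)) / 2)) ≤ Real.exp 1 * Real.exp (-((r + u) / 2)) :=
        exp_node_le m hr.le hu
      have e4 : Real.exp (-(((s + cellIndex s (mesh m) u * mesh m) +
          (s + cellIndex s (mesh m) r' * mesh m)) / 2)) ≤ Real.exp 1 * Real.exp (-((u + r') / 2)) :=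
        exp_node_le m hu hr'.le
      rw [norm_mul, norm_mul, Real.norm_eq_abs, Real.norm_eq_abs, Real.norm_eq_abs]
      have e5 : |stepCutoff s (mesh m) (meshCells m + 1) u| ≤ 1 := by
        refine (abs_stepCutoff_le s _ _ u).trans ?_
        rw [cutoff, Set.indicator_of_mem (Set.mem_Ici.mpr hu), Pi.one_apply]
      calc _ ≤ 1 * ((3 * airyBound * (Real.exp 1 * Real.exp (-((r + u) / 2)))) *
            (3 * airyBound * (Real.exp 1 * Real.exp (-((u + r') / 2))))) := by
            gcongr
            · exact e1.trans (by gcongr)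
            · exact e2.trans (by gcongr)
        _ = 9 * airyBound ^ 2 * (Real.exp 1 * Real.exp (-((r + u) / 2)) *
            Real.exp 1 * Real.exp (-((u + r') / 2))) := by ring
        _ = _ := by
            rw [← Real.exp_add, ← Real.exp_add, ← Real.exp_add, mul_assoc (9 * airyBound ^ 2),
              mul_assoc (9 * airyBound ^ 2), ← Real.exp_add, ← Real.exp_add, ← Real.exp_add,
              abs_of_nonneg (by linarith)]
            congr 2
            ring
    · have : stepCutoff s (mesh m) (meshCells m + 1) u = 0 := by
        by_contra h
        exact hu ((stepCutoff_ne_zero_iff _ _).mp h).1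
      rw [this, zero_mul, norm_zero]
      positivity
  · exact ((integrable_exp_neg_mul_abs_sub s one_pos).const_mul _).const_mul _
  · have hne : ∀ᵐ u : ℝ, u ≠ s := by simp [ae_iff]
    filter_upwards [hne] with u hu
    have hcut := tendsto_stepCutoff s u (N := fun m => meshCells m + 1) fun m => Nat.le_succ _
    by_cases h : s < u
    · exact hcut.mul ((tendsto_diffEntry hr (tendsto_node h.le)).mul
        (tendsto_diffEntry h (tendsto_node hr'.le)))
    · have h' : ¬ s ≤ u := fun h0 => h (lt_of_le_of_ne h0 (Ne.symm hu))
      have e1 : cutoff s u = 0 := Set.indicator_of_notMem (by simpa using h') _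
      have e2 : ∀ m, stepCutoff s (mesh m) (meshCells m + 1) u = 0 := fun m =>
        Set.indicator_of_notMem (by simp [h']) _
      simp only [e1, e2, zero_mul]
      exact tendsto_const_nhds

theorem tendsto_det_gld (s : ℝ) :
    Tendsto (fun m => (1 - hankelDiff ℝ (meshCells m) (fun n => airyTail (s + n * mesh m)) *
      (hankelDiff ℝ (meshCells m) (fun n => airyTail (s + n * mesh m)) - (1 / 2 : ℝ) •
        (cornerMatrix ℝ (meshCells m) *
          hankelMatrix ℝ (meshCells m) fun n => airyTail (s + n * mesh m)))).det)
      atTop (𝓝 (fredholmDet (cutoff s) gldKernel)) := by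
  simp_rw [hankelDiff_mul_eq]
  exact tendsto_det_mesh (A := gldEntry s) (by positivity) (fun m j k _ _ => abs_gldEntry_le s m j k)
    fun r r' hr hr' => tendsto_gldEntry hr hr'

end GldLimit

/-! ### Gaussian quadratic forms and the Schur test. -/

section GaussianForms

theorem integrable_gaussian_mul_cos {a : ℝ} (ha : 0 < a) (t : ℝ) :
    Integrable fun y : ℝ => Real.exp (-a * y ^ 2) * Real.cos (t * y) := by
  refine (integrable_exp_neg_mul_sq ha).mono' (Continuous.aestronglyMeasurable (by fun_prop))
    (Eventually.of_forall fun y => ?_)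
  rw [norm_mul, Real.norm_of_nonneg (Real.exp_pos _).le]
  exact mul_le_of_le_one_right (Real.exp_pos _).le (Real.abs_cos_le_one _)

theorem integral_gaussian_mul_cos {a : ℝ} (ha : 0 < a) (t : ℝ) :
    ∫ y : ℝ, Real.exp (-a * y ^ 2) * Real.cos (t * y) =
      √(Real.pi / a) * Real.exp (-t ^ 2 / (4 * a)) := by
  have h := fourierIntegral_gaussian (b := a) (by simpa using ha) t
  have hnorm : ∀ y : ℝ, ‖exp (I * t * y) * exp (-(a : ℂ) * y ^ 2)‖ = Real.exp (-a * y ^ 2) := by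
    intro y
    rw [norm_mul, show I * (t : ℂ) * y = ((t * y : ℝ) : ℂ) * I by push_cast; ring,
      Complex.norm_exp_ofReal_mul_I, one_mul,
      show -(a : ℂ) * (y : ℂ) ^ 2 = ((-a * y ^ 2 : ℝ) : ℂ) by push_cast; ring,
      ← Complex.ofReal_exp, Complex.norm_real, Real.norm_of_nonneg (Real.exp_pos _).le]
  have hint : Integrable fun y : ℝ => exp (I * t * y) * exp (-(a : ℂ) * y ^ 2) :=
    (integrable_exp_neg_mul_sq ha).mono' (Continuous.aestronglyMeasurable (by fun_prop))
      (Eventually.of_forall fun y => (hnorm y).le)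
  have h2 := congrArg Complex.re h
  have h3 := Complex.reCLM.integral_comp_comm hint
  simp only [Complex.reCLM_apply] at h3
  rw [← h3] at h2
  have h4 : ((Real.pi : ℂ) / a) ^ (1 / 2 : ℂ) * exp (-(t : ℂ) ^ 2 / (4 * a)) =
      ((√(Real.pi / a) * Real.exp (-t ^ 2 / (4 * a)) : ℝ) : ℂ) := by
    rw [Real.sqrt_eq_rpow]
    push_cast [Complex.ofReal_cpow (div_pos Real.pi_pos ha).le]
    rfl
  rw [h4, Complex.ofReal_re] at h2
  rw [← h2]
  congr 1
  ext y
  rw [show I * (t : ℂ) * y = ((t * y : ℝ) : ℂ) * I by push_cast; ring,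
    show -(a : ℂ) * (y : ℂ) ^ 2 = ((-a * y ^ 2 : ℝ) : ℂ) by push_cast; ring,
    ← Complex.ofReal_exp, mul_comm (exp _), Complex.re_ofReal_mul, Complex.exp_ofReal_mul_I_re]

theorem norm_sq_exp_sum {n : ℕ} (u θ : Fin n → ℝ) (y : ℝ) :
    ‖∑ j, (u j : ℂ) * exp (((θ j * y : ℝ) : ℂ) * I)‖ ^ 2 =
      ∑ j, ∑ k, u j * u k * Real.cos ((θ j - θ k) * y) := by
  rw [Complex.sq_norm, Complex.normSq_apply]
  simp only [Complex.re_sum, Complex.im_sum, Complex.re_ofReal_mul, Complex.im_ofReal_mul,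
    Complex.exp_ofReal_mul_I_re, Complex.exp_ofReal_mul_I_im]
  rw [Finset.sum_mul_sum, Finset.sum_mul_sum, ← Finset.sum_add_distrib]
  refine Finset.sum_congr rfl fun j _ => ?_
  rw [← Finset.sum_add_distrib]
  refine Finset.sum_congr rfl fun k _ => ?_
  rw [sub_mul, Real.cos_sub]
  ring

theorem integrable_gaussian_mul_norm_sq {a : ℝ} (ha : 0 < a) {n : ℕ} (u θ : Fin n → ℝ) :
    Integrable fun y : ℝ => Real.exp (-a * y ^ 2) *
      ‖∑ j, (u j : ℂ) * exp (((θ j * y : ℝ) : ℂ) * I)‖ ^ 2 := by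
  simp_rw [norm_sq_exp_sum, Finset.mul_sum]
  refine integrable_finsetSum _ fun j _ => integrable_finsetSum _ fun k _ => ?_
  refine ((integrable_gaussian_mul_cos ha (θ j - θ k)).const_mul (u j * u k)).congr
    (Eventually.of_forall fun y => ?_)
  simp only
  ring

theorem integral_gaussian_mul_norm_sq {a : ℝ} (ha : 0 < a) {n : ℕ} (u θ : Fin n → ℝ) :
    ∫ y : ℝ, Real.exp (-a * y ^ 2) * ‖∑ j, (u j : ℂ) * exp (((θ j * y : ℝ) : ℂ) * I)‖ ^ 2 =
      √(Real.pi / a) * ∑ j, ∑ k, u j * u k * Real.exp (-(θ j - θ k) ^ 2 / (4 * a)) := by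
  have hint : ∀ j k, Integrable fun y : ℝ =>
      u j * u k * (Real.exp (-a * y ^ 2) * Real.cos ((θ j - θ k) * y)) := fun j k =>
    (integrable_gaussian_mul_cos ha (θ j - θ k)).const_mul (u j * u k)
  have e : ∀ y : ℝ, Real.exp (-a * y ^ 2) *
      ‖∑ j, (u j : ℂ) * exp (((θ j * y : ℝ) : ℂ) * I)‖ ^ 2 =
      ∑ j, ∑ k, u j * u k * (Real.exp (-a * y ^ 2) * Real.cos ((θ j - θ k) * y)) := by
    intro y
    rw [norm_sq_exp_sum, Finset.mul_sum]
    refine Finset.sum_congr rfl fun j _ => ?_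
    rw [Finset.mul_sum]
    exact Finset.sum_congr rfl fun k _ => by ring
  simp_rw [e]
  rw [integral_finsetSum _ fun j _ => integrable_finsetSum _ fun k _ => hint j k, Finset.mul_sum]
  refine Finset.sum_congr rfl fun j _ => ?_
  rw [integral_finsetSum _ fun k _ => hint j k, Finset.mul_sum]
  refine Finset.sum_congr rfl fun k _ => ?_
  rw [integral_const_mul, integral_gaussian_mul_cos ha]
  ring

theorem sum_gaussian_le {β : ℝ} (hβ : 0 < β) (t : ℕ) :
    ∑ i ∈ Finset.range t, Real.exp (-β * ((i + 1 : ℕ) : ℝ) ^ 2) ≤ √(Real.pi / β) / 2 := by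
  have hanti : AntitoneOn (fun x : ℝ => Real.exp (-β * x ^ 2)) (Set.Icc 0 (0 + t)) := by
    intro x hx y _ hxy
    have := hx.1
    simp only [neg_mul]
    gcongr
  have h := hanti.sum_le_integral
  simp only [zero_add] at h
  refine h.trans ?_
  rw [← integral_gaussian_Ioi, intervalIntegral.integral_of_le (Nat.cast_nonneg t)]
  exact setIntegral_mono_set (integrable_exp_neg_mul_sq hβ).integrableOn
    (Eventually.of_forall fun x => (Real.exp_pos _).le) Set.Ioc_subset_Ioi_self.eventuallyLE

/-- The diagonal contributes 1, and each side of it at most half of the full Gaussian integral, by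
comparison of a decreasing sum with its integral. -/
theorem sum_gaussian_row_le {β : ℝ} (hβ : 0 < β) {n : ℕ} (j : Fin n) :
    ∑ k : Fin n, Real.exp (-β * (((j : ℕ) : ℝ) - ((k : ℕ) : ℝ)) ^ 2) ≤ 1 + √(Real.pi / β) := by
  obtain ⟨t, ht⟩ : ∃ t, n = (j : ℕ) + 1 + t := ⟨n - (j + 1), by have := j.2; omega⟩
  obtain ⟨i, hi⟩ := j
  simp only at ht ⊢
  rw [← Finset.sum_range fun k : ℕ => Real.exp (-β * ((i : ℝ) - (k : ℝ)) ^ 2), ht,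
    Finset.sum_range_add, ← Finset.sum_range_reflect, Finset.sum_range_succ']
  have h1 : ∑ k ∈ Finset.range i, Real.exp (-β * ((i : ℝ) - ((i + 1 - 1 - (k + 1) : ℕ) : ℝ)) ^ 2) =
      ∑ k ∈ Finset.range i, Real.exp (-β * ((k + 1 : ℕ) : ℝ) ^ 2) := by
    refine Finset.sum_congr rfl fun k hk => ?_
    rw [Finset.mem_range] at hk
    have : ((i + 1 - 1 - (k + 1) : ℕ) : ℝ) = (i : ℝ) - ((k + 1 : ℕ) : ℝ) := by
      rw [Nat.add_sub_cancel, Nat.cast_sub (by omega)]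
    rw [this]
    congr 2
    ring
  have h2 : ∑ k ∈ Finset.range t, Real.exp (-β * ((i : ℝ) - ((i + 1 + k : ℕ) : ℝ)) ^ 2) =
      ∑ k ∈ Finset.range t, Real.exp (-β * ((k + 1 : ℕ) : ℝ) ^ 2) := by
    refine Finset.sum_congr rfl fun k _ => ?_
    congr 2
    push_cast
    ring
  rw [h1, h2]
  have h3 := sum_gaussian_le hβ i
  have h4 := sum_gaussian_le hβ t
  simp only [Nat.add_sub_cancel, Nat.sub_zero, sub_self, zero_pow two_ne_zero, mul_zero,
    Real.exp_zero]
  linarith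

/-- From u_j u_k ≤ (u_j² + u_k²)/2, the symmetry of G and the bound on its row sums. -/
theorem schur_test {n : ℕ} (G : Fin n → Fin n → ℝ) (hG : ∀ j k, 0 ≤ G j k)
    (hs : ∀ j k, G j k = G k j) {c : ℝ} (hc : ∀ j, ∑ k, G j k ≤ c) (u : Fin n → ℝ) :
    ∑ j, ∑ k, u j * u k * G j k ≤ c * ∑ j, u j ^ 2 := by
  have h1 : ∑ j, ∑ k, u j * u k * G j k ≤ ∑ j, ∑ k, (u j ^ 2 / 2 * G j k + u k ^ 2 / 2 * G j k) := by
    refine Finset.sum_le_sum fun j _ => Finset.sum_le_sum fun k _ => ?_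
    rw [← add_mul]
    refine mul_le_mul_of_nonneg_right ?_ (hG j k)
    nlinarith [sq_nonneg (u j - u k)]
  have h2 : ∑ j, ∑ k, u j ^ 2 / 2 * G j k ≤ c / 2 * ∑ j, u j ^ 2 := by
    rw [Finset.mul_sum]
    refine Finset.sum_le_sum fun j _ => ?_
    rw [← Finset.mul_sum]
    have := mul_le_mul_of_nonneg_left (hc j) (show 0 ≤ u j ^ 2 / 2 by positivity)
    linarith
  have h3 : ∑ j, ∑ k, u k ^ 2 / 2 * G j k = ∑ j, ∑ k, u j ^ 2 / 2 * G j k := by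
    rw [Finset.sum_comm]
    exact Finset.sum_congr rfl fun j _ => Finset.sum_congr rfl fun k _ => by rw [hs]
  simp_rw [Finset.sum_add_distrib] at h1
  rw [h3] at h1
  linarith

end GaussianForms

/-! ### The Airy Hankel operator is a contraction. -/

section AiryHankel

/-- The Hankel structure turns the quadratic form into a contour integral of the square of one
exponential sum, the sum of v_j exp(-jh(a + iy)). Taking moduli leaves a Gaussian average of its
squared modulus. -/
theorem abs_airyForm_le_integral {a : ℝ} (ha : 0 < a) (s h : ℝ) {n : ℕ} (v : Fin n → ℝ) :
    |∑ j : Fin n, ∑ k : Fin n, v j * v k * airyAi (s + ((j : ℕ) + (k : ℕ)) * h)| ≤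
      Real.exp (a ^ 3 / 3 - s * a) * (1 / (2 * Real.pi)) *
        ∫ y : ℝ, Real.exp (-a * y ^ 2) *
          ‖∑ j : Fin n, ((v j * Real.exp (-(j * h * a)) : ℝ) : ℂ) *
            exp (((-(j * h) * y : ℝ) : ℂ) * I)‖ ^ 2 := by
  have hint := fun x : ℝ => integrable_airyIntegrand (p := fun _ => 1) ha (C := 1) (κ := 0)
    continuous_const (fun y => norm_one_le_exp y) x
  have hpt : ∀ y : ℝ, ∑ j : Fin n, ∑ k : Fin n, ((v j : ℂ) * v k) *
      (1 * exp (-((s + ((j : ℕ) + (k : ℕ)) * h : ℝ) : ℂ) * (a + y * I) + (a + y * I) ^ 3 / 3)) =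
      exp (-(s : ℂ) * (a + y * I) + (a + y * I) ^ 3 / 3) *
        (∑ j : Fin n, ((v j * Real.exp (-(j * h * a)) : ℝ) : ℂ) *
            exp (((-(j * h) * y : ℝ) : ℂ) * I)) ^ 2 := by
    intro y
    rw [sq, Finset.sum_mul_sum, Finset.mul_sum]
    refine Finset.sum_congr rfl fun j _ => ?_
    rw [Finset.mul_sum]
    refine Finset.sum_congr rfl fun k _ => ?_
    push_cast
    rw [show -((s : ℂ) + ((j : ℕ) + (k : ℕ)) * h) * (a + y * I) + (a + y * I) ^ 3 / 3 =
      (-(s : ℂ) * (a + y * I) + (a + y * I) ^ 3 / 3) + ((-((j : ℕ) * h * a) : ℂ) +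
        (-((j : ℕ) * h) * y * I)) + ((-((k : ℕ) * h * a) : ℂ) + (-((k : ℕ) * h) * y * I)) by ring]
    simp only [Complex.exp_add]
    ring
  have hC : ((∑ j : Fin n, ∑ k : Fin n, v j * v k * airyAi (s + ((j : ℕ) + (k : ℕ)) * h) : ℝ) : ℂ) =
      (1 / (2 * (Real.pi : ℂ))) * ∫ y : ℝ, exp (-(s : ℂ) * (a + y * I) + (a + y * I) ^ 3 / 3) *
        (∑ j : Fin n, ((v j * Real.exp (-(j * h * a)) : ℝ) : ℂ) *
            exp (((-(j * h) * y : ℝ) : ℂ) * I)) ^ 2 := by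
    simp_rw [← hpt]
    rw [integral_finsetSum _ fun j _ => integrable_finsetSum _ fun k _ => (hint _).const_mul _,
      Finset.mul_sum]
    simp_rw [ofReal_sum]
    refine Finset.sum_congr rfl fun j _ => ?_
    rw [integral_finsetSum _ fun k _ => (hint _).const_mul _, Finset.mul_sum]
    refine Finset.sum_congr rfl fun k _ => ?_
    rw [integral_const_mul, ofReal_mul, ofReal_mul, airyAi_eq ha, airyTransform]
    ring
  rw [← Real.norm_eq_abs, ← Complex.norm_real, hC, norm_mul]
  have h1 : ‖1 / (2 * (Real.pi : ℂ))‖ = 1 / (2 * Real.pi) := by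
    rw [norm_div, norm_one, norm_mul, Complex.norm_real, Real.norm_of_nonneg Real.pi_pos.le]
    norm_num
  rw [h1, mul_comm (Real.exp _), mul_assoc]
  refine mul_le_mul_of_nonneg_left ?_ (by positivity)
  rw [← integral_const_mul]
  refine norm_integral_le_of_norm_le ((integrable_gaussian_mul_norm_sq ha _ _).const_mul _)
    (Eventually.of_forall fun y => le_of_eq ?_)
  rw [norm_mul, norm_exp_cube, norm_pow]
  ring

/-- The bound on the norm of the discrete Airy form that comes from the line of abscissa `a`. -/
noncomputable def airyFormBound (s a h : ℝ) : ℝ :=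
  Real.exp (a ^ 3 / 3 - s * a) * (1 + h / √a)

/-- The Gaussian average is a form with entries exp(-h²(j - k)²/(4a)), whose row sums are at most 1
+ 2√(πa)/h. After the prefactors, the second term gives exactly 1 and the first an error of order
h/√a. The damping exp(-jha) ≤ 1 is simply dropped. -/
theorem abs_airyForm_le {a h : ℝ} (ha : 0 < a) (hh : 0 < h) (s : ℝ) {n : ℕ} (v : Fin n → ℝ) :
    h * |∑ j : Fin n, ∑ k : Fin n, v j * v k * airyAi (s + ((j : ℕ) + (k : ℕ)) * h)| ≤
      airyFormBound s a h * ∑ j, v j ^ 2 := by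
  have h0 := abs_airyForm_le_integral ha s h v
  rw [integral_gaussian_mul_norm_sq ha] at h0
  set u : Fin n → ℝ := fun j => v j * Real.exp (-(j * h * a)) with hu
  have hβ : 0 < h ^ 2 / (4 * a) := by positivity
  have h1 := schur_test (fun j k : Fin n =>
    Real.exp (-(-(((j : ℕ) : ℝ) * h) - -(((k : ℕ) : ℝ) * h)) ^ 2 / (4 * a)))
    (fun j k => (Real.exp_pos _).le) (fun j k => by congr 2; ring)
    (c := 1 + √(Real.pi / (h ^ 2 / (4 * a)))) (fun j => by
      refine le_trans (le_of_eq ?_) (sum_gaussian_row_le hβ j)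
      refine Finset.sum_congr rfl fun k _ => ?_
      congr 1
      field_simp
      ring) u
  have h2 : ∑ j, u j ^ 2 ≤ ∑ j, v j ^ 2 := by
    refine Finset.sum_le_sum fun j _ => ?_
    have e1 : Real.exp (-(((j : ℕ) : ℝ) * h * a)) ≤ 1 := by
      rw [Real.exp_le_one_iff]
      have : 0 ≤ ((j : ℕ) : ℝ) * h * a := by positivity
      linarith
    rw [hu]
    simp only
    rw [mul_pow]
    exact mul_le_of_le_one_right (sq_nonneg _) (pow_le_one₀ (Real.exp_pos _).le e1)
  have e2 : √(Real.pi / (h ^ 2 / (4 * a))) = 2 * √Real.pi * √a / h := by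
    rw [show Real.pi / (h ^ 2 / (4 * a)) = (2 * √Real.pi * √a / h) ^ 2 by
      rw [div_pow, mul_pow, mul_pow, Real.sq_sqrt Real.pi_pos.le, Real.sq_sqrt ha.le]
      field_simp
      ring, Real.sqrt_sq (by positivity)]
  have e3 : √(Real.pi / a) = √Real.pi / √a := Real.sqrt_div Real.pi_pos.le a
  rw [e2] at h1
  rw [e3] at h0
  have hpi : 0 < √Real.pi := Real.sqrt_pos.mpr Real.pi_pos
  have hsa : 0 < √a := Real.sqrt_pos.mpr ha
  have hpp : √Real.pi * √Real.pi = Real.pi := Real.mul_self_sqrt Real.pi_pos.le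
  have hV : 0 ≤ ∑ j, v j ^ 2 := Finset.sum_nonneg fun j _ => sq_nonneg _
  calc h * |∑ j : Fin n, ∑ k : Fin n, v j * v k * airyAi (s + ((j : ℕ) + (k : ℕ)) * h)|
      ≤ h * (Real.exp (a ^ 3 / 3 - s * a) * (1 / (2 * Real.pi)) * (√Real.pi / √a *
          ((1 + 2 * √Real.pi * √a / h) * ∑ j, v j ^ 2))) := by
        refine mul_le_mul_of_nonneg_left (h0.trans ?_) hh.le
        refine mul_le_mul_of_nonneg_left ?_ (by positivity)
        refine mul_le_mul_of_nonneg_left (h1.trans ?_) (by positivity)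
        exact mul_le_mul_of_nonneg_left h2 (by positivity)
    _ = Real.exp (a ^ 3 / 3 - s * a) * (1 + h / √a * (√Real.pi / (2 * Real.pi))) *
          ∑ j, v j ^ 2 := by
        field_simp
        linear_combination (2 * √a * ∑ j, v j ^ 2) * hpp
    _ ≤ Real.exp (a ^ 3 / 3 - s * a) * (1 + h / √a * 1) * ∑ j, v j ^ 2 := by
        have e4 : √Real.pi / (2 * Real.pi) ≤ 1 := by
          rw [div_le_one (by positivity)]
          have := Real.sqrt_le_sqrt (show Real.pi ≤ Real.pi ^ 2 by nlinarith [Real.pi_gt_three])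
          rw [Real.sqrt_sq Real.pi_pos.le] at this
          linarith [Real.pi_pos]
        gcongr
    _ = _ := by rw [airyFormBound, mul_one]

theorem airyFormBound_pos {a h : ℝ} (hh : 0 < h) (s : ℝ) : 0 < airyFormBound s a h := by
  unfold airyFormBound
  positivity

/-- Divided by its bound, the symmetric form has norm at most 1, so the identity minus it is
positive semidefinite. -/
theorem det_one_sub_airy_nonneg {a h : ℝ} (ha : 0 < a) (hh : 0 < h) (s ε : ℝ) (hε : |ε| = 1)
    (n : ℕ) : 0 ≤ (1 - h • Matrix.of fun j k : Fin n =>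
      ε * (airyFormBound s a h)⁻¹ * airyAi (s + ((j : ℕ) + (k : ℕ)) * h)).det := by
  have hρ := airyFormBound_pos (a := a) hh s
  refine (Matrix.PosSemidef.of_dotProduct_mulVec_nonneg ?_ fun v => ?_).det_nonneg
  · ext j k
    simp [Matrix.one_apply, eq_comm, add_comm]
  · have h1 := abs_airyForm_le ha hh s v
    have h2 : star v ⬝ᵥ (1 - h • Matrix.of fun j k : Fin n =>
        ε * (airyFormBound s a h)⁻¹ * airyAi (s + ((j : ℕ) + (k : ℕ)) * h)).mulVec v =
        ∑ j, v j ^ 2 - ε * (airyFormBound s a h)⁻¹ * (h *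
          ∑ j : Fin n, ∑ k : Fin n, v j * v k * airyAi (s + ((j : ℕ) + (k : ℕ)) * h)) := by
      rw [Matrix.sub_mulVec, Matrix.one_mulVec, dotProduct_sub]
      congr 1
      · simp [dotProduct, sq]
      · simp only [dotProduct, Matrix.mulVec, Finset.mul_sum, Matrix.smul_apply, Matrix.of_apply,
          smul_eq_mul, star_trivial]
        exact Finset.sum_congr rfl fun j _ => Finset.sum_congr rfl fun k _ => by ring
    rw [h2]
    set Q := ∑ j : Fin n, ∑ k : Fin n, v j * v k * airyAi (s + ((j : ℕ) + (k : ℕ)) * h)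
    have h3 : |ε * (airyFormBound s a h)⁻¹ * (h * Q)| ≤ ∑ j, v j ^ 2 := by
      rw [abs_mul, abs_mul, hε, one_mul, abs_of_pos (inv_pos.mpr hρ), abs_mul, abs_of_pos hh,
        inv_mul_le_iff₀ hρ]
      exact h1
    linarith [le_abs_self (ε * (airyFormBound s a h)⁻¹ * (h * Q))]

/-- The abscissa a = √h reconciles two demands: a → 0, so that the exponential prefactor tends to 1,
and h/√a = h^(3/4) → 0, so that the discretization error disappears. -/
theorem tendsto_airyFormBound (s : ℝ) :
    Tendsto (fun m => airyFormBound s (√(mesh m)) (mesh m)) atTop (𝓝 1) := by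
  have ha : Tendsto (fun m => √(mesh m)) atTop (𝓝 0) := by
    have := (Real.continuous_sqrt.tendsto 0).comp tendsto_mesh_zero
    rwa [Real.sqrt_zero] at this
  have hc : Continuous fun a : ℝ => Real.exp (a ^ 3 / 3 - s * a) * (1 + a * √a) := by fun_prop
  have h := (hc.tendsto 0).comp ha
  simp only [Real.sqrt_zero, mul_zero, add_zero, mul_one] at h
  norm_num at h
  refine h.congr fun m => ?_
  have hm := Real.sqrt_pos.mpr (mesh_pos m)
  have hm' := Real.sqrt_pos.mpr hm
  rw [Function.comp_apply, airyFormBound]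
  congr 2
  rw [eq_div_iff hm'.ne', mul_assoc, Real.mul_self_sqrt hm.le, Real.mul_self_sqrt (mesh_pos m).le]

theorem inv_airyFormBound_le (s : ℝ) (m : ℕ) :
    (airyFormBound s (√(mesh m)) (mesh m))⁻¹ ≤ Real.exp |s| := by
  have hm := mesh_pos m
  have ha0 := Real.sqrt_nonneg (mesh m)
  have ha1 : √(mesh m) ≤ 1 := Real.sqrt_le_one.mpr (mesh_le_one m)
  have h1 : Real.exp (-|s|) ≤ airyFormBound s (√(mesh m)) (mesh m) := by
    rw [airyFormBound]
    have e1 : Real.exp (-|s|) ≤ Real.exp (√(mesh m) ^ 3 / 3 - s * √(mesh m)) := by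
      apply Real.exp_le_exp.mpr
      have h2 : s * √(mesh m) ≤ |s| * 1 :=
        mul_le_mul (le_abs_self s) ha1 ha0 (abs_nonneg s)
      have h3 : 0 ≤ √(mesh m) ^ 3 / 3 := by positivity
      linarith
    refine e1.trans (le_mul_of_one_le_right (Real.exp_pos _).le ?_)
    have : 0 ≤ mesh m / √(√(mesh m)) := by positivity
    linarith
  rw [inv_le_comm₀ (airyFormBound_pos hm s) (Real.exp_pos _), ← Real.exp_neg]
  exact h1

/-- It is a limit of the nonnegative determinants above: the normalization of the matrices tends to
1, so it does not change the limit kernel. -/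
theorem fredholmDet_airy_nonneg (s ε : ℝ) (hε : |ε| = 1) :
    0 ≤ fredholmDet (cutoff s) fun r r' => ε * airyAi (r + r' - s) := by
  refine ge_of_tendsto' (tendsto_det_mesh (s := s)
    (A := fun m j k => ε * (airyFormBound s (√(mesh m)) (mesh m))⁻¹ *
      airyAi (s + ((j : ℕ) + (k : ℕ)) * mesh m))
    (K := fun r r' => ε * airyAi (r + r' - s)) (C := Real.exp |s| * airyBound)
    (mul_nonneg (Real.exp_pos _).le airyBound_nonneg) (fun m j k _ _ => ?_)
    fun r r' hr hr' => ?_)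
    fun m => det_one_sub_airy_nonneg (Real.sqrt_pos.mpr (mesh_pos m)) (mesh_pos m) s ε hε _
  · have hm := mesh_pos m
    have hj : (0 : ℝ) ≤ j * mesh m := by positivity
    have hk : (0 : ℝ) ≤ k * mesh m := by positivity
    have h1 := abs_airyAi_le (s + ((j : ℕ) + (k : ℕ)) * mesh m)
    have h2 := exp_neg_sub_le (s := s) (x := s + j * mesh m) (y := s + k * mesh m)
      (by linarith) (by linarith)
    rw [abs_mul, abs_mul, hε, one_mul,
      abs_of_pos (inv_pos.mpr (airyFormBound_pos (mesh_pos m) s)), mul_assoc]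
    refine mul_le_mul (inv_airyFormBound_le s m) (h1.trans ?_) (abs_nonneg _) (Real.exp_pos _).le
    refine mul_le_mul_of_nonneg_left (le_trans (le_of_eq ?_) h2) airyBound_nonneg
    congr 1
    ring
  · have hX : Tendsto (fun m => s + ((cellIndex s (mesh m) r : ℝ) + (cellIndex s (mesh m) r' : ℝ)) *
        mesh m) atTop (𝓝 (r + r' - s)) := by
      refine (((tendsto_node hr.le).add (tendsto_node hr'.le)).sub_const s).congr fun m => ?_
      rw [node, node]
      ring
    have h1 := (((tendsto_airyFormBound s).inv₀ one_ne_zero).const_mul ε).mul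
      ((continuous_airyAi.tendsto _).comp hX)
    rwa [inv_one, mul_one] at h1

end AiryHankel

/-! ### Comparison of the three limits, and the theorem. -/

section PfaffianDeterminant

theorem map_skewShift_mul_hankel (M : ℕ) (b : ℕ → ℝ) :
    (1 - (1 / 2 : ℂ) • (skewShift ℂ M * hankelMatrix ℂ M fun n => (b n : ℂ))).det =
      (((1 - (1 / 2 : ℝ) • (skewShift ℝ M * hankelMatrix ℝ M b)).det : ℝ) : ℂ) := by
  have h := RingHom.map_det Complex.ofRealHom
    (1 - (1 / 2 : ℝ) • (skewShift ℝ M * hankelMatrix ℝ M b))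
  rw [Complex.ofRealHom_eq_coe] at h
  rw [h]
  congr 1
  ext i j
  simp only [RingHom.mapMatrix_apply, Matrix.map_apply, Matrix.sub_apply, Matrix.smul_apply,
    Matrix.mul_apply, skewShift, shiftMatrix, Matrix.transpose_apply, Matrix.of_apply, hankelMatrix,
    Matrix.one_apply, Complex.ofRealHom_eq_coe, smul_eq_mul]
  push_cast [apply_ite]
  rfl

/-- The Fredholm Pfaffian of the GSE kernel is the nonnegative square root of the Fredholm
determinant of the scalar kernel. -/
theorem fredholmPfaffian_gse (s : ℝ) {a b : ℝ} (ha : 0 < a) (hb : 0 < b) : ∃ Q : ℝ, 0 ≤ Q ∧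
    fredholmPfaffian (cutoff s) (gseKernel a b) = (Q : ℂ) ∧
    fredholmDet (cutoff s) gldKernel = Q ^ 2 := by
  set q : ℕ → ℝ := fun m => (1 - (1 / 2 : ℝ) • (skewShift ℝ (meshCells m) *
    hankelMatrix ℝ (meshCells m) fun n => airyTail (s + n * mesh m))).det with hq
  set D : ℝ → ℝ := fun ε => fredholmDet (cutoff s) fun r r' => ε * airyAi (r + r' - s)
  -- The same real numbers q m have their limit computed three ways: as a half sum of nonnegative
  -- determinants, through their squares as the scalar Fredholm determinant, and as the Fredholm
  -- Pfaffian. Uniqueness of limits gives the identities.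
  have hq1 : Tendsto q atTop (𝓝 (1 / 2 * (D (-1) + D 1))) := by
    refine (((tendsto_det_hankelDiff s (-1) (by simp)).add
      (tendsto_det_hankelDiff s 1 (by simp))).const_mul (1 / 2)).congr fun m => ?_
    rw [hq]
    simp only
    rw [det_one_sub_half_skewShift, neg_one_smul, one_smul, sub_neg_eq_add]
  have hq2 : Tendsto (fun m => q m ^ 2) atTop (𝓝 (fredholmDet (cutoff s) gldKernel)) := by
    refine (tendsto_det_gld s).congr fun m => ?_
    rw [← det_one_sub_quarter_skewShift, hq]
    exact det_one_sub_skew_mul_symm _ _ skewShift_transpose (hankelMatrix_transpose _)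
  have hq3 := (tendsto_pfaffian_step s ha hb).congr fun m =>
    map_skewShift_mul_hankel (meshCells m) fun n => airyTail (s + n * mesh m)
  refine ⟨1 / 2 * (D (-1) + D 1), ?_, ?_, tendsto_nhds_unique hq2 (hq1.pow 2)⟩
  · have h1 := fredholmDet_airy_nonneg s (-1) (by simp)
    have h2 := fredholmDet_airy_nonneg s 1 (by simp)
    have h3 := add_nonneg h1 h2
    linarith
  · exact tendsto_nhds_unique hq3 ((Complex.continuous_ofReal.tendsto _).comp hq1)

end PfaffianDeterminant

theorem mainTheorem5 (s : ℝ)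
    -- the contours `cv t + iℝ`, `cw t + iℝ` of the hard-wall kernel at time `t`
    (cv cw : ℝ → ℝ)
    (hcv : ∀ t : ℝ, 0 < t → 0 < cv t ∧ cv t < t ^ (1 / 3 : ℝ) / 2)
    (hcw : ∀ t : ℝ, 0 < t → 0 < cw t ∧ cw t < t ^ (1 / 3 : ℝ) / 2)
    -- the contours `a + iℝ`, `b + iℝ` of the limit kernel
    (a b : ℝ) (ha : 0 < a) (hb : 0 < b) :
    -- the limit of the hard-wall matrix kernel, up to the symmetry, is the GSE kernel
    (∀ t : ℝ, 0 < t →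
      betaRescale (t ^ (1 / 6 : ℝ) / √Real.pi) (largeTimeKernel t a b) = gseKernel a b) ∧
    (∀ r r' : ℝ, Tendsto
      (fun t : ℝ => betaRescale (t ^ (1 / 6 : ℝ) / √Real.pi)
        (hardWallKernel t (cv t) (cw t)) r r') atTop (𝓝 (gseKernel a b r r'))) ∧
    -- the limit of the Fredholm Pfaffians
    (∀ t : ℝ, 0 < t → FredholmPfaffianConverges
      (fermiFactor t (Real.exp (-s * t ^ (1 / 3 : ℝ)))) (hardWallKernel t (cv t) (cw t))) ∧
    FredholmPfaffianConverges (cutoff s) (gseKernel a b) ∧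
    Tendsto
      (fun t : ℝ => fredholmPfaffian
        (fermiFactor t (Real.exp (-s * t ^ (1 / 3 : ℝ)))) (hardWallKernel t (cv t) (cw t)))
      atTop (𝓝 (fredholmPfaffian (cutoff s) (gseKernel a b))) ∧
    -- the identity with the scalar Fredholm determinant
    FredholmDetConverges (cutoff s) gldKernel ∧
    0 ≤ fredholmDet (cutoff s) gldKernel ∧
    fredholmPfaffian (cutoff s) (gseKernel a b) =
      ((√(fredholmDet (cutoff s) gldKernel) : ℝ) : ℂ) ∧
    (∀ t : ℝ, 0 < t →
      FredholmPfaffianConverges (cutoff s) (largeTimeKernel t a b) ∧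
      fredholmPfaffian (cutoff s) (largeTimeKernel t a b) =
        ((√(fredholmDet (cutoff s) gldKernel) : ℝ) : ℂ)) := by
  obtain ⟨Q, hQ, hPf, hDet⟩ := fredholmPfaffian_gse s ha hb
  have hroot : fredholmPfaffian (cutoff s) (gseKernel a b) =
      ((√(fredholmDet (cutoff s) gldKernel) : ℝ) : ℂ) := by
    rw [hPf, hDet, Real.sqrt_sq hQ]
  refine ⟨fun t ht => betaRescale_largeTimeKernel ht a b,
    tendsto_betaRescale_hardWallKernel (fun t ht => (hcv t ht).1) (fun t ht => (hcw t ht).1) ha hb,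
    fun t ht => hardWall_converges s ht (hcv t ht).1 (hcv t ht).2 (hcw t ht).1,
    gse_converges s ha hb,
    tendsto_fredholmPfaffian_hardWall s (fun t ht => (hcv t ht).1) (fun t ht => (hcw t ht).1) ha hb,
    gld_converges s, ?_, hroot, fun t ht => ⟨largeTime_converges s ht ha hb, ?_⟩⟩
  · rw [hDet]
    positivity
  · rw [fredholmPfaffian_largeTimeKernel s ht, hroot]
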